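/- **Setting.** For $\Delta\in\mathbb R$ let $h=2(\sigma^+\otimes\sigma^-+\sigma^-\otimes\sigma^+)+\Delta\,\sigma^z\otimes\sigma^z$ and $j=2(\sigma^x\otimes\sigma^y-\sigma^y\otimes\sigma^x)$, with $\sigma^\pm=\frac12(\sigma^x\pm i\sigma^y)$. On the open chain of $n$ spins $1/2$ let $H_n=\sum_{x=1}^{n-1}h_{x,x+1}$ (XXZ Hamiltonian), $J_n=\sum_{x=1}^{n-1}j_{x,x+1}$ (spin current), $J_n(t)=e^{itH_n}J_ne^{-itH_n}$, $\langle X\rangle_\beta=\operatorname{tr}(e^{-\beta H_n}X)/\operatorname{tr}(e^{-\beta H_n})$ and $\omega(X)=2^{-n}\operatorname{tr}X$. The thermal spin Drude weight is $$D^{\rm th}_\beta=\lim_{t\to\infty}\lim_{n\to\infty}\frac{\beta}{4nt}\int_{-t}^{t}\langle J_nJ_n(s)\rangle_\beta\,ds .$$ Let $S_n(\varepsilon)=\sum_{s\in\{0,+,-\}^n}\langle 0|A_{s_1}\cdots A_{s_n}|0\rangle\,\sigma^{s_1}\otimes\cdots\otimes\sigma^{s_n}$ ($\sigma^0=1$),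 where $A_0=\sum_{k\ge0}a_k|k\rangle\langle k|$, $A_+=\sum_{k\ge0}|k\rangle\langle k+1|$, $A_-=\sum_{k\ge0}b_k|k+1\rangle\langle k|$, $a_k=T_k(\Delta)+\frac{i\varepsilon}{2}U_{k-1}(\Delta)$ (Chebyshev polynomials), $b_0=i\varepsilon$, $b_{k+1}-b_k=a_{k+2}a_{k+1}-a_{k+1}a_k$. Let $Z_n$ be the first-order coefficient in $S_n(\varepsilon)=1+i\varepsilon Z_n+O(\varepsilon^2)$ and $Q_n=i(Z_n-Z_n^\dagger)$ (the charge $Q_{[Z]}$). For $m\ge 2$ and $\gamma\in\mathbb R$ let $A^Z_0=|L\rangle\langle L|+|R\rangle\langle R|+\sum_{k=1}^{m-1}\cos(\gamma k)|k\rangle\langle k|$, $A^Z_+=|L\rangle\langle1|+\sum_{k=1}^{m-2}\sin(\gamma(k+1))|k\rangle\langle k+1|$, $A^Z_-=|1\rangle\langle R|-\sum_{k=1}^{m-2}\sin(\gamma k)|k+1\rangle\langle k|$ on the basis $|L\rangle,|R\rangle,|1\rangle,\dots,|m-1\rangle$, and let $T$ be the $(m+1)$-dimensional restriction of $A^Z_0\otimes\overline{A^Z_0}+\frac12(A^Z_+\otimes\overline{A^Z_+}+A^Z_-\otimes\overline{A^Z_-})$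 to the invariant span of the vectors $|i\rangle\otimes|i\rangle$. **Theorem.** Let $\mathcal R=\{\cos(\pi l/m): l\in\mathbb Z,\ m\ge2,\ \gcd(l,m)=1\}$. There is a function $D_Z$, determined on $\mathcal R$ by $$D_Z=\tfrac12(1-\Delta^2)\,\frac{m}{m-1}\qquad\text{at }\Delta=\cos(\pi l/m),$$ such that for all such $l,m$, with $\gamma=\pi l/m$ and $\Delta=\cos\gamma$: 1. $[H_n,Q_n]=-2i(\sigma^z_1-\sigma^z_n)$ for all $n \geq 1$, and $Q$ is pseudo-local: $Q_n=\sum_{d=1}^n\sum_{x}q^{(d)}_x$ is a translation-invariant sum of $n$-independent hermitian traceless densities $q^{(d)}$ on $d$ consecutive sites with $\omega((q^{(d)})^2)\le\zeta e^{-\xi d}$ for some $\zeta,\xi>0$. 2. $\omega(Q_n^2)=2\langle L|T^n|R\rangle$ for all $n$. The Jordan form of $T$ has exactly one nontrivial block, of size $2$ and eigenvalue $1$; all other eigenvalues have modulus $<1$; and $\frac14\lim_{n\to\infty} n/\langle L|T^n|R\rangle=D_Z$. 3. $\displaystyle\lim_{n\to\infty}\frac1{2n}\frac{\omega(J_nQ_n)^2}{\omega(Q_n^2)}=4D_Z$.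 4. The limits defining $D^{\rm th}_\beta$ exist for all sufficiently small $\beta>0$, and $\liminf_{\beta\to0^+}D^{\rm th}_\beta/\beta\ge4D_Z$ (so $\lim_{\beta\to0^+}D^{\rm th}_\beta/\beta\ge 4D_Z$ whenever this limit exists). Likewise at infinite temperature the limits $C(s)=\lim_n\frac1n\omega(J_nJ_n(s))$ and $\kappa=\lim_{t\to\infty}\frac1{2t}\int_0^tC(s)\,ds$ exist, and $\kappa\ge4D_Z$. Moreover $\mathcal R$ is dense in $[-1,1]$, and $D_Z:\mathcal R\to\mathbb R$ is discontinuous at every point of $\mathcal R$. -/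

import Mathlib

open Filter Topology

noncomputable section

namespace XXZ

/-! ### Finite spin-1/2 chains -/

/-- Operators on a chain of `n` spins `1/2`, as matrices in the product basis
(`0` is spin up, `1` is spin down). -/
abbrev Op (n : ℕ) : Type := Matrix (Fin n → Fin 2) (Fin n → Fin 2) ℂ

def sigmaX : Matrix (Fin 2) (Fin 2) ℂ := !![0, 1; 1, 0]
def sigmaY : Matrix (Fin 2) (Fin 2) ℂ := !![0, -Complex.I; Complex.I, 0]
def sigmaZ : Matrix (Fin 2) (Fin 2) ℂ := !![1, 0; 0, -1]

/-- `(σˣ + i σʸ) / 2` -/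
def sigmaPlus : Matrix (Fin 2) (Fin 2) ℂ := !![0, 1; 0, 0]

/-- `(σˣ - i σʸ) / 2` -/
def sigmaMinus : Matrix (Fin 2) (Fin 2) ℂ := !![0, 0; 1, 0]

/-- The product operator `M 0 ⊗ M 1 ⊗ ⋯ ⊗ M (n - 1)`. -/
def tensor {n : ℕ} (M : Fin n → Matrix (Fin 2) (Fin 2) ℂ) : Op n :=
  Matrix.of fun a b => ∏ i, M i (a i) (b i)

/-- The operator on `n` sites acting as `q` on the `d` consecutive sites `x, …, x + d - 1`
(sites are counted from `0`) and as the identity elsewhere; `0` if these sites do not fit. -/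
def shift (n x : ℕ) {d : ℕ} (q : Op d) : Op n :=
  if hx : x + d ≤ n then
    Matrix.of fun a b =>
      if ∀ i : Fin n, (i.val < x ∨ x + d ≤ i.val) → a i = b i then
        q (fun i => a ⟨x + i.val, by omega⟩) (fun i => b ⟨x + i.val, by omega⟩)
      else 0
  else 0

/-- The XXZ interaction `2 (σ⁺ ⊗ σ⁻ + σ⁻ ⊗ σ⁺) + Δ σᶻ ⊗ σᶻ`. -/
def interaction (Δ : ℝ) : Op 2 :=
  (2 : ℂ) • (tensor ![sigmaPlus, sigmaMinus] + tensor ![sigmaMinus, sigmaPlus]) +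
    (Δ : ℂ) • tensor ![sigmaZ, sigmaZ]

/-- The spin current density `2 (σˣ ⊗ σʸ - σʸ ⊗ σˣ)`. -/
def currentDensity : Op 2 :=
  (2 : ℂ) • (tensor ![sigmaX, sigmaY] - tensor ![sigmaY, sigmaX])

/-- The XXZ Hamiltonian on `n` sites with open boundaries. -/
def hamiltonian (Δ : ℝ) (n : ℕ) : Op n :=
  ∑ x ∈ Finset.range (n - 1), shift n x (interaction Δ)

/-- The extensive spin current on `n` sites. -/
def spinCurrent (n : ℕ) : Op n :=
  ∑ x ∈ Finset.range (n - 1), shift n x currentDensity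

/-- Heisenberg evolution `exp(i t H) X exp(-i t H)`. -/
def evolve (Δ : ℝ) (n : ℕ) (t : ℝ) (X : Op n) : Op n :=
  NormedSpace.exp ((Complex.I * t) • hamiltonian Δ n) * X *
    NormedSpace.exp (-(Complex.I * t) • hamiltonian Δ n)

/-- The Gibbs state at inverse temperature `β`. -/
def gibbs (Δ β : ℝ) (n : ℕ) (X : Op n) : ℂ :=
  (NormedSpace.exp (-(β : ℂ) • hamiltonian Δ n) * X).trace /
    (NormedSpace.exp (-(β : ℂ) • hamiltonian Δ n)).trace

/-- The tracial (infinite-temperature) state. -/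
def tracial {n : ℕ} (X : Op n) : ℂ := X.trace / 2 ^ n

/-! ### The thermal Drude weight -/

/-- `D` is the thermal spin Drude weight
`lim_{t → ∞} lim_{n → ∞} β / (4 n t) ∫_{-t}^{t} ⟨J_n(0) J_n(s)⟩_β ds`
(both limits exist, and the iterated limit is `D`). -/
def IsThermalDrudeWeight (Δ β D : ℝ) : Prop :=
  ∃ g : ℝ → ℂ,
    (∀ t : ℝ, 0 < t →
      Tendsto (fun n : ℕ => (β : ℂ) / (4 * n * t) *
        ∫ s in (-t)..t, gibbs Δ β n (spinCurrent n * evolve Δ n s (spinCurrent n)))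
        atTop (𝓝 (g t))) ∧
    Tendsto g atTop (𝓝 (D : ℂ))

/-- `κ` is the infinite-temperature Drude weight with its prefactor `β` removed:
`κ = lim_{t → ∞} (2 t)⁻¹ ∫_0^t C(s) ds`, where `C(s) = lim_{n → ∞} n⁻¹ ω(J_n J_n(s))`
in the tracial state `ω` (all limits exist). -/
def IsInfiniteTemperatureDrudeRatio (Δ κ : ℝ) : Prop :=
  ∃ C : ℝ → ℂ,
    (∀ s : ℝ, Tendsto (fun n : ℕ =>
      tracial (spinCurrent n * evolve Δ n s (spinCurrent n)) / n) atTop (𝓝 (C s))) ∧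
    Tendsto (fun t : ℝ => (1 / (2 * (t : ℂ))) * ∫ s in (0 : ℝ)..t, C s) atTop (𝓝 (κ : ℂ))

/-! ### The operator `S_n(ε)` and the charge `Q_[Z]` -/

/-- `a_k = T_k(Δ) + (i ε / 2) U_{k-1}(Δ)` -/
def ampZero (Δ : ℝ) (ε : ℂ) (k : ℕ) : ℂ :=
  (Polynomial.Chebyshev.T ℂ (k : ℤ)).eval (Δ : ℂ) +
    Complex.I * ε / 2 * (Polynomial.Chebyshev.U ℂ ((k : ℤ) - 1)).eval (Δ : ℂ)

/-- `b_0 = i ε`, `b_{k+1} - b_k = a_{k+2} a_{k+1} - a_{k+1} a_k` -/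
def ampProd (Δ : ℝ) (ε : ℂ) : ℕ → ℂ
  | 0 => Complex.I * ε
  | k + 1 => ampProd Δ ε k + ampZero Δ ε (k + 2) * ampZero Δ ε (k + 1) -
      ampZero Δ ε (k + 1) * ampZero Δ ε k

/-- `A_0 = ∑ a_k |k⟩⟨k|` -/
def auxZero (Δ : ℝ) (ε : ℂ) : Module.End ℂ (ℕ → ℂ) where
  toFun v k := ampZero Δ ε k * v k
  map_add' v w := by funext k; simp [mul_add]
  map_smul' c v := by funext k; simp [mul_left_comm]

/-- `A_+ = ∑ |k⟩⟨k+1|` (only the products `b_k` of the amplitudes of `A_+` and `A_-` enter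
`S_n(ε)`; the gauge chosen here has all amplitudes of `A_+` equal to `1`). -/
def auxPlus : Module.End ℂ (ℕ → ℂ) where
  toFun v k := v (k + 1)
  map_add' v w := by funext k; simp
  map_smul' c v := by funext k; simp

/-- `A_- = ∑ b_k |k+1⟩⟨k|` -/
def auxMinus (Δ : ℝ) (ε : ℂ) : Module.End ℂ (ℕ → ℂ) where
  toFun v k := match k with
    | 0 => 0
    | k + 1 => ampProd Δ ε k * v k
  map_add' v w := by funext k; cases k <;> simp [mul_add]
  map_smul' c v := by funext k; cases k <;> simp [mul_left_comm]

/-- `S_n(ε) = ∑_s ⟨0| A_{s_1} ⋯ A_{s_n} |0⟩ σ^{s_1} ⊗ ⋯ ⊗ σ^{s_n}`, with `s_i ∈ {0, +, -}`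
coded as `0, 1, 2`. -/
def sOperator (Δ : ℝ) (n : ℕ) (ε : ℂ) : Op n :=
  ∑ s : Fin n → Fin 3,
    ((List.ofFn fun i => ![auxZero Δ ε, auxPlus, auxMinus Δ ε] (s i)).prod
        (Pi.single 0 1) 0) •
      tensor fun i => ![1, sigmaPlus, sigmaMinus] (s i)

/-- The first-order coefficient `Z_n` in `S_n(ε) = 1 + i ε Z_n + O(ε²)`. -/
def zOperator (Δ : ℝ) (n : ℕ) : Op n :=
  Matrix.of fun a b => -Complex.I * deriv (fun ε : ℂ => sOperator Δ n ε a b) 0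

/-- The charge `Q_[Z] = i (Z - Z†)`. -/
def chargeZ (Δ : ℝ) (n : ℕ) : Op n :=
  Complex.I • (zOperator Δ n - (zOperator Δ n).conjTranspose)

/-- A family `Q n` of operators is pseudo-local: it is a translation invariant sum of traceless
hermitian densities on `d` sites, `d = 1, …, n`, whose Hilbert-Schmidt norms decay exponentially
in `d`. -/
def IsPseudoLocal (Q : ∀ n : ℕ, Op n) : Prop :=
  ∃ q : ∀ d : ℕ, Op d, ∃ ζ ξ : ℝ, 0 < ζ ∧ 0 < ξ ∧
    (∀ d : ℕ, 1 ≤ d → (q d).IsHermitian ∧ tracial (q d) = 0 ∧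
      (tracial (q d * q d)).re ≤ ζ * Real.exp (-ξ * d)) ∧
    ∀ n : ℕ, Q n = ∑ d ∈ Finset.Icc 1 n, ∑ x ∈ Finset.range (n - d + 1), shift n x (q d)

/-! ### The auxiliary transfer matrix -/

/-- Labels of the auxiliary basis `|L⟩, |R⟩, |1⟩, …, |m-1⟩`: `inl 0` is `L`, `inl 1` is `R`,
and `inr k` is `k + 1`. -/
abbrev Aux (m : ℕ) : Type := Fin 2 ⊕ Fin (m - 1)

/-- `|L⟩⟨L| + |R⟩⟨R| + ∑ cos(γ k) |k⟩⟨k|` -/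
def auxZ0 (γ : ℝ) (m : ℕ) : Matrix (Aux m) (Aux m) ℂ :=
  Matrix.of fun i j => match i, j with
    | .inl i, .inl j => if i = j then 1 else 0
    | .inr k, .inr k' => if k = k' then (Real.cos (γ * (k.val + 1)) : ℂ) else 0
    | _, _ => 0

/-- `|L⟩⟨1| + ∑ sin(γ (k + 1)) |k⟩⟨k+1|` -/
def auxZPlus (γ : ℝ) (m : ℕ) : Matrix (Aux m) (Aux m) ℂ :=
  Matrix.of fun i j => match i, j with
    | .inl i, .inr k => if i = 0 ∧ k.val = 0 then 1 else 0
    | .inr k, .inr k' => if k'.val = k.val + 1 then (Real.sin (γ * (k.val + 2)) : ℂ) else 0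
    | _, _ => 0

/-- `|1⟩⟨R| - ∑ sin(γ k) |k+1⟩⟨k|` -/
def auxZMinus (γ : ℝ) (m : ℕ) : Matrix (Aux m) (Aux m) ℂ :=
  Matrix.of fun i j => match i, j with
    | .inr k, .inl j => if j = 1 ∧ k.val = 0 then 1 else 0
    | .inr k', .inr k => if k'.val = k.val + 1 then -(Real.sin (γ * (k.val + 1)) : ℂ) else 0
    | _, _ => 0

open scoped Kronecker in
/-- The transfer matrix
`A_0 ⊗ conj A_0 + (A_+ ⊗ conj A_+ + A_- ⊗ conj A_-) / 2`,
restricted to the span of the diagonal vectors `|i⟩ ⊗ |i⟩`, which it leaves invariant: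
an `(m + 1)`-dimensional matrix. -/
def transfer (γ : ℝ) (m : ℕ) : Matrix (Aux m) (Aux m) ℂ :=
  (auxZ0 γ m ⊗ₖ (auxZ0 γ m).map star +
    (1 / 2 : ℂ) • (auxZPlus γ m ⊗ₖ (auxZPlus γ m).map star +
      auxZMinus γ m ⊗ₖ (auxZMinus γ m).map star)).submatrix (fun i => (i, i)) (fun i => (i, i))

/-- The Jordan form of the square matrix `M` has exactly one block of size larger than `1`; this
block has size `2` and eigenvalue `1`, there is no other block with eigenvalue `1`, and all other
eigenvalues have modulus less than `1`. -/
def HasSingleJordanBlock {ι : Type*} [Fintype ι] [DecidableEq ι] (M : Matrix ι ι ℂ) : Prop :=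
  Module.finrank ℂ (Module.End.eigenspace (Matrix.toLin' M) 1) = 1 ∧
  Module.finrank ℂ (Module.End.maxGenEigenspace (Matrix.toLin' M) 1) = 2 ∧
  ∀ μ : ℂ, μ ≠ 1 → Module.End.HasEigenvalue (Matrix.toLin' M) μ →
    ‖μ‖ < 1 ∧ Module.End.maxGenEigenspace (Matrix.toLin' M) μ =
      Module.End.eigenspace (Matrix.toLin' M) μ

/-- The resonant anisotropies `cos(π l / m)`, with `l, m` coprime integers and `m > 1`. -/
def resonant : Set ℝ :=
  {Δ | ∃ (l : ℤ) (m : ℕ), 2 ≤ m ∧ IsCoprime l (m : ℤ) ∧ Δ = Real.cos (Real.pi * l / m)}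

end XXZ

end

/-! The proof joins exact algebra for one charge with a Mazur inequality that survives the
thermodynamic limit.

Algebra. At `ε = 0` the amplitude `b_0` vanishes and `S_n` is the identity. Its first-order term is
a matrix product whose auxiliary path starts at `|L⟩`, wanders among the states `1, 2, …` and is
absorbed at `|R⟩` (`hasDerivAt_sTail`). The trigonometric amplitudes make the commutator with the
Hamiltonian telescope to boundary terms (`hamComm_mpoTail`, `hamComm_mpo`). Squared Hilbert-Schmidt
norms obey a linear recursion in the auxiliary state. Written for the sequence multiplied by
`sin²(kγ)`, it is the identity plus half a discrete Laplacian (`normStep_eq`), and `sin(mγ) = 0`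
puts an absorbing wall at `m`. The harmonic profile `(m - k)/m` yields the norm density `(m - 1)/(m
sin²γ)` of the charge, hence `D_Z`. The parabola `k(m - k)` is a strict supersolution: it yields
exponential decay of the densities and confines the remaining eigenvalues to the open disc. Symmetry
of the Laplacian excludes further Jordan blocks.

Mazur bound. In an eigenbasis of the Hamiltonian the current autocorrelation is a sum of
exponentials with nonnegative amplitudes, and its long-time mean is the weight at frequency zero.
The limit `n → ∞` must be taken first, at every fixed time. A cluster expansion (Möbius transform
over sets of bonds) combined with the one-dimensional renewal equation gives convergence and uniform
bounds for small `β` and small complex time (`exists_thermodynamic_limit`). The same bounds at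
imaginary time are exponential moments of the spectral measures, so convergence of characteristic
functions near zero already implies weak convergence, and with it convergence at all real times
(`exists_tendsto_of_tendsto_charFun_near_zero`). The Mazur inequality is proved at finite `n` with
the test function `1/(1 + K|ω|)`; its error is governed by the commutator of the charge with the
Hamiltonian, which stays bounded in `n`, and `K → ∞` isolates the atom at zero (`mazur_bound`).

The current and the charge are odd under transposition while the Hamiltonian is even. Their thermal
means therefore vanish, and correlations behave as derivations over the partition function
(`correlation_joinBonds`). As `β → 0+` correlation densities tend to their tracial values
(`tendsto_correlation_density`), and the bound becomes `2²/(2 · chargeNorm) = 4 D_Z`.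

Finally, `D_Z` depends on the denominator `m`, and every resonant point is a limit of resonant
points with denominators tending to infinity, along which `m/(m - 1)` tends to `1`. -/

namespace XXZ

/-! ### Translation of local operators: star homomorphism, trace, products of adjacent blocks. -/

section ShiftAlgebra

open scoped Kronecker

/-- Splitting a configuration on `n` sites into its restrictions to the block `x, …, x + d - 1` and
to the complement of this block. -/
def blockEquiv (n x d : ℕ) (hx : x + d ≤ n) :
    (Fin n → Fin 2) ≃
      (Fin d → Fin 2) × ({i : Fin n // ¬ (x ≤ i.val ∧ i.val < x + d)} → Fin 2) :=
  (Equiv.piEquivPiSubtypeProd (fun i : Fin n => x ≤ i.val ∧ i.val < x + d)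
      (fun _ => Fin 2)).trans
    (Equiv.prodCongr
      (Equiv.arrowCongr
        { toFun := fun i => ⟨i.1.val - x, by have := i.2; omega⟩
          invFun := fun i => ⟨⟨x + i.val, by omega⟩, by simp⟩
          left_inv := fun i => by
            have := i.2
            ext
            simp only
            omega
          right_inv := fun i => by ext; simp }
        (Equiv.refl _))
      (Equiv.refl _))

/-- Reindexing by block and complement turns a translate into `q ⊗ 1`, which reduces products,
adjoints and traces to Kronecker products. -/
theorem shift_eq_kronecker (n x : ℕ) {d : ℕ} (hx : x + d ≤ n) (q : Op d) :
    shift n x q = (q ⊗ₖ (1 : Matrix ({i : Fin n // ¬ (x ≤ i.val ∧ i.val < x + d)} → Fin 2)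
      ({i : Fin n // ¬ (x ≤ i.val ∧ i.val < x + d)} → Fin 2) ℂ)).submatrix
        (blockEquiv n x d hx) (blockEquiv n x d hx) := by
  ext a b
  have key : (∀ i : Fin n, (i.val < x ∨ x + d ≤ i.val) → a i = b i) ↔
      (blockEquiv n x d hx a).2 = (blockEquiv n x d hx b).2 := by
    constructor
    · intro h
      funext i
      have := i.2
      exact h i.1 (by omega)
    · intro h i hi
      exact congrFun h ⟨i, by omega⟩
  rw [shift, dif_pos hx, Matrix.of_apply, Matrix.submatrix_apply, Matrix.kroneckerMap_apply,
    Matrix.one_apply]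
  by_cases hab : (blockEquiv n x d hx a).2 = (blockEquiv n x d hx b).2
  · rw [if_pos (key.2 hab), if_pos hab, mul_one]
    rfl
  · rw [if_neg (fun h => hab (key.1 h)), if_neg hab, mul_zero]

theorem shift_of_not_le {n x d : ℕ} (hx : ¬ x + d ≤ n) (q : Op d) : shift n x q = 0 := by
  rw [shift, dif_neg hx]

theorem shift_mul {n x d : ℕ} (p q : Op d) :
    shift n x (p * q) = shift n x p * shift n x q := by
  by_cases hx : x + d ≤ n
  · rw [shift_eq_kronecker n x hx, shift_eq_kronecker n x hx, shift_eq_kronecker n x hx,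
      Matrix.submatrix_mul_equiv, ← Matrix.mul_kronecker_mul, one_mul]
  · simp [shift_of_not_le hx]

theorem shift_one {n x d : ℕ} (hx : x + d ≤ n) : shift n x (1 : Op d) = 1 := by
  rw [shift_eq_kronecker n x hx, Matrix.one_kronecker_one, Matrix.submatrix_one_equiv]

theorem shift_add {n x d : ℕ} (p q : Op d) :
    shift n x (p + q) = shift n x p + shift n x q := by
  by_cases hx : x + d ≤ n
  · rw [shift_eq_kronecker n x hx, shift_eq_kronecker n x hx, shift_eq_kronecker n x hx,
      Matrix.add_kronecker, Matrix.submatrix_add]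
    rfl
  · simp [shift_of_not_le hx]

theorem shift_smul {n x d : ℕ} (c : ℂ) (q : Op d) : shift n x (c • q) = c • shift n x q := by
  by_cases hx : x + d ≤ n
  · rw [shift_eq_kronecker n x hx, shift_eq_kronecker n x hx, Matrix.smul_kronecker,
      Matrix.submatrix_smul]
    rfl
  · simp [shift_of_not_le hx]

theorem shift_conjTranspose {n x d : ℕ} (q : Op d) :
    shift n x q.conjTranspose = (shift n x q).conjTranspose := by
  by_cases hx : x + d ≤ n
  · rw [shift_eq_kronecker n x hx, shift_eq_kronecker n x hx, Matrix.conjTranspose_submatrix,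
      Matrix.conjTranspose_kronecker, Matrix.conjTranspose_one]
  · simp [shift_of_not_le hx]

theorem shift_transpose {n x d : ℕ} (q : Op d) :
    shift n x q.transpose = (shift n x q).transpose := by
  by_cases hx : x + d ≤ n
  · rw [shift_eq_kronecker n x hx, shift_eq_kronecker n x hx, Matrix.transpose_submatrix,
      ← Matrix.kroneckerMap_transpose, Matrix.transpose_one]
  · simp [shift_of_not_le hx]

/-- Translation of operators, as a linear map. -/
def shiftLinear (n x d : ℕ) : Op d →ₗ[ℂ] Op n where
  toFun := shift n x
  map_add' := shift_add
  map_smul' := shift_smul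

@[simp] theorem shiftLinear_apply {n x d : ℕ} (q : Op d) : shiftLinear n x d q = shift n x q := rfl

theorem shift_zero {n x d : ℕ} : shift n x (0 : Op d) = 0 := map_zero (shiftLinear n x d)

theorem shift_sub {n x d : ℕ} (p q : Op d) :
    shift n x (p - q) = shift n x p - shift n x q := map_sub (shiftLinear n x d) p q

theorem shift_sum {ι : Type*} {n x d : ℕ} (s : Finset ι) (f : ι → Op d) :
    shift n x (∑ i ∈ s, f i) = ∑ i ∈ s, shift n x (f i) := map_sum (shiftLinear n x d) f s

/-- Translation of operators into a larger chain, as a star algebra homomorphism. -/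
def shiftHom (n x d : ℕ) (hx : x + d ≤ n) : Op d →⋆ₐ[ℂ] Op n where
  toFun := shift n x
  map_one' := shift_one hx
  map_mul' := shift_mul
  map_zero' := shift_zero
  map_add' := shift_add
  commutes' := fun c => by
    rw [Algebra.algebraMap_eq_smul_one, Algebra.algebraMap_eq_smul_one, shift_smul, shift_one hx]
  map_star' := shift_conjTranspose

@[simp] theorem shiftHom_apply {n x d : ℕ} (hx : x + d ≤ n) (q : Op d) :
    shiftHom n x d hx q = shift n x q := rfl

theorem shift_shift {n x d y e : ℕ} (hx : x + d ≤ n) (hy : y + e ≤ d) (q : Op e) :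
    shift n x (shift d y q) = shift n (x + y) q := by
  ext a b
  have h3 : x + y + e ≤ n := by omega
  simp only [shift, dif_pos hx, dif_pos hy, dif_pos h3, Matrix.of_apply]
  by_cases h : ∀ i : Fin n, (i.val < x + y ∨ x + y + e ≤ i.val) → a i = b i
  · have h1 : ∀ i : Fin n, (i.val < x ∨ x + d ≤ i.val) → a i = b i :=
      fun i hi => h i (by omega)
    have h2 : ∀ i : Fin d, (i.val < y ∨ y + e ≤ i.val) →
        a ⟨x + i.val, by omega⟩ = b ⟨x + i.val, by omega⟩ :=
      fun i hi => h ⟨x + i.val, by omega⟩ (by simp only; omega)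
    rw [if_pos h, if_pos h1, if_pos h2]
    simp only [add_assoc]
  · rw [if_neg h]
    by_cases h1 : ∀ i : Fin n, (i.val < x ∨ x + d ≤ i.val) → a i = b i
    · rw [if_pos h1, if_neg]
      intro h2
      apply h
      intro i hi
      by_cases hi' : i.val < x ∨ x + d ≤ i.val
      · exact h1 i hi'
      · have := h2 ⟨i.val - x, by omega⟩ (by simp only; omega)
        simpa [show x + (i.val - x) = i.val by omega] using this
    · rw [if_neg h1]

theorem blockEquiv_card {n x d : ℕ} (hx : x + d ≤ n) :
    (2 : ℂ) ^ n = 2 ^ d *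
      (Fintype.card ({i : Fin n // ¬ (x ≤ i.val ∧ i.val < x + d)} → Fin 2) : ℂ) := by
  have := Fintype.card_congr (blockEquiv n x d hx)
  rw [Fintype.card_prod, Fintype.card_fun, Fintype.card_fun, Fintype.card_fin, Fintype.card_fin,
    Fintype.card_fin] at this
  exact_mod_cast this

theorem trace_submatrix_equiv {ι κ : Type*} [Fintype ι] [Fintype κ] (e : ι ≃ κ)
    (M : Matrix κ κ ℂ) : (M.submatrix e e).trace = M.trace :=
  Equiv.sum_comp e fun i => M i i

theorem tracial_shift {n x d : ℕ} (hx : x + d ≤ n) (q : Op d) :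
    tracial (shift n x q) = tracial q := by
  have h2 := blockEquiv_card hx
  have h3 : (2 : ℂ) ^ n ≠ 0 := pow_ne_zero _ two_ne_zero
  have h4 : (2 : ℂ) ^ d ≠ 0 := pow_ne_zero _ two_ne_zero
  unfold tracial
  rw [shift_eq_kronecker n x hx, trace_submatrix_equiv, Matrix.trace_kronecker,
    Matrix.trace_one, div_eq_div_iff h3 h4, h2]
  ring

theorem tracial_one (n : ℕ) : tracial (1 : Op n) = 1 := by
  unfold tracial
  rw [Matrix.trace_one, Fintype.card_fun, Fintype.card_fin, Fintype.card_fin]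
  push_cast
  exact div_self (pow_ne_zero _ two_ne_zero)

theorem tracial_add {n : ℕ} (A B : Op n) : tracial (A + B) = tracial A + tracial B := by
  simp [tracial, add_div]

theorem tracial_smul {n : ℕ} (c : ℂ) (A : Op n) : tracial (c • A) = c * tracial A := by
  simp [tracial, mul_div_assoc]

/-- The tracial state, as a linear map. -/
noncomputable def tracialLinear (n : ℕ) : Op n →ₗ[ℂ] ℂ where
  toFun := tracial
  map_add' := tracial_add
  map_smul' := tracial_smul

@[simp] theorem tracialLinear_apply {n : ℕ} (A : Op n) : tracialLinear n A = tracial A := rfl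

theorem tracial_zero (n : ℕ) : tracial (0 : Op n) = 0 := map_zero (tracialLinear n)

theorem tracial_sub {n : ℕ} (A B : Op n) : tracial (A - B) = tracial A - tracial B :=
  map_sub (tracialLinear n) A B

theorem tracial_sum {ι : Type*} {n : ℕ} (s : Finset ι) (f : ι → Op n) :
    tracial (∑ i ∈ s, f i) = ∑ i ∈ s, tracial (f i) := map_sum (tracialLinear n) f s

theorem tracial_mul_comm {n : ℕ} (A B : Op n) : tracial (A * B) = tracial (B * A) := by
  unfold tracial
  rw [Matrix.trace_mul_comm]

theorem tracial_conjTranspose {n : ℕ} (A : Op n) :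
    tracial A.conjTranspose = starRingEnd ℂ (tracial A) := by
  unfold tracial
  rw [Matrix.trace_conjTranspose]
  simp [map_ofNat]

theorem tracial_transpose {n : ℕ} (A : Op n) : tracial A.transpose = tracial A := by
  unfold tracial
  rw [Matrix.trace_transpose]

/-- When two blocks fill the chain, the splitting `Fin.appendEquiv` serves both; `blockEquiv` would
give each block its own complement. -/
theorem shift_left_eq_kronecker (k l : ℕ) (A : Op k) :
    shift (k + l) 0 A = (A ⊗ₖ (1 : Op l)).submatrix
      (Fin.appendEquiv (α := Fin 2) k l).symm (Fin.appendEquiv (α := Fin 2) k l).symm := by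
  ext a b
  rw [shift, dif_pos (by omega), Matrix.of_apply, Matrix.submatrix_apply,
    Matrix.kroneckerMap_apply, Matrix.one_apply]
  have key : (∀ i : Fin (k + l), (i.val < 0 ∨ 0 + k ≤ i.val) → a i = b i) ↔
      ((Fin.appendEquiv (α := Fin 2) k l).symm a).2 =
        ((Fin.appendEquiv (α := Fin 2) k l).symm b).2 := by
    constructor
    · intro h
      funext i
      exact h (Fin.natAdd k i) (by simp)
    · intro h i hi
      have := congrFun h ⟨i.val - k, by omega⟩
      simp only [Fin.appendEquiv, Equiv.coe_fn_symm_mk] at this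
      convert this using 2 <;> · ext; simp; omega
  have h1 : ∀ c : Fin (k + l) → Fin 2, (fun i : Fin k => c ⟨0 + i.val, by omega⟩) =
      ((Fin.appendEquiv (α := Fin 2) k l).symm c).1 := by
    intro c
    funext i
    simp only [Fin.appendEquiv, Equiv.coe_fn_symm_mk]
    congr 1
    ext
    simp
  rw [h1, h1]
  by_cases hab : ((Fin.appendEquiv (α := Fin 2) k l).symm a).2 =
        ((Fin.appendEquiv (α := Fin 2) k l).symm b).2
  · rw [if_pos (key.2 hab), if_pos hab, mul_one]
  · rw [if_neg (fun h => hab (key.1 h)), if_neg hab, mul_zero]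

theorem shift_right_eq_kronecker (k l : ℕ) (B : Op l) :
    shift (k + l) k B = ((1 : Op k) ⊗ₖ B).submatrix
      (Fin.appendEquiv (α := Fin 2) k l).symm (Fin.appendEquiv (α := Fin 2) k l).symm := by
  ext a b
  rw [shift, dif_pos le_rfl, Matrix.of_apply, Matrix.submatrix_apply,
    Matrix.kroneckerMap_apply, Matrix.one_apply]
  have key : (∀ i : Fin (k + l), (i.val < k ∨ k + l ≤ i.val) → a i = b i) ↔
      ((Fin.appendEquiv (α := Fin 2) k l).symm a).1 =
        ((Fin.appendEquiv (α := Fin 2) k l).symm b).1 := by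
    constructor
    · intro h
      funext i
      exact h (Fin.castAdd l i) (by simp)
    · intro h i hi
      have := congrFun h ⟨i.val, by omega⟩
      simpa [Fin.appendEquiv] using this
  have h1 : ∀ c : Fin (k + l) → Fin 2, (fun i : Fin l => c ⟨k + i.val, by omega⟩) =
      ((Fin.appendEquiv (α := Fin 2) k l).symm c).2 := fun c => rfl
  rw [h1, h1]
  by_cases hab : ((Fin.appendEquiv (α := Fin 2) k l).symm a).1 =
        ((Fin.appendEquiv (α := Fin 2) k l).symm b).1
  · rw [if_pos (key.2 hab), if_pos hab, one_mul]
  · rw [if_neg (fun h => hab (key.1 h)), if_neg hab, zero_mul]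

theorem shift_left_mul_shift_right (k l : ℕ) (A : Op k) (B : Op l) :
    shift (k + l) 0 A * shift (k + l) k B = (A ⊗ₖ B).submatrix
      (Fin.appendEquiv (α := Fin 2) k l).symm (Fin.appendEquiv (α := Fin 2) k l).symm := by
  rw [shift_left_eq_kronecker, shift_right_eq_kronecker, Matrix.submatrix_mul_equiv,
    ← Matrix.mul_kronecker_mul, one_mul, mul_one]

theorem shift_left_right_commute (k l : ℕ) (A : Op k) (B : Op l) :
    Commute (shift (k + l) 0 A) (shift (k + l) k B) := by
  unfold Commute SemiconjBy
  rw [shift_left_mul_shift_right, shift_left_eq_kronecker, shift_right_eq_kronecker,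
    Matrix.submatrix_mul_equiv, ← Matrix.mul_kronecker_mul, one_mul, mul_one]

/-- The tracial state is a product state; this is the source of all factorizations over missing
bonds. -/
theorem tracial_shift_left_mul_shift_right (k l : ℕ) (A : Op k) (B : Op l) :
    tracial (shift (k + l) 0 A * shift (k + l) k B) = tracial A * tracial B := by
  unfold tracial
  rw [shift_left_mul_shift_right, trace_submatrix_equiv, Matrix.trace_kronecker, pow_add,
    div_mul_div_comm]

end ShiftAlgebra

/-! ### Splitting off the leftmost site. -/

section Site

/-- The operator `A ⊗ B` on a chain with one more site on the left. -/
def site {n : ℕ} (A : Matrix (Fin 2) (Fin 2) ℂ) (B : Op n) : Op (n + 1) :=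
  Matrix.of fun a b => A (a 0) (b 0) * B (Fin.tail a) (Fin.tail b)

theorem site_apply {n : ℕ} (A : Matrix (Fin 2) (Fin 2) ℂ) (B : Op n) (a b : Fin (n + 1) → Fin 2) :
    site A B a b = A (a 0) (b 0) * B (Fin.tail a) (Fin.tail b) := rfl

theorem sum_site_index {n : ℕ} {M : Type*} [AddCommMonoid M] (f : Fin 2 → (Fin n → Fin 2) → M) :
    ∑ a : Fin (n + 1) → Fin 2, f (a 0) (Fin.tail a) = ∑ x, ∑ a, f x a := by
  rw [← Fintype.sum_prod_type']
  exact Fintype.sum_equiv (Fin.consEquiv (fun _ => Fin 2)).symm _ _ (fun a => rfl)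

theorem site_mul {n : ℕ} (A A' : Matrix (Fin 2) (Fin 2) ℂ) (B B' : Op n) :
    site A B * site A' B' = site (A * A') (B * B') := by
  ext a b
  simp only [Matrix.mul_apply, site_apply]
  rw [sum_site_index (fun x c => A (a 0) x * B (Fin.tail a) c * (A' x (b 0) * B' c (Fin.tail b))),
    Finset.sum_mul_sum]
  exact Finset.sum_congr rfl fun x _ => Finset.sum_congr rfl fun c _ => by ring

theorem site_one (n : ℕ) : site 1 (1 : Op n) = 1 := by
  ext a b
  simp only [site_apply, Matrix.one_apply]
  by_cases h : a = b
  · simp [h]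
  · by_cases h0 : a 0 = b 0
    · rw [if_neg (c := Fin.tail a = Fin.tail b), if_neg h, mul_zero]
      intro h1
      exact h (by rw [← Fin.cons_self_tail a, ← Fin.cons_self_tail b, h0, h1])
    · simp [h, h0]

theorem site_add_left {n : ℕ} (A A' : Matrix (Fin 2) (Fin 2) ℂ) (B : Op n) :
    site (A + A') B = site A B + site A' B := by
  ext a b; simp [site_apply, add_mul]

theorem site_smul_left {n : ℕ} (c : ℂ) (A : Matrix (Fin 2) (Fin 2) ℂ) (B : Op n) :
    site (c • A) B = c • site A B := by
  ext a b; simp [site_apply, mul_assoc]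

theorem site_add_right {n : ℕ} (A : Matrix (Fin 2) (Fin 2) ℂ) (B B' : Op n) :
    site A (B + B') = site A B + site A B' := by
  ext a b; simp [site_apply, mul_add]

theorem site_smul_right {n : ℕ} (c : ℂ) (A : Matrix (Fin 2) (Fin 2) ℂ) (B : Op n) :
    site A (c • B) = c • site A B := by
  ext a b; simp [site_apply, mul_left_comm]

/-- The bilinear map `(A, B) ↦ A ⊗ B`. -/
def siteBilinear (n : ℕ) : Matrix (Fin 2) (Fin 2) ℂ →ₗ[ℂ] Op n →ₗ[ℂ] Op (n + 1) :=
  LinearMap.mk₂ ℂ site site_add_left site_smul_left site_add_right site_smul_right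

theorem site_zero_left {n : ℕ} (B : Op n) : site 0 B = 0 := LinearMap.map_zero₂ (siteBilinear n) B

theorem site_zero_right {n : ℕ} (A : Matrix (Fin 2) (Fin 2) ℂ) : site A (0 : Op n) = 0 :=
  map_zero (siteBilinear n A)

theorem site_sub_left {n : ℕ} (A A' : Matrix (Fin 2) (Fin 2) ℂ) (B : Op n) :
    site (A - A') B = site A B - site A' B := LinearMap.map_sub₂ (siteBilinear n) A A' B

theorem site_sub_right {n : ℕ} (A : Matrix (Fin 2) (Fin 2) ℂ) (B B' : Op n) :
    site A (B - B') = site A B - site A B' := map_sub (siteBilinear n A) B B'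

theorem site_sum_right {ι : Type*} {n : ℕ} (A : Matrix (Fin 2) (Fin 2) ℂ) (s : Finset ι)
    (f : ι → Op n) : site A (∑ i ∈ s, f i) = ∑ i ∈ s, site A (f i) :=
  map_sum (siteBilinear n A) f s

theorem site_conjTranspose {n : ℕ} (A : Matrix (Fin 2) (Fin 2) ℂ) (B : Op n) :
    (site A B).conjTranspose = site A.conjTranspose B.conjTranspose := by
  ext a b; simp [site_apply, Matrix.conjTranspose_apply]

theorem site_transpose {n : ℕ} (A : Matrix (Fin 2) (Fin 2) ℂ) (B : Op n) :
    (site A B).transpose = site A.transpose B.transpose := by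
  ext a b; simp [site_apply]

theorem tracial_site {n : ℕ} (A : Matrix (Fin 2) (Fin 2) ℂ) (B : Op n) :
    tracial (site A B) = A.trace / 2 * tracial B := by
  unfold tracial
  simp only [Matrix.trace, Matrix.diag_apply, site_apply]
  rw [sum_site_index (fun x c => A x x * B c c), ← Finset.sum_mul_sum, pow_succ]
  field_simp

theorem shift_succ {n x d : ℕ} (q : Op d) : shift (n + 1) (x + 1) q = site 1 (shift n x q) := by
  by_cases hx : x + d ≤ n
  · have hx' : x + 1 + d ≤ n + 1 := by omega
    ext a b
    simp only [site_apply, shift, dif_pos hx, dif_pos hx', Matrix.of_apply, Matrix.one_apply]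
    by_cases h : ∀ i : Fin (n + 1), (i.val < x + 1 ∨ x + 1 + d ≤ i.val) → a i = b i
    · have h1 : ∀ i : Fin n, (i.val < x ∨ x + d ≤ i.val) → Fin.tail a i = Fin.tail b i :=
        fun i hi => h i.succ (by simp only [Fin.val_succ]; omega)
      rw [if_pos h, if_pos (h 0 (by simp)), if_pos h1, one_mul]
      congr 1 <;>
      · funext i
        simp only [Fin.tail]
        congr 1
        ext
        simp
        omega
    · rw [if_neg h]
      by_cases h0 : a 0 = b 0
      · rw [if_pos h0, if_neg, mul_zero]
        intro h1
        apply h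
        intro i hi
        induction i using Fin.cases with
        | zero => exact h0
        | succ i => exact h1 i (by simp only [Fin.val_succ] at hi; omega)
      · rw [if_neg h0, zero_mul]
  · rw [shift_of_not_le hx, shift_of_not_le (by omega), site_zero_right]

theorem shift_zero_site {n d : ℕ} (A : Matrix (Fin 2) (Fin 2) ℂ) (q : Op d) :
    shift (n + 1) 0 (site A q) = site A (shift n 0 q) := by
  by_cases hx : 0 + d ≤ n
  · have hx' : 0 + (d + 1) ≤ n + 1 := by omega
    ext a b
    simp only [site_apply, shift, dif_pos hx, dif_pos hx', Matrix.of_apply]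
    by_cases h : ∀ i : Fin (n + 1), (i.val < 0 ∨ 0 + (d + 1) ≤ i.val) → a i = b i
    · have h1 : ∀ i : Fin n, (i.val < 0 ∨ 0 + d ≤ i.val) → Fin.tail a i = Fin.tail b i :=
        fun i hi => h i.succ (by simp only [Fin.val_succ]; omega)
      rw [if_pos h, if_pos h1]
      rfl
    · rw [if_neg h, if_neg, mul_zero]
      intro h1
      apply h
      intro i hi
      induction i using Fin.cases with
      | zero => simp at hi
      | succ i => exact h1 i (by simp only [Fin.val_succ] at hi; omega)
  · rw [shift_of_not_le hx, shift_of_not_le (by omega), site_zero_right]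

theorem shift_self {n : ℕ} (q : Op n) : shift n 0 q = q := by
  ext a b
  rw [shift, dif_pos (by omega), Matrix.of_apply, if_pos (by intro i hi; omega)]
  simp

theorem tensor_succ {n : ℕ} (M : Fin (n + 1) → Matrix (Fin 2) (Fin 2) ℂ) :
    tensor M = site (M 0) (tensor (Fin.tail M)) := by
  ext a b
  simp only [tensor, site_apply, Matrix.of_apply, Fin.prod_univ_succ]
  rfl

theorem tensor_fin_zero (M : Fin 0 → Matrix (Fin 2) (Fin 2) ℂ) : tensor M = 1 := by
  ext a b
  simp [tensor, Matrix.one_apply, Subsingleton.elim a b]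

theorem tensor_one_site (A : Matrix (Fin 2) (Fin 2) ℂ) : tensor ![A] = site A (1 : Op 0) := by
  rw [tensor_succ, tensor_fin_zero]
  rfl

theorem tensor_two_sites (A B : Matrix (Fin 2) (Fin 2) ℂ) :
    tensor ![A, B] = site A (site B (1 : Op 0)) := by
  rw [tensor_succ, tensor_succ, tensor_fin_zero]
  rfl

end Site


/-! ### Möbius transforms over finite sets of bonds, and domination between them. -/

section Moebius

variable {E F G : Type*}

/-- The Möbius transform of a function of finite sets: `f B = ∑ S ⊆ B, mob f S`. -/
def mob [AddCommGroup E] (f : Finset ℕ → E) (S : Finset ℕ) : E :=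
  ∑ T ∈ S.powerset, (-1 : ℤ) ^ (S \ T).card • f T

theorem mob_empty [AddCommGroup E] (f : Finset ℕ → E) : mob f ∅ = f ∅ := by
  simp [mob]

theorem mob_congr [AddCommGroup E] {f g : Finset ℕ → E} {S : Finset ℕ}
    (h : ∀ T ⊆ S, f T = g T) : mob f S = mob g S :=
  Finset.sum_congr rfl fun T hT => by rw [h T (Finset.mem_powerset.1 hT)]

/-- The transform is an iterated finite difference, one difference for each point. -/
theorem mob_insert [AddCommGroup E] (f : Finset ℕ → E) {a : ℕ} {S : Finset ℕ} (ha : a ∉ S) :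
    mob f (insert a S) = mob (fun T => f (insert a T)) S - mob f S := by
  unfold mob
  rw [Finset.sum_powerset_insert ha, sub_eq_add_neg, add_comm, ← Finset.sum_neg_distrib]
  congr 1
  · refine Finset.sum_congr rfl fun T hT => ?_
    rw [Finset.insert_sdiff_insert, Finset.sdiff_insert_of_notMem ha]
  · refine Finset.sum_congr rfl fun T hT => ?_
    have haT : a ∉ T := fun h => ha (Finset.mem_powerset.1 hT h)
    rw [Finset.insert_sdiff_of_notMem _ haT,
      Finset.card_insert_of_notMem (fun h => ha (Finset.mem_sdiff.1 h).1), pow_succ]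
    simp

theorem sum_mob [AddCommGroup E] (f : Finset ℕ → E) (B : Finset ℕ) :
    ∑ S ∈ B.powerset, mob f S = f B := by
  induction B using Finset.induction_on generalizing f with
  | empty => simp [mob_empty]
  | insert a B ha ih =>
    rw [Finset.sum_powerset_insert ha, ih f,
      Finset.sum_congr rfl (fun S hS =>
        mob_insert f (fun h => ha (Finset.mem_powerset.1 hS h))),
      Finset.sum_sub_distrib, ih, ih]
    abel

/-- Uniqueness of Möbius inversion: a transform may be computed by guessing it and checking the sums
over subsets. -/
theorem mob_eq_of_sum [AddCommGroup E] {f g : Finset ℕ → E}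
    (h : ∀ B, ∑ S ∈ B.powerset, g S = f B) (B : Finset ℕ) : mob f B = g B := by
  induction B using Finset.strongInduction with
  | H B ih =>
    have h1 := (sum_mob f B).trans (h B).symm
    have hB : B ∈ B.powerset := Finset.mem_powerset_self B
    rw [← Finset.add_sum_erase _ _ hB, ← Finset.add_sum_erase _ _ hB] at h1
    have h2 : ∑ S ∈ B.powerset.erase B, mob f S = ∑ S ∈ B.powerset.erase B, g S := by
      refine Finset.sum_congr rfl fun S hS => ih S ?_
      rw [Finset.mem_erase, Finset.mem_powerset] at hS
      exact Finset.ssubset_iff_subset_ne.2 ⟨hS.2, hS.1⟩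
    rw [h2] at h1
    exact add_right_cancel h1

theorem mob_add [AddCommGroup E] (f g : Finset ℕ → E) (S : Finset ℕ) :
    mob (fun T => f T + g T) S = mob f S + mob g S := by
  simp [mob, Finset.sum_add_distrib]

theorem mob_sum [AddCommGroup E] {ι : Type*} (s : Finset ι) (f : ι → Finset ℕ → E)
    (S : Finset ℕ) : mob (fun T => ∑ i ∈ s, f i T) S = ∑ i ∈ s, mob (f i) S := by
  simp only [mob, Finset.smul_sum]
  exact Finset.sum_comm

theorem map_mob [AddCommGroup E] [AddCommGroup F] (φ : E →+ F) (f : Finset ℕ → E)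
    (S : Finset ℕ) : mob (fun T => φ (f T)) S = φ (mob f S) := by
  simp [mob]

theorem mob_mul_left [Ring E] (c : E) (f : Finset ℕ → E) (S : Finset ℕ) :
    mob (fun T => c * f T) S = c * mob f S :=
  map_mob (AddMonoidHom.mulLeft c) f S

theorem mob_mul_right [Ring E] (f : Finset ℕ → E) (c : E) (S : Finset ℕ) :
    mob (fun T => f T * c) S = mob f S * c :=
  map_mob (AddMonoidHom.mulRight c) f S

theorem mob_const [AddCommGroup E] (c : E) (S : Finset ℕ) :
    mob (fun _ => c) S = if S = ∅ then c else 0 :=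
  mob_eq_of_sum (g := fun S => if S = ∅ then c else 0) (fun B => by simp) S

/-- This is the binomial theorem for `((c - 1) + 1) ^ |B|`. -/
theorem mob_pow_card (c : ℝ) (S : Finset ℕ) :
    mob (fun T => c ^ T.card) S = (c - 1) ^ S.card := by
  refine mob_eq_of_sum (g := fun S => (c - 1) ^ S.card) (fun B => ?_) S
  have := Finset.sum_pow_mul_eq_add_pow (c - 1) 1 B
  simpa using this

/-- The Möbius transform of a product. -/
theorem mob_bilin [AddCommGroup E] [AddCommGroup F] [AddCommGroup G] (b : E →+ F →+ G)
    (f : Finset ℕ → E) (g : Finset ℕ → F) (S : Finset ℕ) :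
    mob (fun T => b (f T) (g T)) S =
      ∑ p ∈ (S.powerset ×ˢ S.powerset).filter (fun p => p.1 ∪ p.2 = S),
        b (mob f p.1) (mob g p.2) := by
  refine mob_eq_of_sum (g := fun S =>
    ∑ p ∈ (S.powerset ×ˢ S.powerset).filter (fun p => p.1 ∪ p.2 = S),
        b (mob f p.1) (mob g p.2)) (fun B => ?_) S
  have h1 : b (f B) (g B) = ∑ p ∈ B.powerset ×ˢ B.powerset, b (mob f p.1) (mob g p.2) := by
    conv_lhs => rw [← sum_mob f B, ← sum_mob g B]
    simp only [map_sum, AddMonoidHom.finsetSum_apply]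
    rw [Finset.sum_product_right]
  -- Pairs of subsets of `B` are grouped by their union.
  rw [h1, ← Finset.sum_fiberwise_of_maps_to (s := B.powerset ×ˢ B.powerset) (t := B.powerset)
    (g := fun p => p.1 ∪ p.2)]
  · refine Finset.sum_congr rfl fun S hS => Finset.sum_congr ?_ fun _ _ => rfl
    ext p
    simp only [Finset.mem_filter, Finset.mem_product, Finset.mem_powerset]
    rw [Finset.mem_powerset] at hS
    constructor
    · rintro ⟨⟨h1, h2⟩, h3⟩
      exact ⟨⟨h1.trans hS, h2.trans hS⟩, h3⟩
    · rintro ⟨-, rfl⟩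
      exact ⟨⟨Finset.subset_union_left, Finset.subset_union_right⟩, rfl⟩
  · intro p hp
    simp only [Finset.mem_product, Finset.mem_powerset] at hp ⊢
    exact Finset.union_subset hp.1 hp.2

/-- `f` is dominated by `g`: all Möbius coefficients of `f` are bounded by those of `g`. -/
def Dom [SeminormedAddCommGroup E] (f : Finset ℕ → E) (g : Finset ℕ → ℝ) : Prop :=
  ∀ S, ‖mob f S‖ ≤ mob g S

theorem Dom.sum [SeminormedAddCommGroup E] {ι : Type*} (s : Finset ι) {f : ι → Finset ℕ → E}
    {g : ι → Finset ℕ → ℝ} (h : ∀ i ∈ s, Dom (f i) (g i)) :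
    Dom (fun T => ∑ i ∈ s, f i T) (fun T => ∑ i ∈ s, g i T) := by
  intro S
  rw [mob_sum, mob_sum]
  exact norm_sum_le_of_le _ fun i hi => h i hi S

theorem Dom.const [SeminormedAddCommGroup E] (c : E) : Dom (fun _ => c) (fun _ => ‖c‖) := by
  intro S
  rw [mob_const, mob_const]
  split_ifs <;> simp

/-- The transform of a product is a sum over pairs with union `S`, all with coefficient one, so
bounds on the factors multiply. A majorant has nonnegative transform because it bounds norms. -/
theorem Dom.bilin [SeminormedAddCommGroup E] [SeminormedAddCommGroup F]
    [SeminormedAddCommGroup G] (b : E →+ F →+ G) {K : ℝ} (hK : 0 ≤ K)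
    (hb : ∀ x y, ‖b x y‖ ≤ K * (‖x‖ * ‖y‖))
    {f : Finset ℕ → E} {f' : Finset ℕ → F} {g g' : Finset ℕ → ℝ} (h : Dom f g) (h' : Dom f' g') :
    Dom (fun T => b (f T) (f' T)) (fun T => K * (g T * g' T)) := by
  intro S
  have h1 := mob_bilin (AddMonoidHom.mul (R := ℝ)) g g' S
  simp only [AddMonoidHom.mul_apply] at h1
  rw [mob_mul_left, h1, mob_bilin, Finset.mul_sum]
  refine norm_sum_le_of_le _ fun p _ => (hb _ _).trans ?_
  have := h p.1
  have := h' p.2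
  gcongr
  exact (norm_nonneg _).trans (h p.1)

theorem Dom.mul [SeminormedRing E] {f f' : Finset ℕ → E} {g g' : Finset ℕ → ℝ}
    (h : Dom f g) (h' : Dom f' g') : Dom (fun T => f T * f' T) (fun T => g T * g' T) := by
  have := Dom.bilin (AddMonoidHom.mul (R := E)) zero_le_one
    (fun x y => by simpa using norm_mul_le x y) h h'
  simpa using this

theorem Dom.pow [SeminormedRing E] [NormOneClass E] {f : Finset ℕ → E} {g : Finset ℕ → ℝ}
    (h : Dom f g) (k : ℕ) : Dom (fun T => f T ^ k) (fun T => g T ^ k) := by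
  induction k with
  | zero => simpa using Dom.const (1 : E)
  | succ k ih => simpa only [pow_succ] using ih.mul h

theorem tendsto_mob [AddCommGroup E] [TopologicalSpace E] [IsTopologicalAddGroup E]
    {ι : Type*} {l : Filter ι} {f : ι → Finset ℕ → E} {g : Finset ℕ → E}
    (h : ∀ T, Tendsto (fun i => f i T) l (𝓝 (g T))) (S : Finset ℕ) :
    Tendsto (fun i => mob (f i) S) l (𝓝 (mob g S)) :=
  tendsto_finsetSum _ fun T _ => (h T).const_smul _

theorem Dom.tendsto [SeminormedAddCommGroup E] {f : ℕ → Finset ℕ → E} {f' : Finset ℕ → E}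
    {g : ℕ → Finset ℕ → ℝ} {g' : Finset ℕ → ℝ} (h : ∀ i, Dom (f i) (g i))
    (hf : ∀ T, Tendsto (fun i => f i T) atTop (𝓝 (f' T)))
    (hg : ∀ T, Tendsto (fun i => g i T) atTop (𝓝 (g' T))) : Dom f' g' := fun S =>
  le_of_tendsto_of_tendsto' (tendsto_mob hf S).norm (tendsto_mob hg S) fun i => h i S

/-- The transform of an additive set function is supported on singletons. -/
theorem Dom.sum_self [SeminormedAddCommGroup E] {h : ℕ → E} {η : ℝ} (hη : ∀ x, ‖h x‖ ≤ η) :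
    Dom (fun B => ∑ x ∈ B, h x) (fun B => η * B.card) := by
  intro S
  induction S using Finset.induction_on with
  | empty => simp [mob_empty]
  | insert a S ha ih =>
    have h1 : mob (fun T => ∑ x ∈ insert a T, h x) S =
        mob (fun _ => h a) S + mob (fun T => ∑ x ∈ T, h x) S := by
      rw [← mob_add]
      exact mob_congr fun T hT => Finset.sum_insert fun h => ha (hT h)
    have h2 : mob (fun T => η * ((insert a T).card : ℝ)) S =
        mob (fun _ => η) S + mob (fun T => η * (T.card : ℝ)) S := by
      rw [← mob_add]
      refine mob_congr fun T hT => ?_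
      rw [Finset.card_insert_of_notMem fun h => ha (hT h)]
      push_cast
      ring
    rw [mob_insert _ ha, mob_insert _ ha, h1, h2, add_sub_cancel_right, add_sub_cancel_right,
      mob_const, mob_const]
    split_ifs
    · exact hη a
    · simp

theorem Dom.smul [SeminormedAddCommGroup E] [NormedSpace ℂ E] {f : Finset ℕ → E}
    {g : Finset ℕ → ℝ} (h : Dom f g) (c : ℂ) :
    Dom (fun T => c • f T) (fun T => ‖c‖ * g T) := by
  intro S
  have h1 := map_mob (DistribSMul.toAddMonoidHom E c) f S
  simp only [DistribSMul.toAddMonoidHom_apply] at h1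
  rw [h1, mob_mul_left, norm_smul]
  exact mul_le_mul_of_nonneg_left (h S) (norm_nonneg c)

/-- Domination passes through powers and sums, and the exponential series has nonnegative
coefficients; a limit of partial sums concludes. No commutativity is needed. -/
theorem Dom.exp [NormedRing E] [NormedAlgebra ℂ E] [CompleteSpace E] [NormOneClass E]
    {f : Finset ℕ → E} {g : Finset ℕ → ℝ} (h : Dom f g) :
    Dom (fun T => NormedSpace.exp (f T)) (fun T => Real.exp (g T)) := by
  refine Dom.tendsto
    (f := fun N T => ∑ k ∈ Finset.range N, ((k.factorial : ℂ)⁻¹) • f T ^ k)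
    (g := fun N T => ∑ k ∈ Finset.range N, ‖((k.factorial : ℂ)⁻¹)‖ * g T ^ k)
    (fun N => Dom.sum _ fun k _ => (h.pow k).smul _) (fun T => ?_) (fun T => ?_)
  · exact (NormedSpace.exp_series_hasSum_exp' (𝕂 := ℂ) (f T)).tendsto_sum_nat
  · rw [Real.exp_eq_exp_ℝ]
    have := (NormedSpace.exp_series_hasSum_exp' (𝕂 := ℝ) (g T)).tendsto_sum_nat
    simpa using this

/-- The Möbius transform of `c ^ |B|`, restricted to `B ⊇ J`. -/
theorem mob_indicator_pow_card (c : ℝ) (J S : Finset ℕ) :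
    mob (fun T => (if J ⊆ T then 1 else 0) * c ^ T.card) S =
      if J ⊆ S then c ^ J.card * (c - 1) ^ (S \ J).card else 0 := by
  induction S using Finset.induction_on generalizing J with
  | empty =>
    rw [mob_empty]
    by_cases hJ : J ⊆ ∅
    · have : J = ∅ := Finset.subset_empty.1 hJ
      subst this
      simp
    · simp [hJ]
  | insert a S ha ih =>
    rw [mob_insert _ ha, ih J]
    -- A point of `J` has to be present and contributes `c`; any other point contributes the
    -- difference `c - 1`.
    by_cases haJ : a ∈ J
    · have h1 : ¬ J ⊆ S := fun h => ha (h haJ)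
      have h2 : mob (fun T => (if J ⊆ insert a T then 1 else 0) * c ^ (insert a T).card) S =
          c * mob (fun T => (if J.erase a ⊆ T then 1 else 0) * c ^ T.card) S := by
        rw [← mob_mul_left]
        refine mob_congr fun T hT => ?_
        rw [Finset.card_insert_of_notMem fun h => ha (hT h)]
        simp only [Finset.subset_insert_iff]
        ring
      rw [h2, ih, if_neg h1, sub_zero]
      by_cases hJ : J ⊆ insert a S
      · rw [if_pos hJ, if_pos (Finset.subset_insert_iff.1 hJ), ← mul_assoc, ← pow_succ', Finset.card_erase_add_one haJ]
        congr 2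
        congr 1
        ext x
        simp only [Finset.mem_sdiff, Finset.mem_erase, Finset.mem_insert]
        constructor
        · rintro ⟨hx, hx'⟩
          exact ⟨Or.inr hx, fun h => hx' ⟨fun h' => ha (h' ▸ hx), h⟩⟩
        · rintro ⟨hx | hx, hx'⟩
          · exact absurd (hx ▸ haJ) hx'
          · exact ⟨hx, fun h => hx' h.2⟩
      · rw [if_neg hJ, if_neg (fun h => hJ (Finset.subset_insert_iff.2 h)), mul_zero]
    · have h2 : mob (fun T => (if J ⊆ insert a T then 1 else 0) * c ^ (insert a T).card) S =
          c * mob (fun T => (if J ⊆ T then 1 else 0) * c ^ T.card) S := by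
        rw [← mob_mul_left]
        refine mob_congr fun T hT => ?_
        rw [Finset.card_insert_of_notMem fun h => ha (hT h)]
        simp only [Finset.subset_insert_iff, Finset.erase_eq_of_notMem haJ]
        ring
      rw [h2, ih]
      simp only [Finset.subset_insert_iff, Finset.erase_eq_of_notMem haJ]
      split_ifs with hJ
      · rw [Finset.insert_sdiff_of_notMem _ haJ,
          Finset.card_insert_of_notMem (fun h => ha (Finset.mem_sdiff.1 h).1)]
        ring
      · ring

end Moebius

/-! ### Cutting the chain at the first missing bond: the renewal equation. -/

section RenewalCombinatorics

/-- Decomposition according to the first missing bond. -/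
theorem eq_sum_mob_first_missing {E : Type*} [AddCommGroup E] (f : Finset ℕ → E) (N : ℕ) :
    f (Finset.range N) = ∑ k ∈ Finset.range (N + 1),
      mob (fun T => f (T ∪ Finset.Ico (k + 1) N)) (Finset.range k) := by
  -- The expansion stopped at `k`: terms whose first missing bond is below `k`, plus a remainder in
  -- which all bonds below `k` belong to the cluster.
  have key : ∀ k ≤ N, f (Finset.range N) =
      (∑ j ∈ Finset.range k, mob (fun T => f (T ∪ Finset.Ico (j + 1) N)) (Finset.range j)) +
        mob (fun T => f (T ∪ Finset.Ico k N)) (Finset.range k) := by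
    intro k
    induction k with
    | zero => intro _; simp [mob_empty]
    | succ k ih =>
      intro hk
      rw [ih (by omega), Finset.sum_range_succ, Finset.range_add_one (n := k),
        mob_insert _ Finset.notMem_range_self]
      have : mob (fun T => f (insert k T ∪ Finset.Ico (k + 1) N)) (Finset.range k) =
          mob (fun T => f (T ∪ Finset.Ico k N)) (Finset.range k) := by
        refine mob_congr fun T _ => ?_
        congr 1
        ext x
        simp only [Finset.mem_union, Finset.mem_insert, Finset.mem_Ico]
        by_cases hx : x ∈ T
        · simp [hx]
        · simp only [hx]
          constructor
          · rintro ((rfl | h) | h)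
            · right; omega
            · exact h.elim
            · right; omega
          · rintro (h | h)
            · exact h.elim
            · by_cases hxk : x = k
              · exact Or.inl (Or.inl hxk)
              · right; omega
      rw [this]
      abel
  have h := key N le_rfl
  rw [h, Finset.sum_range_succ]
  congr 2
  funext T
  simp

/-- The bonds of a chain of `k + l` sites: `B₁` on the left `k` sites, `B₂` on the right `l`. -/
def joinBonds (k : ℕ) (B₁ B₂ : Finset ℕ) : Finset ℕ := B₁ ∪ B₂.image (k + ·)

/-- Bond `k` joins sites `k` and `k + 1`, so cutting it leaves blocks of `k + 1` and `n - 1 - k`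
sites. -/
theorem first_missing_eq_joinBonds {n k : ℕ} (hk : k < n) (T : Finset ℕ) :
    T ∪ Finset.Ico (k + 1) (n - 1) = joinBonds (k + 1) T (Finset.range (n - 1 - k - 1)) := by
  unfold joinBonds
  congr 1
  ext x
  simp only [Finset.mem_Ico, Finset.mem_image, Finset.mem_range]
  constructor
  · intro h
    exact ⟨x - (k + 1), by omega, by omega⟩
  · rintro ⟨y, hy, rfl⟩
    omega

open PowerSeries in
/-- A family of weights that factorizes over missing bonds satisfies a renewal equation; a family
that is a derivation over it satisfies the linearized renewal equation. -/
theorem renewal_powerSeries (Z N : ℕ → Finset ℕ → ℂ) (hZ0 : Z 0 ∅ = 1) (hN0 : N 0 ∅ = 0)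
    (hZ : ∀ k l B₁ B₂, B₁ ⊆ Finset.range (k - 1) → B₂ ⊆ Finset.range (l - 1) →
      Z (k + l) (joinBonds k B₁ B₂) = Z k B₁ * Z l B₂)
    (hN : ∀ k l B₁ B₂, B₁ ⊆ Finset.range (k - 1) → B₂ ⊆ Finset.range (l - 1) →
      N (k + l) (joinBonds k B₁ B₂) = N k B₁ * Z l B₂ + Z k B₁ * N l B₂) :
    let z : PowerSeries ℂ := mk fun n => Z n (Finset.range (n - 1))
    let u : PowerSeries ℂ := mk fun n => if n = 0 then 0 else mob (Z n) (Finset.range (n - 1))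
    let p : PowerSeries ℂ := mk fun n => if n = 0 then 0 else mob (N n) (Finset.range (n - 1))
    z * (1 - u) = 1 ∧ (mk fun n => N n (Finset.range (n - 1))) = p * z * z := by
  intro z u p
  -- Clusters occupy at least one site, so the convolution runs over the lengths `k + 1`.
  have conv : ∀ (a b : ℕ → ℂ) (n : ℕ), n ≠ 0 →
      coeff n ((mk fun n => if n = 0 then 0 else a n) * mk b) =
        ∑ k ∈ Finset.range n, a (k + 1) * b (n - 1 - k) := by
    intro a b n hn
    rw [coeff_mul, Finset.Nat.sum_antidiagonal_eq_sum_range_succ_mk, Finset.sum_range_succ']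
    simp only [coeff_mk, Nat.add_eq_zero_iff, one_ne_zero, and_false, if_false, if_true, zero_mul,
      add_zero]
    exact Finset.sum_congr rfl fun k hk => by
      rw [show n - (k + 1) = n - 1 - k by omega]
  have hz : z = 1 + u * z := by
    ext n
    rcases Nat.eq_zero_or_pos n with rfl | hn
    · rw [map_add, coeff_mul]
      simp [z, u, hZ0]
    · rw [map_add, conv _ _ n hn.ne', coeff_one, if_neg hn.ne', zero_add, coeff_mk,
        eq_sum_mob_first_missing (Z n) (n - 1), Nat.sub_add_cancel hn]
      refine Finset.sum_congr rfl fun k hk => ?_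
      have hk' : k < n := Finset.mem_range.1 hk
      rw [Nat.add_sub_cancel, ← mob_mul_right]
      refine mob_congr fun T hT => ?_
      rw [first_missing_eq_joinBonds hk', ← hZ (k + 1) (n - 1 - k) T _ (by simpa using hT) le_rfl]
      congr 1
      omega
  have hn : (mk fun n => N n (Finset.range (n - 1))) =
      p * z + u * mk fun n => N n (Finset.range (n - 1)) := by
    ext n
    rcases Nat.eq_zero_or_pos n with rfl | hn
    · rw [map_add, coeff_mul, coeff_mul]
      simp [p, u, hN0]
    · rw [map_add, conv _ _ n hn.ne', conv _ _ n hn.ne', coeff_mk,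
        eq_sum_mob_first_missing (N n) (n - 1), Nat.sub_add_cancel hn, ← Finset.sum_add_distrib]
      refine Finset.sum_congr rfl fun k hk => ?_
      have hk' : k < n := Finset.mem_range.1 hk
      rw [Nat.add_sub_cancel, ← mob_mul_right, ← mob_mul_right, ← mob_add]
      refine mob_congr fun T hT => ?_
      rw [first_missing_eq_joinBonds hk', ← hN (k + 1) (n - 1 - k) T _ (by simpa using hT) le_rfl]
      congr 1
      omega
  have h1 : z * (1 - u) = 1 := by linear_combination hz
  refine ⟨h1, ?_⟩
  set w : PowerSeries ℂ := mk fun n => N n (Finset.range (n - 1))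
  -- From `w = p z + u w` follows `(1 - u) w = p z`; multiplication by `z`, the inverse of `1 - u`,
  -- gives `w = p z²`.
  linear_combination (-w) * h1 + z * hn

end RenewalCombinatorics


/-! ### Asymptotics of the renewal equation near its dominant pole. -/

section RenewalAnalysis

open PowerSeries (coeff rescale X coeff_mk coeff_mul coeff_one coeff_rescale coeff_succ_X_mul
  coeff_zero_mul_X coeff_succ_mul_X)

/-- Division of `1 - P` by `1 - X`. When `p` sums to `1` the quotient has the tails of `p` as
coefficients, and these inherit its decay. -/
theorem one_sub_X_mul_mk_tail (p : ℕ → ℝ) :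
    (1 - X) * (PowerSeries.mk fun n => 1 - ∑ k ∈ Finset.range (n + 1), p k) = (1 - PowerSeries.mk p : PowerSeries ℝ) := by
  ext n
  rw [sub_mul, one_mul, map_sub, map_sub, coeff_one, coeff_mk, coeff_mk]
  cases n with
  | zero => simp
  | succ n =>
    rw [coeff_succ_X_mul, coeff_mk, Finset.sum_range_succ (n := n + 1)]
    simp

/-- Existence of the root of the renewal equation near `1`. -/
theorem exists_renewal_root {δ : ℝ} (hδ : 0 < δ) (hδ' : δ ≤ 1 / 100) {u : ℕ → ℝ} (hu0 : u 0 = 0)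
    (hu1 : u 1 = 1) (hu : ∀ k, |u (k + 1)| ≤ δ ^ k) :
    ∃ x : ℝ, |x - 1| ≤ 8 * δ ∧ HasSum (fun k => u k * x ^ k) 1 := by
  have hb : ∀ x ∈ Set.Icc (1 - 8 * δ) (1 + 8 * δ), ∀ k, |u (k + 2) * x ^ (k + 2)| ≤
      4 * δ * (2 * δ) ^ k := by
    intro x hx k
    have hx0 : 0 ≤ x := by linarith [hx.1]
    have hx2 : x ≤ 2 := by linarith [hx.2]
    rw [abs_mul, abs_of_nonneg (pow_nonneg hx0 _)]
    calc |u (k + 2)| * x ^ (k + 2) ≤ δ ^ (k + 1) * 2 ^ (k + 2) := by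
          gcongr
          exact hu (k + 1)
      _ = 4 * δ * (2 * δ) ^ k := by ring
  have hs : Summable fun k => 4 * δ * (2 * δ) ^ k :=
    (summable_geometric_of_lt_one (by positivity) (by linarith)).mul_left _
  have hs' : ∑' k, 4 * δ * (2 * δ) ^ k ≤ 8 * δ := by
    rw [tsum_mul_left, tsum_geometric_of_lt_one (by positivity) (by linarith),
      ← div_eq_mul_inv, div_le_iff₀ (by linarith)]
    nlinarith
  have hsum : ∀ x ∈ Set.Icc (1 - 8 * δ) (1 + 8 * δ), Summable fun k => u (k + 2) * x ^ (k + 2) :=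
    fun x hx => Summable.of_norm_bounded hs (hb x hx)
  have hc : ContinuousOn (fun x : ℝ => x + ∑' k, u (k + 2) * x ^ (k + 2))
      (Set.Icc (1 - 8 * δ) (1 + 8 * δ)) := by
    refine continuousOn_id.add (continuousOn_tsum (fun k => ?_) hs fun k x hx => hb x hx k)
    fun_prop
  have htail : ∀ x ∈ Set.Icc (1 - 8 * δ) (1 + 8 * δ), |∑' k, u (k + 2) * x ^ (k + 2)| ≤ 8 * δ :=
    fun x hx => (tsum_of_norm_bounded (f := fun k => u (k + 2) * x ^ (k + 2)) hs.hasSum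
      (hb x hx)).trans hs'
  have h1 := htail (1 - 8 * δ) ⟨le_rfl, by linarith⟩
  have h2 := htail (1 + 8 * δ) ⟨by linarith, le_rfl⟩
  -- Since `u 1 = 1`, the series equals `x` up to an error of at most `8δ`, so it takes the value
  -- `1` on this interval.
  obtain ⟨x, hx, hx'⟩ := intermediate_value_Icc (by linarith) hc
    (show (1 : ℝ) ∈ _ from ⟨by linarith [(abs_le.1 h1).2], by linarith [(abs_le.1 h2).1]⟩)
  refine ⟨x, abs_le.2 ⟨by linarith [hx.1], by linarith [hx.2]⟩, ?_⟩
  rw [← hasSum_nat_add_iff' 2]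
  simp only [Finset.sum_range_succ, Finset.range_zero, Finset.sum_empty, hu0, hu1]
  have h3 := (hsum x hx).hasSum
  simp only at hx'
  have h4 : ∑' k, u (k + 2) * x ^ (k + 2) = 1 - x := by linarith
  rw [h4] at h3
  simp only [zero_mul, zero_add, one_mul, pow_one]
  exact h3

/-- Rescaling by the root moves the pole of the generating function to `1`. Multiplication by `1 -
X` removes it and leaves the inverse of a series close to one, with coefficients `e` of size
`(10δ)^n`. Thus `z n * x ^ n` is a partial sum of a convergent series. -/
theorem renewal_sequence {δ : ℝ} (hδ : 0 < δ) (hδ' : δ ≤ 1 / 100) {u z : ℕ → ℝ} (hu0 : u 0 = 0)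
    (hu1 : u 1 = 1) (hu : ∀ k, |u (k + 1)| ≤ δ ^ k)
    (hz : (PowerSeries.mk z : PowerSeries ℝ) * (1 - PowerSeries.mk u) = 1) :
    ∃ (x : ℝ) (e : ℕ → ℝ), |x - 1| ≤ 8 * δ ∧ e 0 = 1 ∧ (∀ n, |e n| ≤ (10 * δ) ^ n) ∧
      ∀ n, z n * x ^ n = ∑ i ∈ Finset.range (n + 1), e i := by
  obtain ⟨x, hx, hxu⟩ := exists_renewal_root hδ hδ' hu0 hu1 hu
  have hx0 : 0 ≤ x := by linarith [(abs_le.1 hx).1]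
  have hx2 : x ≤ 2 := by linarith [(abs_le.1 hx).2]
  set p : ℕ → ℝ := fun k => u k * x ^ k with hp
  set r : ℕ → ℝ := fun n => 1 - ∑ k ∈ Finset.range (n + 1), p k with hr
  set y : ℕ → ℝ := fun n => z n * x ^ n with hy
  have hrescale : ∀ f : ℕ → ℝ, rescale x (PowerSeries.mk f) = PowerSeries.mk fun n => f n * x ^ n := by
    intro f
    ext n
    rw [coeff_rescale, coeff_mk, coeff_mk, mul_comm]
  have hyp : (PowerSeries.mk y : PowerSeries ℝ) * (1 - PowerSeries.mk p) = 1 := by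
    have := congrArg (rescale x) hz
    rwa [map_mul, map_sub, map_one, hrescale, hrescale] at this
  set E : PowerSeries ℝ := PowerSeries.mk y * (1 - X) with hE
  have hEr : E * PowerSeries.mk r = 1 := by
    rw [hE, mul_assoc, one_sub_X_mul_mk_tail, hyp]
  have hrb : ∀ j, |r (j + 1)| ≤ 4 * (2 * δ) ^ (j + 1) := by
    intro j
    have hpb : ∀ k, |p (k + (j + 2))| ≤ 2 * (2 * δ) ^ (j + 1) * (2 * δ) ^ k := by
      intro k
      simp only [hp, abs_mul, abs_of_nonneg (pow_nonneg hx0 _)]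
      calc |u (k + (j + 2))| * x ^ (k + (j + 2)) ≤ δ ^ (k + (j + 1)) * 2 ^ (k + (j + 2)) := by
            gcongr
            exact hu (k + (j + 1))
        _ = 2 * (2 * δ) ^ (j + 1) * (2 * δ) ^ k := by ring
    have h1 : HasSum (fun k => p (k + (j + 2))) (r (j + 1)) := (hasSum_nat_add_iff' (j + 2)).2 hxu
    have h2 : HasSum (fun k => 2 * (2 * δ) ^ (j + 1) * (2 * δ) ^ k)
        (2 * (2 * δ) ^ (j + 1) * (1 - 2 * δ)⁻¹) :=
      (hasSum_geometric_of_lt_one (by positivity) (by linarith)).mul_left _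
    rw [← h1.tsum_eq]
    refine (tsum_of_norm_bounded (f := fun k => p (k + (j + 2))) h2 hpb).trans ?_
    have h3 : (1 - 2 * δ)⁻¹ ≤ 2 := by
      rw [inv_le_comm₀ (by linarith) (by norm_num)]
      linarith
    calc 2 * (2 * δ) ^ (j + 1) * (1 - 2 * δ)⁻¹ ≤ 2 * (2 * δ) ^ (j + 1) * 2 := by gcongr
      _ = 4 * (2 * δ) ^ (j + 1) := by ring
  have hr0 : r 0 = 1 := by simp [hr, hp, hu0]
  have he0 : coeff 0 E = 1 := by
    have := congrArg (coeff 0) hEr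
    rw [coeff_mul] at this
    simpa [hr0] using this
  -- Solving `E r = 1` recursively, the tails decay like `(2δ)^k` against the claimed `(10δ)^k`, a
  -- gain of `1/5` per step, and `∑ 4 (1/5)^(k+1) = 1` closes the induction.
  have heb : ∀ n, |coeff n E| ≤ (10 * δ) ^ n := by
    intro n
    induction n using Nat.strong_induction_on with
    | _ n ih =>
      rcases Nat.eq_zero_or_pos n with rfl | hn
      · simp [he0]
      · have h1 := congrArg (coeff n) hEr
        rw [mul_comm, coeff_mul, Finset.Nat.sum_antidiagonal_eq_sum_range_succ_mk,
          Finset.sum_range_succ', coeff_one, if_neg hn.ne'] at h1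
        simp only [coeff_mk, hr0, one_mul, Nat.sub_zero] at h1
        have h2 : coeff n E = -∑ k ∈ Finset.range n, r (k + 1) * coeff (n - (k + 1)) E := by
          linarith
        rw [h2, abs_neg]
        have hterm : ∀ k ∈ Finset.range n, |r (k + 1) * coeff (n - (k + 1)) E| ≤
            (10 * δ) ^ n * (4 * (1 / 5) ^ (k + 1)) := by
          intro k hk
          have hkn : k < n := Finset.mem_range.1 hk
          rw [abs_mul]
          calc |r (k + 1)| * |coeff (n - (k + 1)) E| ≤
                4 * (2 * δ) ^ (k + 1) * (10 * δ) ^ (n - (k + 1)) := by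
                gcongr
                · exact hrb k
                · exact ih _ (by omega)
            _ = (10 * δ) ^ (k + 1) * (10 * δ) ^ (n - (k + 1)) * (4 * (1 / 5) ^ (k + 1)) := by
                rw [show 2 * δ = 10 * δ * (1 / 5) by ring, mul_pow]
                ring
            _ = (10 * δ) ^ n * (4 * (1 / 5) ^ (k + 1)) := by
                rw [← pow_add, Nat.add_sub_cancel' (by omega : k + 1 ≤ n)]
        refine (Finset.abs_sum_le_sum_abs _ _).trans ((Finset.sum_le_sum hterm).trans ?_)
        rw [← Finset.mul_sum]
        have hgeo : ∑ k ∈ Finset.range n, 4 * (1 / 5 : ℝ) ^ (k + 1) ≤ 1 := by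
          have h3 : HasSum (fun k : ℕ => 4 * (1 / 5 : ℝ) ^ (k + 1)) 1 := by
            have := (hasSum_geometric_of_lt_one (r := (1 / 5 : ℝ)) (by norm_num)
              (by norm_num)).mul_left (4 / 5)
            rw [show (4 / 5 * (1 - 1 / 5)⁻¹ : ℝ) = 1 by norm_num] at this
            have h4 : (fun k : ℕ => 4 * (1 / 5 : ℝ) ^ (k + 1)) = fun k => 4 / 5 * (1 / 5) ^ k := by
              funext k
              ring
            rwa [h4]
          exact sum_le_hasSum _ (fun k _ => by positivity) h3
        exact mul_le_of_le_one_right (by positivity) hgeo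
  refine ⟨x, fun n => coeff n E, hx, he0, heb, fun n => ?_⟩
  induction n with
  | zero =>
    have : coeff 0 E = y 0 := by rw [hE, mul_sub, mul_one, map_sub, coeff_zero_mul_X, sub_zero,
      coeff_mk]
    simp [this, hy]
  | succ n ih =>
    rw [Finset.sum_range_succ, ← ih, hE, mul_sub, mul_one, map_sub, coeff_succ_mul_X, coeff_mk,
      coeff_mk]
    simp only [hy]
    ring

/-- Cauchy products of absolutely summable sequences. -/
theorem summable_coeff_mul {a b : ℕ → ℂ} (ha : Summable fun k => ‖a k‖)
    (hb : Summable fun k => ‖b k‖) :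
    (Summable fun k => ‖coeff k (PowerSeries.mk a * PowerSeries.mk b)‖) ∧
      ∑' k, ‖coeff k (PowerSeries.mk a * PowerSeries.mk b)‖ ≤ (∑' k, ‖a k‖) * ∑' k, ‖b k‖ ∧
      ∑' k, coeff k (PowerSeries.mk a * PowerSeries.mk b) = (∑' k, a k) * ∑' k, b k := by
  have hc : ∀ k, coeff k (PowerSeries.mk a * PowerSeries.mk b) = ∑ ij ∈ Finset.HasAntidiagonal.antidiagonal k, a ij.1 * b ij.2 := by
    intro k
    simp [coeff_mul]
  simp only [hc]
  have ha' : Summable fun k => ‖‖a k‖‖ := by simpa using ha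
  have hb' : Summable fun k => ‖‖b k‖‖ := by simpa using hb
  have hs := summable_norm_sum_mul_antidiagonal_of_summable_norm ha hb
  refine ⟨hs, ?_, (tsum_mul_tsum_eq_tsum_sum_antidiagonal_of_summable_norm ha hb).symm⟩
  rw [tsum_mul_tsum_eq_tsum_sum_antidiagonal_of_summable_norm ha' hb']
  have hs2 := (summable_norm_sum_mul_antidiagonal_of_summable_norm ha' hb').of_norm
  exact hs.tsum_le_tsum (fun k => norm_sum_le_of_le _ fun ij _ => (norm_mul _ _).le) hs2

/-- Convolution with the coefficients `n + 1` of `1/(1 - X)²`: after division by `n` the weights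
tend to `1` and are at most `2`, so dominated convergence applies. -/
theorem tendsto_sum_mul_div {g : ℕ → ℂ} (hg : Summable fun k => ‖g k‖) :
    Tendsto (fun n : ℕ => (∑ k ∈ Finset.range (n + 1), g k * ((n - k : ℕ) + 1 : ℂ)) / n) atTop
      (𝓝 (∑' k, g k)) := by
  have h1 : ∀ n : ℕ, (∑ k ∈ Finset.range (n + 1), g k * ((n - k : ℕ) + 1 : ℂ)) / n =
      ∑' k, if k ∈ Finset.range (n + 1) then g k * (((n - k : ℕ) + 1 : ℂ) / n) else 0 := by
    intro n
    rw [tsum_eq_sum (s := Finset.range (n + 1)) (fun k hk => if_neg hk), Finset.sum_div]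
    exact Finset.sum_congr rfl fun k hk => by rw [if_pos hk, mul_div_assoc]
  simp only [h1]
  refine tendsto_tsum_of_dominated_convergence (bound := fun k => 2 * ‖g k‖) (hg.mul_left 2)
    (fun k => ?_) ?_
  · have h2 : Tendsto (fun n : ℕ => g k * (((n : ℂ) - k + 1) / n)) atTop (𝓝 (g k)) := by
      have h3 : Tendsto (fun n : ℕ => 1 + (1 - (k : ℂ)) * (n : ℂ)⁻¹) atTop (𝓝 (1 + (1 - (k : ℂ)) * 0)) :=
        (tendsto_const_nhds.mul (tendsto_inv_atTop_nhds_zero_nat (𝕜 := ℂ))).const_add _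
      have h4 : Tendsto (fun n : ℕ => g k * (1 + (1 - (k : ℂ)) * (n : ℂ)⁻¹)) atTop
          (𝓝 (g k * (1 + (1 - (k : ℂ)) * 0))) := h3.const_mul _
      rw [mul_zero, add_zero, mul_one] at h4
      refine h4.congr' ?_
      filter_upwards [eventually_gt_atTop 0] with n hn
      have : (n : ℂ) ≠ 0 := Nat.cast_ne_zero.2 hn.ne'
      field_simp
      ring
    refine h2.congr' ?_
    filter_upwards [eventually_ge_atTop k] with n hn
    rw [if_pos (Finset.mem_range.2 (by omega)), Nat.cast_sub hn]
  · filter_upwards [eventually_gt_atTop 0] with n hn k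
    split_ifs with hk
    · rw [norm_mul, mul_comm]
      gcongr
      rw [norm_div, Complex.norm_natCast, div_le_iff₀ (by positivity)]
      have h5 : ‖((n - k : ℕ) + 1 : ℂ)‖ = ((n - k + 1 : ℕ) : ℝ) := by
        rw [← Complex.norm_natCast]
        push_cast
        rfl
      rw [h5]
      have : n - k + 1 ≤ 2 * n := by omega
      exact_mod_cast this
    · simp

/-- Renewal theorem: asymptotics of the linearized renewal equation. -/
theorem renewal_limit {δ : ℝ} (hδ : 0 < δ) (hδ' : δ ≤ 1 / 100) {u z : ℕ → ℝ} (hu0 : u 0 = 0)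
    (hu1 : u 1 = 1) (hu : ∀ k, |u (k + 1)| ≤ δ ^ k)
    (hz : (PowerSeries.mk z : PowerSeries ℝ) * (1 - PowerSeries.mk u) = 1) :
    ∃ x E : ℝ, |x - 1| ≤ 8 * δ ∧ |E - 1| ≤ 20 * δ ∧ (∀ n, 0 < z n) ∧
      ∀ p N : ℕ → ℂ, PowerSeries.mk N = PowerSeries.mk p * (PowerSeries.mk fun n => (z n : ℂ)) * (PowerSeries.mk fun n => (z n : ℂ)) →
        (Summable fun k => ‖p k‖ * x ^ k) →
        Tendsto (fun n : ℕ => N n / z n / n) atTop (𝓝 ((∑' k, p k * (x : ℂ) ^ k) * E)) ∧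
        ∀ n : ℕ, 0 < n → ‖N n / z n / n‖ ≤ 4 * ∑' k, ‖p k‖ * x ^ k := by
  obtain ⟨x, e, hx, he0, heb, hze⟩ := renewal_sequence hδ hδ' hu0 hu1 hu hz
  have hx0 : 0 < x := by linarith [(abs_le.1 hx).1]
  have hgeo := hasSum_geometric_of_lt_one (r := 10 * δ) (by positivity) (by linarith)
  have hes : Summable fun n => |e n| := Summable.of_nonneg_of_le (fun n => abs_nonneg _) heb
    hgeo.summable
  have hes' : Summable e := hes.of_abs
  have hgeo1 : HasSum (fun n => (10 * δ) ^ (n + 1)) ((1 - 10 * δ)⁻¹ - 1) := by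
    have := (hasSum_nat_add_iff' 1).2 hgeo
    simpa using this
  have hbd : (1 - 10 * δ)⁻¹ - 1 ≤ 20 * δ := by
    have : (1 - 10 * δ)⁻¹ ≤ 1 + 20 * δ := by
      rw [inv_le_iff_one_le_mul₀ (by linarith)]
      nlinarith
    linarith
  have hE : |∑' n, e n - 1| ≤ 20 * δ := by
    rw [hes'.tsum_eq_zero_add, he0, add_sub_cancel_left]
    exact (tsum_of_norm_bounded (f := fun n => e (n + 1)) hgeo1 fun n => heb (n + 1)).trans hbd
  have hpartial : ∀ n, 4 / 5 ≤ ∑ i ∈ Finset.range (n + 1), e i := by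
    intro n
    rw [Finset.sum_range_succ', he0]
    have h1 : |∑ i ∈ Finset.range n, e (i + 1)| ≤ 20 * δ := by
      refine (Finset.abs_sum_le_sum_abs _ _).trans ((Finset.sum_le_sum fun i _ => heb (i + 1)).trans
        ((sum_le_hasSum _ (fun i _ => by positivity) hgeo1).trans hbd))
    linarith [(abs_le.1 h1).1]
  have hzpos : ∀ n, 0 < z n := by
    intro n
    have h1 : 0 < z n * x ^ n := by rw [hze]; linarith [hpartial n]
    exact (pos_iff_pos_of_mul_pos h1).2 (pow_pos hx0 n)
  refine ⟨x, ∑' n, e n, hx, hE, hzpos, fun p N hN hp => ?_⟩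
  set q : ℕ → ℂ := fun k => p k * (x : ℂ) ^ k with hq
  have hqn : ∀ k, ‖q k‖ = ‖p k‖ * x ^ k := by
    intro k
    rw [hq, norm_mul, norm_pow, Complex.norm_real, Real.norm_of_nonneg hx0.le]
  have hqs : Summable fun k => ‖q k‖ := by simpa only [hqn] using hp
  obtain ⟨ec, hec⟩ : ∃ ec : ℕ → ℂ, ∀ k, ec k = (e k : ℂ) := ⟨_, fun _ => rfl⟩
  have hecs : Summable fun k => ‖ec k‖ := by simpa [hec] using hes
  obtain ⟨hee1, hee2, hee3⟩ := summable_coeff_mul hecs hecs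
  have hmk : ∀ f : PowerSeries ℂ, PowerSeries.mk (fun k => coeff k f) = f := fun f => by ext; simp
  obtain ⟨hg1, hg2, hg3⟩ := summable_coeff_mul hqs hee1
  rw [hmk] at hg1 hg2 hg3
  rw [hee3] at hg3
  set g : ℕ → ℂ := fun k => coeff k (PowerSeries.mk q * (PowerSeries.mk ec * PowerSeries.mk ec)) with hg
  have hrescale : ∀ f : ℕ → ℂ, rescale (x : ℂ) (PowerSeries.mk f) = PowerSeries.mk fun n => f n * (x : ℂ) ^ n := by
    intro f
    ext n
    rw [coeff_rescale, coeff_mk, coeff_mk, mul_comm]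
  have hy : (PowerSeries.mk fun n => (z n : ℂ) * (x : ℂ) ^ n) = PowerSeries.mk ec * PowerSeries.mk 1 := by
    ext n
    rw [coeff_mk, coeff_mul, Finset.Nat.sum_antidiagonal_eq_sum_range_succ_mk]
    simp only [coeff_mk, Pi.one_apply, mul_one]
    simp only [hec]
    exact_mod_cast hze n
  have h11 : (PowerSeries.mk 1 * PowerSeries.mk 1 : PowerSeries ℂ) = PowerSeries.mk fun n => (n : ℂ) + 1 := by
    ext n
    simp [coeff_mul]
  have hNx : ∀ n, N n * (x : ℂ) ^ n = ∑ k ∈ Finset.range (n + 1), g k * ((n - k : ℕ) + 1 : ℂ) := by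
    intro n
    have h1 := congrArg (rescale (x : ℂ)) hN
    rw [map_mul, map_mul, hrescale, hrescale, hrescale, hy] at h1
    have h2 : (PowerSeries.mk fun n => N n * (x : ℂ) ^ n) = PowerSeries.mk g * PowerSeries.mk fun n => (n : ℂ) + 1 := by
      rw [h1, ← h11, hg, hmk]
      ring
    have h3 := congrArg (coeff n) h2
    rw [coeff_mk, coeff_mul, Finset.Nat.sum_antidiagonal_eq_sum_range_succ_mk] at h3
    simpa using h3
  have hratio : ∀ n : ℕ, N n / z n / n =
      (∑ k ∈ Finset.range (n + 1), g k * ((n - k : ℕ) + 1 : ℂ)) / n /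
        (∑ i ∈ Finset.range (n + 1), e i : ℝ) := by
    intro n
    rw [← hNx, ← hze]
    push_cast
    have h1 : (x : ℂ) ^ n ≠ 0 := pow_ne_zero _ (by exact_mod_cast hx0.ne')
    rw [div_right_comm, mul_comm (z n : ℂ), ← div_div, mul_div_right_comm, mul_div_assoc,
      div_self h1, mul_one]
  constructor
  · simp only [hratio]
    have h1 := tendsto_sum_mul_div hg1
    have h2 : Tendsto (fun n : ℕ => ((∑ i ∈ Finset.range (n + 1), e i : ℝ) : ℂ)) atTop
        (𝓝 ((∑' n, e n : ℝ) : ℂ)) :=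
      (Complex.continuous_ofReal.tendsto _).comp
        ((hes'.hasSum.tendsto_sum_nat).comp (tendsto_add_atTop_nat 1))
    have hEne : ((∑' n, e n : ℝ) : ℂ) ≠ 0 := by
      have : (0 : ℝ) < ∑' n, e n := by linarith [(abs_le.1 hE).1]
      exact_mod_cast this.ne'
    have h3 := h1.div h2 hEne
    -- The two factors `z` carry the square of the sum of `e`; the normalization by `z n` removes
    -- one of them.
    have h4 : (∑' k, g k) / ((∑' n, e n : ℝ) : ℂ) = (∑' k, q k) * ((∑' n, e n : ℝ) : ℂ) := by
      have h5 : ∑' k, ec k = ((∑' n, e n : ℝ) : ℂ) := by simp only [hec, Complex.ofReal_tsum]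
      rw [hg3, h5, ← mul_assoc, mul_div_assoc, div_self hEne, mul_one]
    rwa [h4] at h3
  · intro n hn
    rw [hratio, norm_div, Complex.norm_real, Real.norm_of_nonneg (by linarith [hpartial n]),
      div_le_iff₀ (by linarith [hpartial n]), norm_div, Complex.norm_natCast,
      div_le_iff₀ (by positivity)]
    -- The constant `4` of the bound comes from `2 (10/9)² ≤ 4 · (4/5)`: the norms of `e` sum to at
    -- most `10/9` and its partial sums are at least `4/5`.
    have hesum : ∑' k, ‖ec k‖ ≤ 10 / 9 := by
      have h1 : ∀ k, ‖ec k‖ = |e k| := fun k => by simp [hec]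
      simp only [h1]
      refine (hes.tsum_le_tsum heb hgeo.summable).trans ?_
      rw [hgeo.tsum_eq, inv_le_comm₀ (by linarith) (by norm_num)]
      linarith
    have hg4 : ∑' k, ‖g k‖ ≤ (∑' k, ‖q k‖) * (10 / 9 * (10 / 9)) := by
      refine hg2.trans (mul_le_mul_of_nonneg_left (hee2.trans ?_) (tsum_nonneg fun _ => norm_nonneg _))
      exact mul_le_mul hesum hesum (tsum_nonneg fun _ => norm_nonneg _) (by norm_num)
    have hterm : ∀ k ∈ Finset.range (n + 1), ‖g k * ((n - k : ℕ) + 1 : ℂ)‖ ≤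
        ‖g k‖ * (2 * n) := by
      intro k _
      rw [norm_mul]
      gcongr
      have h5 : ‖((n - k : ℕ) + 1 : ℂ)‖ = ((n - k + 1 : ℕ) : ℝ) := by
        rw [← Complex.norm_natCast]
        push_cast
        rfl
      rw [h5]
      have : n - k + 1 ≤ 2 * n := by omega
      exact_mod_cast this
    have hQ : 0 ≤ ∑' k, ‖q k‖ := tsum_nonneg fun _ => norm_nonneg _
    simp only [← hqn]
    calc ‖∑ k ∈ Finset.range (n + 1), g k * ((n - k : ℕ) + 1 : ℂ)‖
        ≤ ∑ k ∈ Finset.range (n + 1), ‖g k‖ * (2 * n) := norm_sum_le_of_le _ hterm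
      _ = (∑ k ∈ Finset.range (n + 1), ‖g k‖) * (2 * n) := by rw [Finset.sum_mul]
      _ ≤ ((∑' k, ‖q k‖) * (10 / 9 * (10 / 9))) * (2 * n) := by
          gcongr
          exact (hg1.sum_le_tsum _ fun _ _ => norm_nonneg _).trans hg4
      _ ≤ 4 * (∑' k, ‖q k‖) * (4 / 5) * n := by
          have : 0 ≤ (∑' k, ‖q k‖) * n := by positivity
          nlinarith
      _ ≤ 4 * (∑' k, ‖q k‖) * (∑ i ∈ Finset.range (n + 1), e i) * n := by
          gcongr
          exact hpartial n

end RenewalAnalysis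


/-! ### The normalized Hilbert-Schmidt norm and its interplay with the operator norm. -/

section HilbertSchmidt

open scoped Matrix.Norms.L2Operator

/-- The normalized Hilbert-Schmidt norm. -/
noncomputable def hs {n : ℕ} (X : Op n) : ℝ := Real.sqrt (tracial (X.conjTranspose * X)).re

theorem tracial_conjTranspose_mul {n : ℕ} (X Y : Op n) :
    tracial (X.conjTranspose * Y) = (∑ p : (Fin n → Fin 2) × (Fin n → Fin 2),
      starRingEnd ℂ (X p.1 p.2) * Y p.1 p.2) / 2 ^ n := by
  unfold tracial
  simp only [Matrix.trace, Matrix.diag_apply, Matrix.mul_apply, Matrix.conjTranspose_apply]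
  rw [Fintype.sum_prod_type_right]
  rfl

theorem tracial_conjTranspose_mul_self {n : ℕ} (X : Op n) :
    tracial (X.conjTranspose * X) = ((∑ p : (Fin n → Fin 2) × (Fin n → Fin 2),
      ‖X p.1 p.2‖ ^ 2) / 2 ^ n : ℝ) := by
  rw [tracial_conjTranspose_mul]
  push_cast
  congr 1
  exact Finset.sum_congr rfl fun p _ => Complex.conj_mul' _

theorem hs_sq {n : ℕ} (X : Op n) : hs X ^ 2 = (tracial (X.conjTranspose * X)).re := by
  rw [hs, Real.sq_sqrt]
  rw [tracial_conjTranspose_mul_self, Complex.ofReal_re]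
  positivity

theorem hs_sq_eq_sum {n : ℕ} (X : Op n) : hs X ^ 2 =
    (∑ p : (Fin n → Fin 2) × (Fin n → Fin 2), ‖X p.1 p.2‖ ^ 2) / 2 ^ n := by
  rw [hs_sq, tracial_conjTranspose_mul_self, Complex.ofReal_re]

theorem tracial_conjTranspose_mul_self_eq_hs_sq {n : ℕ} (X : Op n) :
    tracial (X.conjTranspose * X) = ((hs X ^ 2 : ℝ) : ℂ) := by
  rw [tracial_conjTranspose_mul_self, hs_sq_eq_sum]

theorem hs_nonneg {n : ℕ} (X : Op n) : 0 ≤ hs X := Real.sqrt_nonneg _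

theorem hs_conjTranspose {n : ℕ} (X : Op n) : hs X.conjTranspose = hs X := by
  rw [hs, hs, Matrix.conjTranspose_conjTranspose, tracial_mul_comm]

theorem norm_tracial_conjTranspose_mul_le {n : ℕ} (X Y : Op n) :
    ‖tracial (X.conjTranspose * Y)‖ ≤ hs X * hs Y := by
  have h2 : (0 : ℝ) < 2 ^ n := by positivity
  refine abs_le_of_sq_le_sq' ?_ (mul_nonneg (hs_nonneg X) (hs_nonneg Y)) |>.2
  rw [mul_pow, hs_sq_eq_sum, hs_sq_eq_sum, tracial_conjTranspose_mul, norm_div, norm_pow,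
    Complex.norm_ofNat, div_pow, div_mul_div_comm, ← sq]
  gcongr
  have h3 := norm_sum_le (Finset.univ : Finset ((Fin n → Fin 2) × (Fin n → Fin 2)))
    (fun p => starRingEnd ℂ (X p.1 p.2) * Y p.1 p.2)
  refine (pow_le_pow_left₀ (norm_nonneg _) h3 2).trans ?_
  simp only [norm_mul, RCLike.norm_conj]
  exact Finset.sum_mul_sq_le_sq_mul_sq _ _ _

theorem norm_tracial_mul_le {n : ℕ} (X Y : Op n) : ‖tracial (X * Y)‖ ≤ hs X * hs Y := by
  have := norm_tracial_conjTranspose_mul_le X.conjTranspose Y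
  rwa [Matrix.conjTranspose_conjTranspose, hs_conjTranspose] at this

theorem hs_mul_le {n : ℕ} (A X : Op n) : hs (A * X) ≤ ‖A‖ * hs X := by
  refine abs_le_of_sq_le_sq' ?_ (mul_nonneg (norm_nonneg A) (hs_nonneg X)) |>.2
  rw [mul_pow, hs_sq_eq_sum, hs_sq_eq_sum, ← mul_div_assoc, Fintype.sum_prod_type_right,
    Fintype.sum_prod_type_right, Finset.mul_sum]
  gcongr with b
  have h := Matrix.l2_opNorm_mulVec A (WithLp.toLp 2 fun a => X a b)
  have h2 := pow_le_pow_left₀ (norm_nonneg _) h 2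
  rw [mul_pow, EuclideanSpace.norm_sq_eq, EuclideanSpace.norm_sq_eq] at h2
  exact h2

/-- Densities are measured in Hilbert-Schmidt norm, exponentials in operator norm. Pseudo-locality
controls the densities only in the former, so this estimate lets them enter the cluster expansion.
-/
theorem norm_tracial_mul_mul_mul_le {n : ℕ} (A X B Y : Op n) :
    ‖tracial (A * X * B * Y)‖ ≤ hs X * hs Y * (‖A‖ * ‖B‖) := by
  rw [mul_assoc (A * X)]
  refine (norm_tracial_mul_le _ _).trans ?_
  calc hs (A * X) * hs (B * Y) ≤ (‖A‖ * hs X) * (‖B‖ * hs Y) :=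
        mul_le_mul (hs_mul_le A X) (hs_mul_le B Y) (hs_nonneg _)
          (mul_nonneg (norm_nonneg _) (hs_nonneg _))
    _ = hs X * hs Y * (‖A‖ * ‖B‖) := by ring

theorem hs_one (n : ℕ) : hs (1 : Op n) = 1 := by
  rw [hs, Matrix.conjTranspose_one, one_mul, tracial_one, Complex.one_re, Real.sqrt_one]

theorem norm_tracial_le {n : ℕ} (A : Op n) : ‖tracial A‖ ≤ ‖A‖ := by
  have h1 := norm_tracial_mul_le A 1
  have h2 := hs_mul_le A 1
  rw [mul_one, hs_one] at *
  linarith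

theorem hs_shift {n x d : ℕ} (hx : x + d ≤ n) (q : Op d) : hs (shift n x q) = hs q := by
  rw [hs, hs, ← shift_conjTranspose, ← shift_mul, tracial_shift hx]

theorem hs_zero (n : ℕ) : hs (0 : Op n) = 0 := by simp [hs, tracial_zero]

/-- Star homomorphisms between C*-algebras are contractive. -/
theorem norm_shift_le {n x d : ℕ} (q : Op d) : ‖shift n x q‖ ≤ ‖q‖ := by
  by_cases hx : x + d ≤ n
  · exact NonUnitalStarAlgHom.norm_apply_le (shiftHom n x d hx) q
  · rw [shift_of_not_le hx, norm_zero]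
    exact norm_nonneg q

end HilbertSchmidt

/-! ### Extensive operators indexed by sets of bonds. -/

section LocalFamilies

/-- The sum of the translates of the two-site operator `h` over the bonds in `B`. -/
noncomputable def bondSum (n : ℕ) (h : Op 2) (B : Finset ℕ) : Op n := ∑ x ∈ B, shift n x h

/-- The sum of the translates of the densities `q` over the intervals of bonds contained in `B`. -/
noncomputable def familySum (n : ℕ) (q : ∀ d, Op d) (B : Finset ℕ) : Op n :=
  ∑ x ∈ Finset.range n, ∑ e ∈ Finset.range n,
    if Finset.Ico x (x + e + 1) ⊆ B then shift n x (q (e + 2)) else 0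

theorem bondSum_transpose {n : ℕ} {h : Op 2} (hT : h.transpose = h) (B : Finset ℕ) :
    (bondSum n h B).transpose = bondSum n h B := by
  unfold bondSum
  rw [Matrix.transpose_sum]
  exact Finset.sum_congr rfl fun x _ => by rw [← shift_transpose, hT]

theorem bondSum_conjTranspose {n : ℕ} {h : Op 2} (hH : h.IsHermitian) (B : Finset ℕ) :
    (bondSum n h B).IsHermitian := by
  unfold bondSum Matrix.IsHermitian
  rw [Matrix.conjTranspose_sum]
  exact Finset.sum_congr rfl fun x _ => by rw [← shift_conjTranspose, hH]

theorem familySum_transpose {n : ℕ} {q : ∀ d, Op d} (hq : ∀ d, (q d).transpose = -q d)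
    (B : Finset ℕ) : (familySum n q B).transpose = -familySum n q B := by
  unfold familySum
  rw [Matrix.transpose_sum, ← Finset.sum_neg_distrib]
  refine Finset.sum_congr rfl fun x _ => ?_
  rw [Matrix.transpose_sum, ← Finset.sum_neg_distrib]
  refine Finset.sum_congr rfl fun e _ => ?_
  split_ifs
  · rw [← shift_transpose, hq, ← shiftLinear_apply, map_neg, shiftLinear_apply]
  · simp

theorem bondSum_joinBonds {k l : ℕ} (h : Op 2) {B₁ B₂ : Finset ℕ}
    (h₁ : B₁ ⊆ Finset.range (k - 1)) (h₂ : B₂ ⊆ Finset.range (l - 1)) :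
    bondSum (k + l) h (joinBonds k B₁ B₂) =
      shift (k + l) 0 (bondSum k h B₁) + shift (k + l) k (bondSum l h B₂) := by
  unfold bondSum joinBonds
  rw [Finset.sum_union, Finset.sum_image (fun x _ y _ hxy => by simpa using hxy), shift_sum,
    shift_sum]
  · congr 1
    · refine Finset.sum_congr rfl fun x hx => ?_
      have := Finset.mem_range.1 (h₁ hx)
      rw [shift_shift (by omega) (by omega), zero_add]
    · refine Finset.sum_congr rfl fun x hx => ?_
      have := Finset.mem_range.1 (h₂ hx)
      rw [shift_shift (by omega) (by omega)]
  · rw [Finset.disjoint_left]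
    intro x hx hx'
    have := Finset.mem_range.1 (h₁ hx)
    obtain ⟨y, -, rfl⟩ := Finset.mem_image.1 hx'
    omega

/-- The bond between the two blocks is absent, so an interval of present bonds lies entirely in one
of them. -/
theorem familySum_joinBonds {k l : ℕ} (q : ∀ d, Op d) {B₁ B₂ : Finset ℕ}
    (h₁ : B₁ ⊆ Finset.range (k - 1)) (h₂ : B₂ ⊆ Finset.range (l - 1)) :
    familySum (k + l) q (joinBonds k B₁ B₂) =
      shift (k + l) 0 (familySum k q B₁) + shift (k + l) k (familySum l q B₂) := by
  have hmem₁ : ∀ {x e}, Finset.Ico x (x + e + 1) ⊆ B₁ → x + e + 2 ≤ k := by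
    intro x e h
    have := Finset.mem_range.1 (h₁ (h (Finset.mem_Ico.2 ⟨by omega, Nat.lt_succ_self (x + e)⟩)))
    omega
  have hmem₂ : ∀ {x e}, Finset.Ico x (x + e + 1) ⊆ B₂ → x + e + 2 ≤ l := by
    intro x e h
    have := Finset.mem_range.1 (h₂ (h (Finset.mem_Ico.2 ⟨by omega, Nat.lt_succ_self (x + e)⟩)))
    omega
  have hsmall : ∀ x < k, ∀ e, Finset.Ico x (x + e + 1) ⊆ joinBonds k B₁ B₂ ↔
      Finset.Ico x (x + e + 1) ⊆ B₁ := by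
    intro x hx e
    constructor
    · intro h
      have hnot : k - 1 ∉ Finset.Ico x (x + e + 1) := by
        intro hk
        rcases Finset.mem_union.1 (h hk) with h' | h'
        · have := Finset.mem_range.1 (h₁ h')
          omega
        · obtain ⟨y, -, hy⟩ := Finset.mem_image.1 h'
          omega
      intro y hy
      rcases Finset.mem_union.1 (h hy) with h' | h'
      · exact h'
      · obtain ⟨z, -, hz⟩ := Finset.mem_image.1 h'
        rw [Finset.mem_Ico] at hnot hy
        omega
    · exact fun h => h.trans Finset.subset_union_left
  have hlarge : ∀ x e, Finset.Ico (k + x) (k + x + e + 1) ⊆ joinBonds k B₁ B₂ ↔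
      Finset.Ico x (x + e + 1) ⊆ B₂ := by
    intro x e
    constructor
    · intro h y hy
      rw [Finset.mem_Ico] at hy
      have hky : k + y ∈ Finset.Ico (k + x) (k + x + e + 1) := by rw [Finset.mem_Ico]; omega
      rcases Finset.mem_union.1 (h hky) with h' | h'
      · have := Finset.mem_range.1 (h₁ h')
        omega
      · obtain ⟨z, hz, hz'⟩ := Finset.mem_image.1 h'
        obtain rfl : z = y := by simpa using hz'
        exact hz
    · intro h y hy
      rw [Finset.mem_Ico] at hy
      refine Finset.mem_union_right _ (Finset.mem_image.2 ⟨y - k, h ?_, by omega⟩)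
      rw [Finset.mem_Ico]
      omega
  unfold familySum
  rw [Finset.sum_range_add]
  congr 1
  · rw [shift_sum]
    refine Finset.sum_congr rfl fun x hx => ?_
    have hx' := Finset.mem_range.1 hx
    rw [shift_sum, Finset.sum_range_add, Finset.sum_eq_zero (s := Finset.range l), add_zero]
    · refine Finset.sum_congr rfl fun e _ => ?_
      by_cases h : Finset.Ico x (x + e + 1) ⊆ B₁
      · rw [if_pos ((hsmall x hx' e).2 h), if_pos h,
          shift_shift (by omega) (by have := hmem₁ h; omega), zero_add]
      · rw [if_neg (fun h' => h ((hsmall x hx' e).1 h')), if_neg h, shift_zero]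
    · intro e _
      rw [if_neg]
      intro h'
      have := hmem₁ ((hsmall x hx' _).1 h')
      omega
  · rw [shift_sum]
    refine Finset.sum_congr rfl fun x hx => ?_
    rw [shift_sum, add_comm k l, Finset.sum_range_add,
      Finset.sum_eq_zero (s := Finset.range k), add_zero]
    · refine Finset.sum_congr rfl fun e _ => ?_
      by_cases h : Finset.Ico x (x + e + 1) ⊆ B₂
      · rw [if_pos ((hlarge x e).2 h), if_pos h,
          shift_shift (by omega) (by have := hmem₂ h; omega)]
      · rw [if_neg (fun h' => h ((hlarge x e).1 h')), if_neg h, shift_zero]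
    · intro e _
      rw [if_neg]
      intro h'
      have := hmem₂ ((hlarge x _).1 h')
      omega

end LocalFamilies

/-! ### Partition functions and correlations as functions of the set of bonds. -/

section Weights

open scoped Matrix.Norms.L2Operator

theorem continuous_shift (n x d : ℕ) : Continuous (shift n x : Op d → Op n) :=
  (shiftLinear n x d).continuous_of_finiteDimensional

theorem continuous_tracial (n : ℕ) : Continuous (tracial : Op n → ℂ) :=
  (tracialLinear n).continuous_of_finiteDimensional

theorem shift_exp {n x d : ℕ} (hx : x + d ≤ n) (A : Op d) :
    shift n x (NormedSpace.exp A) = NormedSpace.exp (shift n x A) := by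
  let _ : NormedAlgebra ℚ (Op d) := NormedAlgebra.restrictScalars ℚ ℂ (Op d)
  exact NormedSpace.map_exp (shiftHom n x d hx) (continuous_shift n x d) A

/-- `A ⊗ B`, for operators on adjacent blocks. -/
noncomputable def blockProd (k l : ℕ) (A : Op k) (B : Op l) : Op (k + l) :=
  shift (k + l) 0 A * shift (k + l) k B

theorem blockProd_mul {k l : ℕ} (A A' : Op k) (B B' : Op l) :
    blockProd k l A B * blockProd k l A' B' = blockProd k l (A * A') (B * B') := by
  unfold blockProd
  rw [shift_mul, shift_mul, mul_assoc, mul_assoc,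
    ← mul_assoc (shift (k + l) k B), ← (shift_left_right_commute k l A' B).eq, mul_assoc]

theorem tracial_blockProd {k l : ℕ} (A : Op k) (B : Op l) :
    tracial (blockProd k l A B) = tracial A * tracial B :=
  tracial_shift_left_mul_shift_right k l A B

theorem shift_left_eq_blockProd {k l : ℕ} (A : Op k) :
    shift (k + l) 0 A = blockProd k l A 1 := by
  rw [blockProd, shift_one le_rfl, mul_one]

theorem shift_right_eq_blockProd {k l : ℕ} (B : Op l) :
    shift (k + l) k B = blockProd k l 1 B := by
  rw [blockProd, shift_one (by omega), one_mul]

theorem exp_smul_bondSum_joinBonds {k l : ℕ} (h : Op 2) (c : ℂ) {B₁ B₂ : Finset ℕ}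
    (h₁ : B₁ ⊆ Finset.range (k - 1)) (h₂ : B₂ ⊆ Finset.range (l - 1)) :
    NormedSpace.exp (c • bondSum (k + l) h (joinBonds k B₁ B₂)) =
      blockProd k l (NormedSpace.exp (c • bondSum k h B₁))
        (NormedSpace.exp (c • bondSum l h B₂)) := by
  rw [bondSum_joinBonds h h₁ h₂, smul_add, ← shift_smul, ← shift_smul,
    Matrix.exp_add_of_commute _ _ (shift_left_right_commute k l _ _), blockProd,
    shift_exp (by omega), shift_exp le_rfl]

/-- `ω(exp(c H_B))` -/
noncomputable def weight (h : Op 2) (c : ℂ) (n : ℕ) (B : Finset ℕ) : ℂ :=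
  tracial (NormedSpace.exp (c • bondSum n h B))

/-- `ω(exp(c₁ H_B) X_B exp(c₂ H_B) Y_B)` -/
noncomputable def correlation (h : Op 2) (X Y : ∀ d, Op d) (c₁ c₂ : ℂ) (n : ℕ)
    (B : Finset ℕ) : ℂ :=
  tracial (NormedSpace.exp (c₁ • bondSum n h B) * familySum n X B *
    NormedSpace.exp (c₂ • bondSum n h B) * familySum n Y B)

theorem weight_empty (h : Op 2) (c : ℂ) (n : ℕ) : weight h c n ∅ = 1 := by
  simp [weight, bondSum, tracial_one]

theorem weight_joinBonds (h : Op 2) (c : ℂ) (k l : ℕ) (B₁ B₂ : Finset ℕ)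
    (h₁ : B₁ ⊆ Finset.range (k - 1)) (h₂ : B₂ ⊆ Finset.range (l - 1)) :
    weight h c (k + l) (joinBonds k B₁ B₂) = weight h c k B₁ * weight h c l B₂ := by
  unfold weight
  rw [exp_smul_bondSum_joinBonds h c h₁ h₂, tracial_blockProd]

/-- Transposition preserves the trace and the Hamiltonian but reverses the sign of the family, so
the expectation equals its own negative. -/
theorem tracial_exp_mul_familySum {n : ℕ} {h : Op 2} (hT : h.transpose = h) {q : ∀ d, Op d}
    (hq : ∀ d, (q d).transpose = -q d) (c : ℂ) (B : Finset ℕ) :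
    tracial (NormedSpace.exp (c • bondSum n h B) * familySum n q B) = 0 := by
  have h1 : tracial (NormedSpace.exp (c • bondSum n h B) * familySum n q B) =
      -tracial (NormedSpace.exp (c • bondSum n h B) * familySum n q B) := by
    conv_lhs => rw [← tracial_transpose, Matrix.transpose_mul, familySum_transpose hq,
      ← Matrix.exp_transpose, Matrix.transpose_smul, bondSum_transpose hT, tracial_mul_comm]
    rw [mul_neg, ← tracialLinear_apply, map_neg, tracialLinear_apply]
  exact self_eq_neg.1 h1

theorem exp_smul_mul_exp_smul {n : ℕ} (A : Op n) (c₁ c₂ : ℂ) :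
    NormedSpace.exp (c₁ • A) * NormedSpace.exp (c₂ • A) = NormedSpace.exp ((c₁ + c₂) • A) := by
  rw [add_smul, Matrix.exp_add_of_commute]
  exact ((Commute.refl A).smul_left c₁).smul_right c₂

/-- With `X` in one block and `Y` in the other, the trace factors through a mean of `X`, which
vanishes by oddness. Correlations are thus a derivation over the weights, without subtraction of
disconnected parts. -/
theorem correlation_joinBonds {h : Op 2} (hT : h.transpose = h) {X Y : ∀ d, Op d}
    (hX : ∀ d, (X d).transpose = -X d) (c₁ c₂ : ℂ)
    (k l : ℕ) (B₁ B₂ : Finset ℕ)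
    (h₁ : B₁ ⊆ Finset.range (k - 1)) (h₂ : B₂ ⊆ Finset.range (l - 1)) :
    correlation h X Y c₁ c₂ (k + l) (joinBonds k B₁ B₂) =
      correlation h X Y c₁ c₂ k B₁ * weight h (c₁ + c₂) l B₂ +
        weight h (c₁ + c₂) k B₁ * correlation h X Y c₁ c₂ l B₂ := by
  have hzero : ∀ (n : ℕ) (B : Finset ℕ), tracial (NormedSpace.exp (c₁ • bondSum n h B) *
      familySum n X B * NormedSpace.exp (c₂ • bondSum n h B)) = 0 := by
    intro n B
    rw [tracial_mul_comm, ← mul_assoc, exp_smul_mul_exp_smul, tracial_exp_mul_familySum hT hX]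
  unfold correlation weight
  rw [exp_smul_bondSum_joinBonds h c₁ h₁ h₂, exp_smul_bondSum_joinBonds h c₂ h₁ h₂,
    familySum_joinBonds X h₁ h₂, familySum_joinBonds Y h₁ h₂, shift_left_eq_blockProd,
    shift_left_eq_blockProd, shift_right_eq_blockProd, shift_right_eq_blockProd]
  simp only [mul_add, add_mul, blockProd_mul, tracial_add, tracial_blockProd, mul_one, hzero,
    exp_smul_mul_exp_smul]
  ring

theorem correlation_zero (h : Op 2) (X Y : ∀ d, Op d) (c₁ c₂ : ℂ) :
    correlation h X Y c₁ c₂ 0 ∅ = 0 := by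
  simp [correlation, familySum, tracial_zero]

theorem dom_exp_bondSum (n : ℕ) (h : Op 2) (c : ℂ) :
    Dom (fun B => NormedSpace.exp (c • bondSum n h B))
      (fun B => Real.exp (‖c‖ * (‖h‖ * B.card))) :=
  ((Dom.sum_self fun x => norm_shift_le (n := n) (x := x) h).smul c).exp

/-- The majorant of the exponential is a product over bonds, so each bond of a cluster costs
`exp(‖c‖ ‖h‖) - 1`, which is small at high temperature. -/
theorem norm_mob_weight_le (h : Op 2) (c : ℂ) (n : ℕ) (S : Finset ℕ) :
    ‖mob (weight h c n) S‖ ≤ (Real.exp (‖c‖ * ‖h‖) - 1) ^ S.card := by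
  have h1 := map_mob (tracialLinear n).toAddMonoidHom
    (fun B => NormedSpace.exp (c • bondSum n h B)) S
  have h2 := dom_exp_bondSum n h c S
  have h3 : (fun B : Finset ℕ => Real.exp (‖c‖ * (‖h‖ * B.card))) =
      fun B => Real.exp (‖c‖ * ‖h‖) ^ B.card := by
    funext B
    rw [← Real.exp_nat_mul]
    congr 1
    ring
  rw [h3, mob_pow_card] at h2
  change mob (weight h c n) S = tracial (mob (fun B => NormedSpace.exp (c • bondSum n h B)) S) at h1
  rw [h1]
  exact (norm_tracial_le _).trans h2

end Weights


/-! ### Cluster bounds for correlations of pseudo-local quantities. -/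

section CorrelationBound

open scoped Matrix.Norms.L2Operator

/-- The bilinear map `(A, B) ↦ ω(A x B y)`. -/
noncomputable def sandwich {n : ℕ} (x y : Op n) : Op n →+ Op n →+ ℂ :=
  AddMonoidHom.mk' (fun A => AddMonoidHom.mk' (fun B => tracial (A * x * B * y))
    (fun B B' => by rw [mul_add, add_mul, tracial_add]))
    (fun A A' => by
      ext B
      simp [add_mul, tracial_add])

theorem sandwich_apply {n : ℕ} (x y A B : Op n) :
    sandwich x y A B = tracial (A * x * B * y) := rfl

theorem card_Ico_bonds (x e : ℕ) : (Finset.Ico x (x + e + 1)).card = e + 1 := by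
  rw [Nat.card_Ico]
  omega

/-- Bound of one term in the Möbius transform of a correlation. -/
theorem norm_mob_correlation_term_le {n : ℕ} (h : Op 2) (c₁ c₂ : ℂ) (x y : Op n) {C r ρ : ℝ}
    (hC : 0 ≤ C) (hr : 0 < r) (hr1 : r ≤ 1) (I I' : Finset ℕ)
    (hxy : hs x * hs y ≤ C * r ^ (I.card + I'.card))
    (hρ₁ : r * Real.exp ((‖c₁‖ + ‖c₂‖) * ‖h‖) ≤ ρ)
    (hρ₂ : Real.exp ((‖c₁‖ + ‖c₂‖) * ‖h‖) - 1 ≤ ρ) (S : Finset ℕ) :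
    ‖mob (fun B => if I ∪ I' ⊆ B then tracial (NormedSpace.exp (c₁ • bondSum n h B) * x *
      NormedSpace.exp (c₂ • bondSum n h B) * y) else 0) S‖ ≤ C * ρ ^ S.card := by
  set κ := (‖c₁‖ + ‖c₂‖) * ‖h‖ with hκ
  have hκ0 : 0 ≤ κ := by positivity
  have hexp : 0 ≤ Real.exp κ - 1 := by linarith [Real.add_one_le_exp κ]
  have hρ0 : 0 ≤ ρ := hexp.trans hρ₂
  -- The transform of this indicator is `1` at `I ∪ I'` and `0` elsewhere, hence nonnegative: the
  -- indicator dominates itself.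
  have hind : Dom (fun B : Finset ℕ => if I ∪ I' ⊆ B then (1 : ℝ) else 0)
      (fun B => if I ∪ I' ⊆ B then (1 : ℝ) else 0) := by
    intro T
    have h1 := mob_indicator_pow_card 1 (I ∪ I') T
    simp only [one_pow, mul_one, sub_self, one_mul] at h1
    rw [h1, Real.norm_of_nonneg]
    split_ifs <;> positivity
  have hmain := (Dom.bilin (sandwich x y) (mul_nonneg (hs_nonneg x) (hs_nonneg y))
    (fun A B => norm_tracial_mul_mul_mul_le A x B y) (dom_exp_bondSum n h c₁)
    (dom_exp_bondSum n h c₂))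
  have hsm : Dom (fun B : Finset ℕ => (if I ∪ I' ⊆ B then (1 : ℝ) else 0) •
      sandwich x y (NormedSpace.exp (c₁ • bondSum n h B)) (NormedSpace.exp (c₂ • bondSum n h B)))
      (fun B => 1 * ((if I ∪ I' ⊆ B then (1 : ℝ) else 0) * (hs x * hs y *
        (Real.exp (‖c₁‖ * (‖h‖ * B.card)) * Real.exp (‖c₂‖ * (‖h‖ * B.card)))))) :=
    Dom.bilin (E := ℝ) (F := ℂ) (G := ℂ) (AddMonoidHom.smul) zero_le_one
      (fun a b => by simp) hind hmain
  have h2 := hsm S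
  have h3 : (fun B : Finset ℕ => if I ∪ I' ⊆ B then tracial (NormedSpace.exp (c₁ • bondSum n h B)
      * x * NormedSpace.exp (c₂ • bondSum n h B) * y) else 0) =
      fun B => (if I ∪ I' ⊆ B then (1 : ℝ) else 0) •
      sandwich x y (NormedSpace.exp (c₁ • bondSum n h B))
        (NormedSpace.exp (c₂ • bondSum n h B)) := by
    funext B
    rw [sandwich_apply]
    split_ifs <;> simp
  have h4 : (fun B : Finset ℕ => 1 * ((if I ∪ I' ⊆ B then (1 : ℝ) else 0) * (hs x * hs y *
        (Real.exp (‖c₁‖ * (‖h‖ * B.card)) * Real.exp (‖c₂‖ * (‖h‖ * B.card)))))) =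
      fun B => (hs x * hs y) * ((if I ∪ I' ⊆ B then (1 : ℝ) else 0) * Real.exp κ ^ B.card) := by
    funext B
    rw [← Real.exp_add, ← Real.exp_nat_mul, show ‖c₁‖ * (‖h‖ * (B.card : ℝ)) +
      ‖c₂‖ * (‖h‖ * (B.card : ℝ)) = B.card * κ by rw [hκ]; ring]
    ring
  rw [h3]
  refine h2.trans ?_
  rw [h4, mob_mul_left, mob_indicator_pow_card]
  split_ifs with hJ
  · have hcard : (I ∪ I').card ≤ I.card + I'.card := Finset.card_union_le _ _
    have hS : (I ∪ I').card + (S \ (I ∪ I')).card = S.card := by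
      rw [Finset.card_sdiff_of_subset hJ, Nat.add_sub_cancel' (Finset.card_le_card hJ)]
    -- Bonds of `I ∪ I'` are paid for by the decay `r` of the densities, the other bonds of `S` by
    -- `exp κ - 1`; both costs are at most `ρ` per bond.
    calc hs x * hs y * (Real.exp κ ^ (I ∪ I').card * (Real.exp κ - 1) ^ (S \ (I ∪ I')).card)
        ≤ C * r ^ (I ∪ I').card * (Real.exp κ ^ (I ∪ I').card * ρ ^ (S \ (I ∪ I')).card) := by
          refine mul_le_mul (hxy.trans (mul_le_mul_of_nonneg_left ?_ hC)) ?_ (by positivity)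
            (by positivity)
          · exact pow_le_pow_of_le_one hr.le hr1 hcard
          · gcongr
      _ = C * ((r * Real.exp κ) ^ (I ∪ I').card * ρ ^ (S \ (I ∪ I')).card) := by
          rw [mul_pow]
          ring
      _ ≤ C * (ρ ^ (I ∪ I').card * ρ ^ (S \ (I ∪ I')).card) := by gcongr
      _ = C * ρ ^ S.card := by rw [← pow_add, hS]
  · rw [mul_zero]
    positivity

/-- Densities of a pseudo-local quantity that is odd under transposition. -/
structure IsOddFamily (q : ∀ d, Op d) (C r : ℝ) : Prop where
  transpose : ∀ d, (q d).transpose = -q d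
  bound : ∀ e, hs (q (e + 2)) ≤ C * r ^ (e + 1)

theorem correlation_eq_sum (h : Op 2) (X Y : ∀ d, Op d) (c₁ c₂ : ℂ) (n : ℕ) (B : Finset ℕ) :
    correlation h X Y c₁ c₂ n B =
      ∑ p ∈ Finset.range n ×ˢ Finset.range n, ∑ p' ∈ Finset.range n ×ˢ Finset.range n,
        if Finset.Ico p.1 (p.1 + p.2 + 1) ∪ Finset.Ico p'.1 (p'.1 + p'.2 + 1) ⊆ B then
          tracial (NormedSpace.exp (c₁ • bondSum n h B) * shift n p.1 (X (p.2 + 2)) *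
            NormedSpace.exp (c₂ • bondSum n h B) * shift n p'.1 (Y (p'.2 + 2))) else 0 := by
  unfold correlation familySum
  rw [← Finset.sum_product', ← Finset.sum_product', Finset.mul_sum, tracial_sum, Finset.sum_comm]
  refine Finset.sum_congr rfl fun p' _ => ?_
  rw [Finset.mul_sum, Finset.sum_mul, Finset.sum_mul, tracial_sum]
  refine Finset.sum_congr rfl fun p _ => ?_
  by_cases h1 : Finset.Ico p.1 (p.1 + p.2 + 1) ⊆ B
  · by_cases h2 : Finset.Ico p'.1 (p'.1 + p'.2 + 1) ⊆ B
    · rw [if_pos h1, if_pos h2, if_pos (Finset.union_subset h1 h2)]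
    · rw [if_neg h2, if_neg (fun h => h2 (Finset.subset_union_right.trans h)), mul_zero,
        tracial_zero]
  · rw [if_neg h1, if_neg (fun h => h1 (Finset.subset_union_left.trans h)), mul_zero, zero_mul,
      zero_mul, tracial_zero]

/-- The factor `n ^ 4` counts positions and lengths of two densities; a polynomial does no harm
against exponential decay in the cluster size. -/
theorem norm_mob_correlation_le (h : Op 2) {X Y : ∀ d, Op d} {C r ρ : ℝ} (hC : 0 ≤ C)
    (hr : 0 < r) (hr1 : r ≤ 1) (hX : IsOddFamily X C r) (hY : IsOddFamily Y C r) (c₁ c₂ : ℂ)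
    (hρ₁ : r * Real.exp ((‖c₁‖ + ‖c₂‖) * ‖h‖) ≤ ρ)
    (hρ₂ : Real.exp ((‖c₁‖ + ‖c₂‖) * ‖h‖) - 1 ≤ ρ) (n : ℕ) (S : Finset ℕ) :
    ‖mob (correlation h X Y c₁ c₂ n) S‖ ≤ C ^ 2 * n ^ 4 * ρ ^ S.card := by
  have hbound : ∀ {q : ∀ d, Op d}, IsOddFamily q C r → ∀ x e, hs (shift n x (q (e + 2))) ≤
      C * r ^ (e + 1) := by
    intro q hq x e
    by_cases hx : x + (e + 2) ≤ n
    · rw [hs_shift hx]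
      exact hq.bound e
    · rw [shift_of_not_le hx, hs_zero]
      positivity
  have h1 : mob (correlation h X Y c₁ c₂ n) S =
      ∑ p ∈ Finset.range n ×ˢ Finset.range n, ∑ p' ∈ Finset.range n ×ˢ Finset.range n,
        mob (fun B => if Finset.Ico p.1 (p.1 + p.2 + 1) ∪ Finset.Ico p'.1 (p'.1 + p'.2 + 1) ⊆ B then
          tracial (NormedSpace.exp (c₁ • bondSum n h B) * shift n p.1 (X (p.2 + 2)) *
            NormedSpace.exp (c₂ • bondSum n h B) * shift n p'.1 (Y (p'.2 + 2))) else 0) S := by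
    rw [mob_congr fun B _ => correlation_eq_sum h X Y c₁ c₂ n B, mob_sum]
    exact Finset.sum_congr rfl fun p _ => by rw [mob_sum]
  rw [h1]
  have h2 : ∀ p ∈ Finset.range n ×ˢ Finset.range n, ∀ p' ∈ Finset.range n ×ˢ Finset.range n,
      ‖mob (fun B => if Finset.Ico p.1 (p.1 + p.2 + 1) ∪ Finset.Ico p'.1 (p'.1 + p'.2 + 1) ⊆ B then
          tracial (NormedSpace.exp (c₁ • bondSum n h B) * shift n p.1 (X (p.2 + 2)) *
            NormedSpace.exp (c₂ • bondSum n h B) * shift n p'.1 (Y (p'.2 + 2))) else 0) S‖ ≤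
        C ^ 2 * ρ ^ S.card := by
    intro p _ p' _
    refine norm_mob_correlation_term_le h c₁ c₂ _ _ (sq_nonneg C) hr hr1 _ _ ?_ hρ₁ hρ₂ S
    rw [card_Ico_bonds, card_Ico_bonds]
    calc _ ≤ (C * r ^ (p.2 + 1)) * (C * r ^ (p'.2 + 1)) :=
          mul_le_mul (hbound hX _ _) (hbound hY _ _) (hs_nonneg _) (by positivity)
      _ = _ := by rw [pow_add]; ring
  refine (norm_sum_le_of_le _ fun p hp => norm_sum_le_of_le _ fun p' hp' => h2 p hp p' hp').trans ?_
  simp only [Finset.sum_const, Finset.card_product, Finset.card_range, nsmul_eq_mul]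
  push_cast
  exact le_of_eq (by ring)

theorem continuous_mob_correlation (h : Op 2) (X Y : ∀ d, Op d) (n : ℕ) (S : Finset ℕ) :
    Continuous fun c : ℂ × ℂ => mob (correlation h X Y c.1 c.2 n) S := by
  let _ : NormedAlgebra ℚ (Op n) := NormedAlgebra.restrictScalars ℚ ℂ (Op n)
  unfold mob correlation
  refine continuous_finsetSum _ fun T _ => Continuous.const_smul ?_ _
  refine (continuous_tracial n).comp ?_
  have hexp : Continuous (NormedSpace.exp : Op n → Op n) := NormedSpace.exp_continuous
  refine Continuous.mul (Continuous.mul (Continuous.mul ?_ continuous_const) ?_) continuous_const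
  · exact hexp.comp (continuous_fst.smul continuous_const)
  · exact hexp.comp (continuous_snd.smul continuous_const)

end CorrelationBound

/-! ### The renewal theorem applied to Gibbs weights and correlations. -/

section ThermodynamicLimit

open scoped Matrix.Norms.L2Operator

theorem weight_real {h : Op 2} (hH : h.IsHermitian) (β : ℝ) (n : ℕ) (B : Finset ℕ) :
    ((weight h (β : ℂ) n B).re : ℂ) = weight h (β : ℂ) n B := by
  rw [← Complex.conj_eq_iff_re, weight, ← tracial_conjTranspose, ← Matrix.exp_conjTranspose,
    Matrix.conjTranspose_smul, (bondSum_conjTranspose hH B : _ = _)]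
  simp

/-- Data of the renewal equation for the Gibbs weights at inverse temperature `-β`. -/
theorem weight_renewal {h : Op 2} (hH : h.IsHermitian) (hT : h.transpose = h) (β : ℝ) {δ : ℝ}
    (hδ : 0 < δ) (hδ' : δ ≤ 1 / 100) (hβ : Real.exp (|β| * ‖h‖) - 1 ≤ δ) :
    ∃ x E : ℝ, |x - 1| ≤ 8 * δ ∧ |E - 1| ≤ 20 * δ ∧
      (∀ n, 0 < (weight h (β : ℂ) n (Finset.range (n - 1))).re) ∧
      ∀ (X Y : ∀ d, Op d), (∀ d, (X d).transpose = -X d) →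
        ∀ c₁ c₂ : ℂ, c₁ + c₂ = β →
        (Summable fun n : ℕ => ‖if n = 0 then 0 else
          mob (correlation h X Y c₁ c₂ n) (Finset.range (n - 1))‖ * x ^ n) →
        Tendsto (fun n : ℕ => correlation h X Y c₁ c₂ n (Finset.range (n - 1)) /
          weight h (β : ℂ) n (Finset.range (n - 1)) / n) atTop
          (𝓝 ((∑' n : ℕ, (if n = 0 then 0 else
            mob (correlation h X Y c₁ c₂ n) (Finset.range (n - 1))) * (x : ℂ) ^ n) * E)) ∧
        ∀ n : ℕ, 0 < n → ‖correlation h X Y c₁ c₂ n (Finset.range (n - 1)) /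
          weight h (β : ℂ) n (Finset.range (n - 1)) / n‖ ≤
          4 * ∑' n : ℕ, ‖if n = 0 then 0 else
            mob (correlation h X Y c₁ c₂ n) (Finset.range (n - 1))‖ * x ^ n := by
  set z : ℕ → ℝ := fun n => (weight h (β : ℂ) n (Finset.range (n - 1))).re with hz
  set u : ℕ → ℝ := fun n => if n = 0 then 0 else
    mob (fun B => (weight h (β : ℂ) n B).re) (Finset.range (n - 1)) with hu
  have hzc : ∀ n, (z n : ℂ) = weight h (β : ℂ) n (Finset.range (n - 1)) :=
    fun n => weight_real hH β n _
  have hmobc : ∀ n S, ((mob (fun B => (weight h (β : ℂ) n B).re) S : ℝ) : ℂ) =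
      mob (weight h (β : ℂ) n) S := by
    intro n S
    have h1 := map_mob (Complex.ofRealHom : ℝ →+* ℂ).toAddMonoidHom
      (fun B => (weight h (β : ℂ) n B).re) S
    refine h1.symm.trans (mob_congr fun T _ => weight_real hH β n T)
  have huc : ∀ n, (u n : ℂ) = if n = 0 then 0 else
      mob (weight h (β : ℂ) n) (Finset.range (n - 1)) := by
    intro n
    simp only [hu]
    split_ifs
    · simp
    · exact hmobc _ _
  have hren := fun (X Y : ∀ d, Op d) (hX : ∀ d, (X d).transpose = -X d)
    (c₁ c₂ : ℂ) (hc : c₁ + c₂ = β) =>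
    renewal_powerSeries (weight h (β : ℂ)) (correlation h X Y c₁ c₂) (weight_empty h β 0)
    (correlation_zero h X Y c₁ c₂) (weight_joinBonds h β)
    (hc ▸ correlation_joinBonds hT hX c₁ c₂)
  have hzu : (PowerSeries.mk z : PowerSeries ℝ) * (1 - PowerSeries.mk u) = 1 := by
    -- The equation for the weights alone does not involve the families, so zero families suffice to
    -- extract it.
    have h1 := (hren 0 0 (fun d => by simp) β 0 (add_zero _)).1
    have hinj : Function.Injective (PowerSeries.map Complex.ofRealHom) :=
      PowerSeries.map_injective _ Complex.ofReal_injective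
    apply hinj
    rw [map_mul, map_sub, map_one]
    have h2 : PowerSeries.map Complex.ofRealHom (PowerSeries.mk z) =
        PowerSeries.mk fun n => weight h (β : ℂ) n (Finset.range (n - 1)) := by
      ext n
      simp only [PowerSeries.coeff_map, PowerSeries.coeff_mk]
      exact hzc n
    have h3 : PowerSeries.map Complex.ofRealHom (PowerSeries.mk u) =
        PowerSeries.mk fun n => if n = 0 then 0 else
          mob (weight h (β : ℂ) n) (Finset.range (n - 1)) := by
      ext n
      simp only [PowerSeries.coeff_map, PowerSeries.coeff_mk]
      exact huc n
    rw [h2, h3]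
    exact h1
  have hu1 : u 1 = 1 := by
    simp [hu, mob_empty, weight_empty]
  have hub : ∀ k, |u (k + 1)| ≤ δ ^ k := by
    intro k
    have h1 : |u (k + 1)| = ‖(u (k + 1) : ℂ)‖ := by simp
    rw [h1, huc, if_neg (Nat.succ_ne_zero k)]
    refine (norm_mob_weight_le h β (k + 1) _).trans ?_
    rw [Nat.add_sub_cancel, Finset.card_range, Complex.norm_real, Real.norm_eq_abs]
    refine pow_le_pow_left₀ ?_ hβ k
    have : 0 ≤ |β| * ‖h‖ := by positivity
    linarith [Real.add_one_le_exp (|β| * ‖h‖)]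
  obtain ⟨x, E, hx, hE, hpos, hlim⟩ := renewal_limit hδ hδ' (by simp [hu]) hu1 hub hzu
  refine ⟨x, E, hx, hE, hpos, fun X Y hX c₁ c₂ hc hs => ?_⟩
  have h1 := hlim (fun n => if n = 0 then 0 else
    mob (correlation h X Y c₁ c₂ n) (Finset.range (n - 1)))
    (fun n => correlation h X Y c₁ c₂ n (Finset.range (n - 1))) ?_ hs
  · simp only [hzc] at h1
    exact h1
  · simp only [hzc]
    exact (hren X Y hX c₁ c₂ hc).2

end ThermodynamicLimit


/-! ### Thermodynamic limit at high temperature and continuity as `β → 0+`. -/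

section ThermodynamicLimit

open scoped Matrix.Norms.L2Operator

theorem exists_high_temperature_radius (η : ℝ) (hη : 0 ≤ η) {r : ℝ} (hr1 : r < 1) :
    ∃ κ₀ > 0, ∀ κ, 0 ≤ κ → κ ≤ κ₀ → Real.exp (κ * η) - 1 ≤ (1 - r) / 100 := by
  have h1 : 0 < Real.log (1 + (1 - r) / 100) := Real.log_pos (by linarith)
  refine ⟨Real.log (1 + (1 - r) / 100) / (η + 1), by positivity, fun κ hκ hκ' => ?_⟩
  have h2 : κ * η ≤ Real.log (1 + (1 - r) / 100) := by
    rw [le_div_iff₀ (by linarith)] at hκ'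
    nlinarith
  have h3 := Real.exp_le_exp.2 h2
  rw [Real.exp_log (by linarith)] at h3
  linarith

theorem summable_correlation_bound {r : ℝ} (hr : 0 < r) (hr1 : r < 1) (C : ℝ) :
    Summable fun n : ℕ => 8 * C ^ 2 * ((n : ℝ) ^ 4 * (1 - (1 - r) / 4) ^ n) := by
  refine Summable.mul_left _ (summable_pow_mul_geometric_of_norm_lt_one 4 ?_)
  rw [Real.norm_of_nonneg (by linarith)]
  linarith

/-- A decay of `(1 + r)/2` per bond beats the growth of `x ^ n` at the renewal root: `(1 + r)/2 * x
≤ 1 - (1 - r)/4`. The factor `8` absorbs the one power by which sites outnumber bonds. The majorant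
does not depend on `c₁`, `c₂` and `x`. -/
theorem norm_mob_correlation_mul_pow_le (h : Op 2) {X Y : ∀ d, Op d} {C r : ℝ} (hC : 0 ≤ C)
    (hr : 0 < r) (hr1 : r < 1) (hX : IsOddFamily X C r) (hY : IsOddFamily Y C r) (c₁ c₂ : ℂ)
    (hκ : Real.exp ((‖c₁‖ + ‖c₂‖) * ‖h‖) - 1 ≤ (1 - r) / 100) {x : ℝ} (hx0 : 0 ≤ x)
    (hx : x ≤ 1 + 8 * ((1 - r) / 100)) (n : ℕ) :
    ‖if n = 0 then 0 else mob (correlation h X Y c₁ c₂ n) (Finset.range (n - 1))‖ * x ^ n ≤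
      8 * C ^ 2 * ((n : ℝ) ^ 4 * (1 - (1 - r) / 4) ^ n) := by
  rcases Nat.eq_zero_or_pos n with rfl | hn
  · simp
  · rw [if_neg hn.ne']
    have h1 := norm_mob_correlation_le h (ρ := (1 + r) / 2) hC hr hr1.le hX hY c₁ c₂
      (by nlinarith) (by linarith) n (Finset.range (n - 1))
    rw [Finset.card_range] at h1
    obtain ⟨m, rfl⟩ : ∃ m, n = m + 1 := ⟨n - 1, by omega⟩
    rw [Nat.add_sub_cancel] at *
    have h2 : (1 + r) / 2 * x ≤ 1 - (1 - r) / 4 := by nlinarith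
    calc _ ≤ C ^ 2 * ((m + 1 : ℕ) : ℝ) ^ 4 * ((1 + r) / 2) ^ m * x ^ (m + 1) := by gcongr
      _ = C ^ 2 * (((m + 1 : ℕ) : ℝ) ^ 4 * ((1 + r) / 2 * x) ^ m * x) := by
          rw [mul_pow, pow_succ x]; ring
      _ ≤ C ^ 2 * (((m + 1 : ℕ) : ℝ) ^ 4 * (1 - (1 - r) / 4) ^ m *
            (8 * (1 - (1 - r) / 4))) := by
          have h3 : 0 ≤ 1 - (1 - r) / 4 := by linarith
          have h4 : 0 ≤ (1 + r) / 2 * x := mul_nonneg (by linarith) hx0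
          have h5 : x ≤ 8 * (1 - (1 - r) / 4) := by linarith
          gcongr
      _ = _ := by rw [pow_succ (1 - (1 - r) / 4)]; ring

/-- High-temperature thermodynamic limit of correlations of pseudo-local quantities. -/
theorem exists_thermodynamic_limit {h : Op 2} (hH : h.IsHermitian) (hT : h.transpose = h) {r : ℝ}
    (hr : 0 < r) (hr1 : r < 1) : ∃ κ₀ > 0, ∀ C : ℝ, 0 ≤ C → ∃ M : ℝ, ∀ X Y : ∀ d, Op d,
      IsOddFamily X C r → IsOddFamily Y C r → ∀ (β : ℝ) (c₁ c₂ : ℂ), c₁ + c₂ = β →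
      ‖c₁‖ + ‖c₂‖ ≤ κ₀ → (∀ n, 0 < (weight h (β : ℂ) n (Finset.range (n - 1))).re) ∧
        (∃ L : ℂ, Tendsto (fun n : ℕ => correlation h X Y c₁ c₂ n (Finset.range (n - 1)) /
          weight h (β : ℂ) n (Finset.range (n - 1)) / n) atTop (𝓝 L)) ∧
        ∀ n : ℕ, 0 < n → ‖correlation h X Y c₁ c₂ n (Finset.range (n - 1)) /
          weight h (β : ℂ) n (Finset.range (n - 1)) / n‖ ≤ M := by
  obtain ⟨κ₀, hκ₀, hκ⟩ := exists_high_temperature_radius ‖h‖ (norm_nonneg h) hr1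
  refine ⟨κ₀, hκ₀, fun C hC => ⟨4 * ∑' n : ℕ, 8 * C ^ 2 *
    ((n : ℝ) ^ 4 * (1 - (1 - r) / 4) ^ n), fun X Y hX hY β c₁ c₂ hc hcκ => ?_⟩⟩
  have h1 := hκ _ (by positivity) hcκ
  have hβ : |β| ≤ ‖c₁‖ + ‖c₂‖ := by
    rw [← Real.norm_eq_abs, ← Complex.norm_real, ← hc]
    exact norm_add_le _ _
  have h2 := hκ _ (abs_nonneg β) (hβ.trans hcκ)
  obtain ⟨x, E, hx, hE, hpos, hlim⟩ :=
    weight_renewal hH hT β (δ := (1 - r) / 100) (by linarith) (by linarith) h2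
  have hx0 : 0 ≤ x := by linarith [(abs_le.1 hx).1]
  have hb := norm_mob_correlation_mul_pow_le h hC hr hr1 hX hY c₁ c₂ h1 hx0
    (by linarith [(abs_le.1 hx).2])
  have hs0 := summable_correlation_bound hr hr1 C
  have hs := Summable.of_nonneg_of_le (fun n => by positivity) hb hs0
  obtain ⟨h3, h4⟩ := hlim X Y hX.transpose c₁ c₂ hc hs
  refine ⟨hpos, ⟨_, h3⟩, fun n hn => (h4 n hn).trans ?_⟩
  exact mul_le_mul_of_nonneg_left (hs.tsum_le_tsum hb hs0) (by norm_num)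

theorem tendsto_high_temperature_radius (η : ℝ) :
    Tendsto (fun β : ℝ => Real.exp (|β| * η) - 1 + |β|) (𝓝[>] 0) (𝓝 0) := by
  have h1 : Continuous fun β : ℝ => Real.exp (|β| * η) - 1 + |β| := by fun_prop
  have h2 := h1.tendsto 0
  simp only [abs_zero, zero_mul, Real.exp_zero, sub_self, add_zero] at h2
  exact h2.mono_left nhdsWithin_le_nhds

/-- Correlation densities at high temperature converge to those at infinite temperature. -/
theorem tendsto_correlation_density {h : Op 2} (hH : h.IsHermitian) (hT : h.transpose = h)
    {C r : ℝ} (hC : 0 ≤ C) (hr : 0 < r) (hr1 : r < 1) {X Y : ∀ d, Op d} (hX : IsOddFamily X C r)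
    (hY : IsOddFamily Y C r) {L₀ : ℂ} (hL₀ : Tendsto (fun n : ℕ =>
      correlation h X Y 0 0 n (Finset.range (n - 1)) / n) atTop (𝓝 L₀)) :
    ∃ L : ℝ → ℂ, (∀ᶠ β : ℝ in 𝓝[>] 0, Tendsto (fun n : ℕ =>
      correlation h X Y ((-β : ℝ) : ℂ) 0 n (Finset.range (n - 1)) /
        weight h ((-β : ℝ) : ℂ) n (Finset.range (n - 1)) / n) atTop (𝓝 (L β))) ∧
      Tendsto L (𝓝[>] 0) (𝓝 L₀) := by
  -- The added `|β|` keeps `δ β` strictly positive for `β ≠ 0`, as the renewal theorem requires,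
  -- even if `h = 0`.
  set δ : ℝ → ℝ := fun β => Real.exp (|β| * ‖h‖) - 1 + |β| with hδ
  have hδlim : Tendsto δ (𝓝[>] 0) (𝓝 0) := tendsto_high_temperature_radius ‖h‖
  have hexp0 : ∀ β : ℝ, 0 ≤ Real.exp (|β| * ‖h‖) - 1 := fun β => by
    have : 0 ≤ |β| * ‖h‖ := by positivity
    linarith [Real.add_one_le_exp (|β| * ‖h‖)]
  have hδsmall : ∀ᶠ β in 𝓝[>] (0 : ℝ), 0 < δ β ∧ δ β ≤ (1 - r) / 100 := by
    filter_upwards [self_mem_nhdsWithin, hδlim.eventually_le_const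
      (show (0 : ℝ) < (1 - r) / 100 by linarith)] with β hβ hβ'
    have : 0 < |β| := abs_pos.2 (ne_of_gt hβ)
    exact ⟨by simp only [hδ]; linarith [hexp0 β], hβ'⟩
  -- The root and the constant are made functions of `β`; outside the high-temperature range their
  -- values are irrelevant.
  have hex : ∀ β : ℝ, ∃ xE : ℝ × ℝ, 0 < δ β ∧ δ β ≤ (1 - r) / 100 →
      |xE.1 - 1| ≤ 8 * δ β ∧ |xE.2 - 1| ≤ 20 * δ β ∧
      Tendsto (fun n : ℕ => correlation h X Y ((-β : ℝ) : ℂ) 0 n (Finset.range (n - 1)) /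
        weight h ((-β : ℝ) : ℂ) n (Finset.range (n - 1)) / n) atTop
        (𝓝 ((∑' n : ℕ, (if n = 0 then 0 else mob (correlation h X Y ((-β : ℝ) : ℂ) 0 n)
          (Finset.range (n - 1))) * (xE.1 : ℂ) ^ n) * xE.2)) := by
    intro β
    by_cases hβ : 0 < δ β ∧ δ β ≤ (1 - r) / 100
    · obtain ⟨x, E, hx, hE, hpos, hlim⟩ :=
        weight_renewal hH hT (-β) hβ.1 (by linarith [hβ.2])
          (by rw [abs_neg]; simp only [hδ]; linarith [abs_nonneg β])
      refine ⟨(x, E), fun _ => ⟨hx, hE, (hlim X Y hX.transpose _ _ (add_zero _) ?_).1⟩⟩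
      refine Summable.of_nonneg_of_le (fun n => ?_)
        (norm_mob_correlation_mul_pow_le h hC hr hr1 hX hY _ _ ?_ ?_ ?_)
        (summable_correlation_bound hr hr1 C)
      · have : 0 ≤ x := by linarith [(abs_le.1 hx).1, hβ.2]
        positivity
      · rw [norm_zero, add_zero, Complex.norm_real, Real.norm_eq_abs, abs_neg]
        have := hβ.2
        simp only [hδ] at this
        linarith [abs_nonneg β]
      · linarith [(abs_le.1 hx).1, hβ.2]
      · linarith [(abs_le.1 hx).2, hβ.2]
    · exact ⟨(0, 0), fun h' => absurd h' hβ⟩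
  choose xE hxE using hex
  have hsq : ∀ (f : ℝ → ℝ) (K : ℝ), (∀ᶠ β in 𝓝[>] (0 : ℝ), |f β - 1| ≤ K * δ β) →
      Tendsto f (𝓝[>] 0) (𝓝 1) := by
    intro f K hf
    rw [tendsto_iff_norm_sub_tendsto_zero]
    have h1 : Tendsto (fun β => K * δ β) (𝓝[>] 0) (𝓝 0) := by simpa using hδlim.const_mul K
    exact squeeze_zero' (Eventually.of_forall fun β => norm_nonneg _) hf h1
  have hxlim : Tendsto (fun β => (xE β).1) (𝓝[>] 0) (𝓝 1) :=
    hsq _ 8 (hδsmall.mono fun β hβ => (hxE β hβ).1)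
  have hElim : Tendsto (fun β => (xE β).2) (𝓝[>] 0) (𝓝 1) :=
    hsq _ 20 (hδsmall.mono fun β hβ => (hxE β hβ).2.1)
  set p : ℝ → ℕ → ℂ := fun β n => if n = 0 then 0 else
    mob (correlation h X Y ((-β : ℝ) : ℂ) 0 n) (Finset.range (n - 1)) with hp
  have hplim : ∀ n, Tendsto (fun β => p β n) (𝓝[>] 0) (𝓝 (p 0 n)) := by
    intro n
    by_cases hn : n = 0
    · simp [hp, hn]
    · simp only [hp, if_neg hn]
      have h1 : Continuous fun β : ℝ => mob (correlation h X Y ((-β : ℝ) : ℂ) 0 n)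
          (Finset.range (n - 1)) :=
        (continuous_mob_correlation h X Y n (Finset.range (n - 1))).comp
          (g := fun c : ℂ × ℂ => mob (correlation h X Y c.1 c.2 n) (Finset.range (n - 1)))
          (f := fun β : ℝ => (((-β : ℝ) : ℂ), (0 : ℂ))) (by fun_prop)
      exact (h1.tendsto 0).mono_left nhdsWithin_le_nhds
  have hp0 : ∀ n, p 0 n = if n = 0 then 0 else
      mob (correlation h X Y 0 0 n) (Finset.range (n - 1)) := by
    intro n
    simp [hp]
  have hp0s : Summable fun n => ‖p 0 n‖ := by
    refine Summable.of_nonneg_of_le (fun n => norm_nonneg _) (fun n => ?_)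
      (summable_correlation_bound hr hr1 C)
    have := norm_mob_correlation_mul_pow_le h hC hr hr1 hX hY 0 0
      (by simp; linarith) (x := 1) (by norm_num) (by linarith) n
    rwa [one_pow, mul_one, ← hp0] at this
  -- At `β = 0` all weights are `1` and the correlation series is `P/(1 - X)²`, which identifies
  -- `L₀` by uniqueness of limits.
  have hL0 : L₀ = ∑' n, p 0 n := by
    refine tendsto_nhds_unique hL₀ ((tendsto_sum_mul_div hp0s).congr fun n => ?_)
    have h1 := (renewal_powerSeries (weight h 0) (correlation h X Y 0 0) (weight_empty h 0 0)
      (correlation_zero h X Y 0 0) (weight_joinBonds h 0)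
      (by simpa using correlation_joinBonds (Y := Y) hT hX.transpose 0 0)).2
    have h2 : ∀ n B, weight h 0 n B = 1 := fun n B => by simp [weight, tracial_one]
    simp only [h2, ← hp0] at h1
    have h11 : ((PowerSeries.mk fun _ => 1) * (PowerSeries.mk fun _ => 1) : PowerSeries ℂ) =
        PowerSeries.mk fun n => (n : ℂ) + 1 := by
      ext n
      simp [PowerSeries.coeff_mul]
    rw [mul_assoc, h11] at h1
    have h3 := congrArg (PowerSeries.coeff n) h1
    rw [PowerSeries.coeff_mk, PowerSeries.coeff_mul,
      Finset.Nat.sum_antidiagonal_eq_sum_range_succ_mk] at h3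
    simp only [PowerSeries.coeff_mk] at h3
    rw [h3]
  refine ⟨fun β => (∑' n, p β n * ((xE β).1 : ℂ) ^ n) * (xE β).2,
    hδsmall.mono fun β hβ => (hxE β hβ).2.2, ?_⟩
  have hmain : Tendsto (fun β => ∑' n, p β n * ((xE β).1 : ℂ) ^ n) (𝓝[>] 0)
      (𝓝 (∑' n, p 0 n)) := by
    refine tendsto_tsum_of_dominated_convergence (summable_correlation_bound hr hr1 C)
      (fun n => ?_) ?_
    · have h1 : Tendsto (fun β => (((xE β).1 : ℝ) : ℂ)) (𝓝[>] 0) (𝓝 ((1 : ℝ) : ℂ)) :=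
        (Complex.continuous_ofReal.tendsto _).comp hxlim
      simpa using (hplim n).mul (h1.pow n)
    · filter_upwards [hδsmall] with β hβ n
      have hx := (hxE β hβ).1
      have hx0 : 0 ≤ (xE β).1 := by linarith [(abs_le.1 hx).1, hβ.2]
      rw [norm_mul, norm_pow, Complex.norm_real, Real.norm_of_nonneg hx0]
      refine norm_mob_correlation_mul_pow_le h hC hr hr1 hX hY _ _ ?_ hx0
        (by linarith [(abs_le.1 hx).2, hβ.2]) n
      rw [norm_zero, add_zero, Complex.norm_real, Real.norm_eq_abs, abs_neg]
      have := hβ.2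
      simp only [hδ] at this
      linarith [abs_nonneg β]
  have h2 : Tendsto (fun β => (((xE β).2 : ℝ) : ℂ)) (𝓝[>] 0) (𝓝 ((1 : ℝ) : ℂ)) :=
    (Complex.continuous_ofReal.tendsto _).comp hElim
  rw [hL0]
  simpa using hmain.mul h2

end ThermodynamicLimit


/-! ### Weak convergence from characteristic functions near zero and exponential moments. -/

section WeakLimits

open MeasureTheory ProbabilityTheory

/-- An exponential moment makes the complex moment generating function analytic in a strip around
the imaginary axis. Agreement on a segment of this axis spreads over the strip by the identity
theorem, and on the axis the function is the characteristic function. -/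
theorem ext_of_charFun_eq_of_integrable_exp {μ ν : Measure ℝ} [IsProbabilityMeasure μ]
    [IsProbabilityMeasure ν] {ρ s₀ : ℝ} (hρ : 0 < ρ) (hs₀ : 0 < s₀)
    (hμ : Integrable (fun x => Real.exp (ρ * |x|)) μ)
    (hν : Integrable (fun x => Real.exp (ρ * |x|)) ν)
    (h : ∀ s, |s| < s₀ → charFun μ s = charFun ν s) : μ = ν := by
  have hint : ∀ κ : Measure ℝ, Integrable (fun x => Real.exp (ρ * |x|)) κ →
      Set.Ioo (-ρ) ρ ⊆ interior (integrableExpSet id κ) := by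
    intro κ hκ
    refine interior_maximal (fun t ht => ?_) isOpen_Ioo
    refine hκ.mono' (by fun_prop) (Eventually.of_forall fun x => ?_)
    rw [Real.norm_of_nonneg (Real.exp_pos _).le, Real.exp_le_exp]
    calc t * id x ≤ |t * x| := le_abs_self _
      _ = |t| * |x| := abs_mul _ _
      _ ≤ ρ * |x| := mul_le_mul_of_nonneg_right (abs_lt.2 ht).le (abs_nonneg x)
  set U : Set ℂ := Complex.re ⁻¹' Set.Ioo (-ρ) ρ with hU
  have hUc : IsPreconnected U :=
    ((convex_Ioo (-ρ) ρ).linear_preimage Complex.reLm).isPreconnected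
  have hE : Set.EqOn (complexMGF id μ) (complexMGF id ν) U := by
    refine (analyticOnNhd_complexMGF.mono fun z hz => hint μ hμ hz).eqOn_of_preconnected_of_frequently_eq
      (analyticOnNhd_complexMGF.mono fun z hz => hint ν hν hz) hUc (z₀ := 0)
      (show (0 : ℂ).re ∈ Set.Ioo (-ρ) ρ from ⟨by simpa using hρ, by simpa using hρ⟩) ?_
    have h1 : Tendsto (fun s : ℝ => (s : ℂ) * Complex.I) (𝓝[≠] 0) (𝓝[≠] 0) := by
      refine tendsto_nhdsWithin_iff.2 ⟨?_, ?_⟩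
      · have : Continuous fun s : ℝ => (s : ℂ) * Complex.I := by fun_prop
        simpa using (this.tendsto 0).mono_left nhdsWithin_le_nhds
      · filter_upwards [self_mem_nhdsWithin] with s hs
        simpa using hs
    refine h1.frequently (Eventually.frequently ?_)
    have h2 : ∀ᶠ s : ℝ in 𝓝[≠] 0, s ∈ Set.Ioo (-s₀) s₀ :=
      nhdsWithin_le_nhds (Ioo_mem_nhds (by linarith) hs₀)
    filter_upwards [h2] with s hs
    rw [complexMGF_id_mul_I, complexMGF_id_mul_I, h s (abs_lt.2 hs)]
  refine Measure.ext_of_charFun (funext fun s => ?_)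
  rw [← complexMGF_id_mul_I, ← complexMGF_id_mul_I]
  exact hE (show ((s : ℂ) * Complex.I).re ∈ Set.Ioo (-ρ) ρ from
    ⟨by simpa using hρ, by simpa using hρ⟩)

/-- Weak convergence controls only bounded continuous functions, so moment bounds are carried by
truncated exponentials; Fatou's lemma removes the truncation. -/
theorem integrable_exp_of_integral_min_le {μ : Measure ℝ} [IsProbabilityMeasure μ] {ρ M : ℝ}
    (h : ∀ K : ℕ, ∫ x, min (Real.exp (ρ * |x|)) K ∂μ ≤ M) :
    Integrable (fun x => Real.exp (ρ * |x|)) μ := by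
  refine ⟨by fun_prop, ?_⟩
  rw [hasFiniteIntegral_iff_ofReal (Eventually.of_forall fun x => (Real.exp_pos _).le)]
  have hnn : ∀ (K : ℕ) (x : ℝ), 0 ≤ min (Real.exp (ρ * |x|)) K := fun K x =>
    le_min (Real.exp_pos _).le K.cast_nonneg
  have h1 : ∀ K : ℕ, ∫⁻ x, ENNReal.ofReal (min (Real.exp (ρ * |x|)) K) ∂μ ≤ ENNReal.ofReal M := by
    intro K
    rw [← ofReal_integral_eq_lintegral_ofReal ?_ (Eventually.of_forall (hnn K))]
    · exact ENNReal.ofReal_le_ofReal (h K)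
    · refine Integrable.mono' (integrable_const (K : ℝ)) (by fun_prop)
        (Eventually.of_forall fun x => ?_)
      rw [Real.norm_of_nonneg (hnn K x)]
      exact min_le_right _ _
  have h2 : ∫⁻ x, ENNReal.ofReal (Real.exp (ρ * |x|)) ∂μ ≤ ENNReal.ofReal M := by
    refine (lintegral_mono fun x => ?_).trans ((lintegral_liminf_le (u := (atTop : Filter ℕ))
      (f := fun (K : ℕ) x => ENNReal.ofReal (min (Real.exp (ρ * |x|)) K))
        (fun K => by fun_prop)).trans ?_)
    · refine (Tendsto.liminf_eq (tendsto_const_nhds.congr' ?_)).ge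
      filter_upwards [eventually_ge_atTop ⌈Real.exp (ρ * |x|)⌉₊] with K hK
      rw [min_eq_left (Nat.ceil_le.1 hK)]
    · exact (liminf_le_liminf (Eventually.of_forall h1)).trans (by simp)
  exact h2.trans_lt ENNReal.ofReal_lt_top

/-- Convergence of characteristic functions near zero together with a uniform exponential moment
implies weak convergence. -/
theorem exists_tendsto_of_tendsto_charFun_near_zero (μ : ℕ → ProbabilityMeasure ℝ) {ρ s₀ M : ℝ}
    (hρ : 0 < ρ) (hs₀ : 0 < s₀)
    (hM : ∀ n (K : ℕ), ∫ x, min (Real.exp (ρ * |x|)) K ∂(μ n : Measure ℝ) ≤ M)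
    (h : ∀ s, |s| < s₀ → ∃ L, Tendsto (fun n => charFun (μ n : Measure ℝ) s) atTop (𝓝 L)) :
    ∃ ν : ProbabilityMeasure ℝ, Tendsto μ atTop (𝓝 ν) := by
  -- Markov's inequality for the exponential truncated at `K` bounds the mass outside `[-R, R]` by
  -- `M / K`.
  have htight : IsTightMeasureSet {((κ : ProbabilityMeasure ℝ) : Measure ℝ) | κ ∈ Set.range μ} := by
    rw [isTightMeasureSet_iff_exists_isCompact_measure_compl_le]
    intro ε hε
    by_cases hεt : ε = ⊤
    · exact ⟨∅, isCompact_empty, fun _ _ => hεt ▸ le_top⟩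
    obtain ⟨K, hK⟩ := exists_nat_gt (M / ε.toReal)
    have hε' : 0 < ε.toReal := ENNReal.toReal_pos hε.ne' hεt
    have hlog : ∃ R : ℝ, (K : ℝ) ≤ Real.exp (ρ * R) := by
      refine ⟨K / ρ, ?_⟩
      rw [mul_div_cancel₀ _ hρ.ne']
      linarith [Real.add_one_le_exp (K : ℝ)]
    obtain ⟨R, hR⟩ := hlog
    refine ⟨Set.Icc (-R) R, isCompact_Icc, ?_⟩
    rintro _ ⟨_, ⟨n, rfl⟩, rfl⟩
    have h1 : (K : ℝ) * (μ n : Measure ℝ).real {x | (K : ℝ) ≤ min (Real.exp (ρ * |x|)) K} ≤ M :=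
      (mul_meas_ge_le_integral_of_nonneg (Eventually.of_forall fun x =>
        le_min (Real.exp_pos _).le K.cast_nonneg) (Integrable.mono' (integrable_const (K : ℝ))
          (by fun_prop) (Eventually.of_forall fun x => by
            rw [Real.norm_of_nonneg (le_min (Real.exp_pos _).le K.cast_nonneg)]
            exact min_le_right _ _)) K).trans (hM n K)
    have hsub : (Set.Icc (-R) R)ᶜ ⊆ {x | (K : ℝ) ≤ min (Real.exp (ρ * |x|)) K} := by
      intro x hx
      have hx' : R < |x| := by
        by_contra! hx'
        exact hx (abs_le.1 hx')
      refine le_min (hR.trans (Real.exp_le_exp.2 ?_)) le_rfl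
      exact mul_le_mul_of_nonneg_left hx'.le hρ.le
    have hM0 : 0 ≤ M := le_trans (by positivity) h1
    have hK0 : (0 : ℝ) < K := lt_of_le_of_lt (by positivity) hK
    have h2 : (μ n : Measure ℝ).real (Set.Icc (-R) R)ᶜ ≤ ε.toReal := by
      have h3 := measureReal_mono (μ := (μ n : Measure ℝ)) hsub
      rw [div_lt_iff₀ hε'] at hK
      by_contra! h4
      nlinarith [mul_lt_mul_of_pos_left h4 hK0, mul_le_mul_of_nonneg_left h3 hK0.le]
    exact (ENNReal.toReal_le_toReal (measure_ne_top _ _) hεt).1 h2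
  have hcomp := isCompact_closure_of_isTightMeasureSet htight
  -- By Prokhorov's theorem every ultrafilter has a limit; the sequence converges once the limits
  -- along all ultrafilters finer than `atTop` coincide.
  have hex : ∀ U : Ultrafilter ℕ, ∃ κ : ProbabilityMeasure ℝ, Tendsto μ U (𝓝 κ) := by
    intro U
    obtain ⟨κ, -, hκ⟩ := hcomp.ultrafilter_le_nhds (U.map μ)
      (.trans (by simp) (monotone_principal subset_closure))
    exact ⟨κ, hκ⟩
  have hchar : ∀ (U : Ultrafilter ℕ) (κ : ProbabilityMeasure ℝ), Tendsto μ U (𝓝 κ) → ∀ s,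
      Tendsto (fun n => charFun (μ n : Measure ℝ) s) U (𝓝 (charFun (κ : Measure ℝ) s)) := by
    intro U κ hκ s
    rw [ProbabilityMeasure.tendsto_iff_forall_integral_rclike_tendsto ℂ] at hκ
    have := hκ (BoundedContinuousFunction.innerProbChar s)
    simpa only [charFun_eq_integral_innerProbChar] using this
  have hexp : ∀ (U : Ultrafilter ℕ) (κ : ProbabilityMeasure ℝ), Tendsto μ U (𝓝 κ) →
      Integrable (fun x => Real.exp (ρ * |x|)) (κ : Measure ℝ) := by
    intro U κ hκ
    refine integrable_exp_of_integral_min_le (M := M) fun K => ?_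
    rw [ProbabilityMeasure.tendsto_iff_forall_integral_tendsto] at hκ
    have := hκ (BoundedContinuousFunction.ofNormedAddCommGroup
      (fun x : ℝ => min (Real.exp (ρ * |x|)) (K : ℝ)) (by fun_prop) K fun x => by
        rw [Real.norm_of_nonneg (le_min (Real.exp_pos _).le K.cast_nonneg)]
        exact min_le_right _ _)
    exact le_of_tendsto this (Eventually.of_forall fun n => hM n K)
  obtain ⟨ν, hν⟩ := hex (hyperfilter ℕ)
  refine ⟨ν, (Filter.tendsto_iff_ultrafilter _ _ _).2 fun U hU => ?_⟩
  obtain ⟨κ, hκ⟩ := hex U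
  have : κ = ν := by
    have hm : (κ : Measure ℝ) = (ν : Measure ℝ) := by
      refine ext_of_charFun_eq_of_integrable_exp hρ hs₀ (hexp U κ hκ) (hexp _ ν hν) fun s hs => ?_
      obtain ⟨L, hL⟩ := h s hs
      rw [tendsto_nhds_unique (hchar U κ hκ s) (hL.mono_left hU),
        tendsto_nhds_unique (hchar _ ν hν s) (hL.mono_left Nat.hyperfilter_le_atTop)]
    exact Subtype.ext hm
  exact this ▸ hκ

end WeakLimits


/-! ### Spectral measures of autocorrelations, their atom at zero, and the Mazur inequality. -/

section SpectralMeasure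

open MeasureTheory ProbabilityTheory

/-- The mean of a character over `[-t, t]` is `sinc (t * x)`, which is bounded by `1` and tends to
the indicator of `{0}`. -/
theorem tendsto_mean_charFun (μ : ProbabilityMeasure ℝ) :
    Tendsto (fun t : ℝ => (1 / (2 * (t : ℂ))) * ∫ s in (-t)..t, charFun (μ : Measure ℝ) s) atTop
      (𝓝 (((μ : Measure ℝ).real {0} : ℝ) : ℂ)) := by
  have h1 : Tendsto (fun t : ℝ => ∫ x, Real.sinc (t * x) ∂(μ : Measure ℝ)) atTop
      (𝓝 (∫ x, Set.indicator {0} (fun _ => (1 : ℝ)) x ∂(μ : Measure ℝ))) := by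
    refine tendsto_integral_filter_of_dominated_convergence (fun _ => (1 : ℝ))
      (Eventually.of_forall fun t => by fun_prop)
      (Eventually.of_forall fun t => Eventually.of_forall fun x => ?_) (integrable_const _)
      (Eventually.of_forall fun x => ?_)
    · exact abs_le.2 ⟨Real.neg_one_le_sinc _, Real.sinc_le_one _⟩
    · by_cases hx : x = 0
      · simp [hx]
      · rw [Set.indicator_of_notMem (by simpa using hx)]
        have h2 : Tendsto (fun t : ℝ => |t * x|⁻¹) atTop (𝓝 0) := by
          simp_rw [abs_mul, mul_inv]
          simpa using (tendsto_inv_atTop_zero.comp tendsto_abs_atTop_atTop).mul_const |x|⁻¹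
        refine squeeze_zero_norm' ?_ h2
        filter_upwards [eventually_gt_atTop 0] with t ht
        rw [Real.sinc_of_ne_zero (mul_ne_zero ht.ne' hx), Real.norm_eq_abs, abs_div, div_eq_mul_inv]
        exact mul_le_of_le_one_left (by positivity) (Real.abs_sin_le_one _)
  rw [integral_indicator_const _ (measurableSet_singleton 0), smul_eq_mul, mul_one] at h1
  refine ((Complex.continuous_ofReal.tendsto _).comp h1).congr' ?_
  filter_upwards [eventually_gt_atTop 0] with t ht
  rw [integral_charFun_Icc ht]
  have : (t : ℂ) ≠ 0 := by exact_mod_cast ht.ne'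
  simp only [Function.comp_apply]
  field_simp

theorem exists_discrete_probabilityMeasure {ι : Type*} [Fintype ι] (a ω : ι → ℝ)
    (ha : ∀ i, 0 ≤ a i) (hA : 0 < ∑ i, a i) :
    ∃ μ : ProbabilityMeasure ℝ, ∀ {E : Type} [NormedAddCommGroup E] [NormedSpace ℝ E]
      [CompleteSpace E] (g : ℝ → E),
      ∫ x, g x ∂(μ : Measure ℝ) = (∑ i, a i)⁻¹ • ∑ i, a i • g (ω i) := by
  set A := ∑ i, a i with hAdef
  have hp : IsProbabilityMeasure (∑ i, ENNReal.ofReal (a i / A) • Measure.dirac (ω i)) := by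
    constructor
    simp only [Measure.coe_finsetSum, Finset.sum_apply, Measure.smul_apply, measure_univ,
      smul_eq_mul, mul_one]
    rw [← ENNReal.ofReal_sum_of_nonneg fun i _ => div_nonneg (ha i) hA.le, ← Finset.sum_div,
      div_self hA.ne', ENNReal.ofReal_one]
  refine ⟨⟨_, hp⟩, fun {E} _ _ _ g => ?_⟩
  change ∫ x, g x ∂(∑ i, ENNReal.ofReal (a i / A) • Measure.dirac (ω i)) = _
  rw [integral_finsetSum_measure fun i _ =>
    (integrable_dirac (by simp)).smul_measure ENNReal.ofReal_ne_top, Finset.smul_sum]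
  refine Finset.sum_congr rfl fun i _ => ?_
  rw [integral_smul_measure, integral_dirac, ENNReal.toReal_ofReal (div_nonneg (ha i) hA.le),
    smul_smul, div_eq_inv_mul]

/-- Limits of finite trigonometric sums with nonnegative amplitudes and controlled exponential
moments are given by a measure. -/
theorem exists_spectral_measure {ι : ℕ → Type*} [∀ n, Fintype (ι n)] (a ω : ∀ n, ι n → ℝ)
    (ha : ∀ n i, 0 ≤ a n i) {ρ M : ℝ} (hρ : 0 < ρ)
    (hM : ∀ n, 0 < n → ∀ z : ℂ, ‖z‖ ≤ ρ → ‖∑ i, (a n i : ℂ) * Complex.exp (z * ω n i)‖ ≤ M)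
    (hlim : ∀ z : ℂ, ‖z‖ ≤ ρ →
      ∃ L, Tendsto (fun n => ∑ i, (a n i : ℂ) * Complex.exp (z * ω n i)) atTop (𝓝 L))
    {C : ℝ} (hC : 0 < C) (hC' : Tendsto (fun n => ∑ i, a n i) atTop (𝓝 C)) :
    ∃ μ : ProbabilityMeasure ℝ,
      (∀ s : ℝ, Tendsto (fun n => ∑ i, (a n i : ℂ) * Complex.exp ((Complex.I * s) * ω n i)) atTop
        (𝓝 (C * charFun (μ : Measure ℝ) s))) ∧
      ∀ φ : BoundedContinuousFunction ℝ ℝ, Tendsto (fun n => ∑ i, a n i * φ (ω n i)) atTop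
        (𝓝 (C * ∫ x, φ x ∂(μ : Measure ℝ))) := by
  -- The total mass may vanish for small `n`; those indices are discarded before normalizing.
  obtain ⟨N, hN⟩ := eventually_atTop.1 ((eventually_gt_atTop 0).and
    (hC'.eventually (lt_mem_nhds (half_lt_self hC))))
  have hpos : ∀ n, 0 < ∑ i, a (n + N) i := fun n =>
    (half_pos hC).trans (hN (n + N) (by omega)).2
  have hex := fun n => exists_discrete_probabilityMeasure (a (n + N)) (ω (n + N))
    (ha (n + N)) (hpos n)
  choose μ hμ using hex
  have hC'' : Tendsto (fun n => ∑ i, a (n + N) i) atTop (𝓝 C) :=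
    hC'.comp (tendsto_add_atTop_nat N)
  have hchar : ∀ (n : ℕ) (s : ℝ), ∑ i, (a (n + N) i : ℂ) *
      Complex.exp ((Complex.I * s) * ω (n + N) i) =
        ((∑ i, a (n + N) i : ℝ) : ℂ) * charFun (μ n : Measure ℝ) s := by
    intro n s
    rw [charFun_apply_real, hμ, Complex.real_smul, ← mul_assoc, ← Complex.ofReal_mul,
      mul_inv_cancel₀ (hpos n).ne', Complex.ofReal_one, one_mul]
    refine Finset.sum_congr rfl fun i _ => ?_
    rw [Complex.real_smul]
    congr 2
    ring
  obtain ⟨ν, hν⟩ := exists_tendsto_of_tendsto_charFun_near_zero μ (M := (C / 2)⁻¹ * (M + M)) hρ hρ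
    (fun n K => by
      rw [hμ, smul_eq_mul]
      have h1 := (hN (n + N) (by omega))
      -- Since `exp(ρ|ω|) ≤ exp(ρω) + exp(-ρω)`, the values at `z = ±ρ` bound the exponential
      -- moment.
      have hb : ∀ σ : ℝ, |σ| = ρ → ∑ i, a (n + N) i * Real.exp (σ * ω (n + N) i) ≤ M := by
        intro σ hσ
        have := hM (n + N) h1.1 σ (by rw [Complex.norm_real, Real.norm_eq_abs, hσ])
        refine le_trans (le_trans (le_abs_self _) (le_of_eq ?_)) this
        rw [← Real.norm_eq_abs, ← Complex.norm_real]
        push_cast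
        rfl
      have h2 : ∑ i, a (n + N) i • min (Real.exp (ρ * |ω (n + N) i|)) (K : ℝ) ≤ M + M := by
        refine le_trans ?_ (add_le_add (hb ρ (abs_of_pos hρ)) (hb (-ρ) (by
          rw [abs_neg, abs_of_pos hρ])))
        rw [← Finset.sum_add_distrib]
        refine Finset.sum_le_sum fun i _ => ?_
        rw [smul_eq_mul, ← mul_add]
        refine mul_le_mul_of_nonneg_left ((min_le_left _ _).trans ?_) (ha _ i)
        rcases abs_cases (ω (n + N) i) with ⟨h, -⟩ | ⟨h, -⟩ <;> rw [h]
        · linarith [Real.exp_pos (-ρ * ω (n + N) i)]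
        · rw [mul_neg, ← neg_mul]
          linarith [Real.exp_pos (ρ * ω (n + N) i)]
      have h3 : 0 ≤ ∑ i, a (n + N) i • min (Real.exp (ρ * |ω (n + N) i|)) (K : ℝ) :=
        Finset.sum_nonneg fun i _ => smul_nonneg (ha _ i)
          (le_min (Real.exp_pos _).le K.cast_nonneg)
      exact mul_le_mul (inv_anti₀ (half_pos hC) h1.2.le) h2 h3 (by positivity))
    (fun s hs => by
      obtain ⟨L, hL⟩ := hlim (Complex.I * s) (by simpa using hs.le)
      refine ⟨(C : ℂ)⁻¹ * L, ?_⟩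
      have h1 := (hL.comp (tendsto_add_atTop_nat N))
      have h2 : Tendsto (fun n => ((∑ i, a (n + N) i : ℝ) : ℂ)⁻¹) atTop (𝓝 (C : ℂ)⁻¹) :=
        ((Complex.continuous_ofReal.tendsto _).comp hC'').inv₀ (by exact_mod_cast hC.ne')
      refine (h2.mul h1).congr fun n => ?_
      simp only [Function.comp_apply]
      rw [hchar, inv_mul_cancel_left₀]
      exact_mod_cast (hpos n).ne')
  refine ⟨ν, fun s => ?_, fun φ => ?_⟩
  · refine (tendsto_add_atTop_iff_nat N).1 ?_
    simp_rw [hchar]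
    refine Tendsto.mul ((Complex.continuous_ofReal.tendsto _).comp hC'') ?_
    rw [ProbabilityMeasure.tendsto_iff_forall_integral_rclike_tendsto ℂ] at hν
    simpa only [charFun_eq_integral_innerProbChar] using
      hν (BoundedContinuousFunction.innerProbChar s)
  · refine (tendsto_add_atTop_iff_nat N).1 ?_
    rw [ProbabilityMeasure.tendsto_iff_forall_integral_tendsto] at hν
    refine (hC''.mul (hν φ)).congr fun n => ?_
    rw [hμ, smul_eq_mul, mul_inv_cancel_left₀ (hpos n).ne']
    rfl

/-- The Mazur inequality in the limit of large systems. -/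
theorem mazur_bound {ι : ℕ → Type*} [∀ n, Fintype (ι n)] (a ω : ∀ n, ι n → ℝ)
    (ha : ∀ n i, 0 ≤ a n i) {C : ℝ} {μ : ProbabilityMeasure ℝ}
    (hC : Tendsto (fun n => ∑ i, a n i) atTop (𝓝 C))
    (hμ : ∀ φ : BoundedContinuousFunction ℝ ℝ, Tendsto (fun n => ∑ i, a n i * φ (ω n i)) atTop
        (𝓝 (C * ∫ x, φ x ∂(μ : Measure ℝ))))
    (r q e : ℕ → ℝ) {R Q : ℝ} (hr : Tendsto r atTop (𝓝 R)) (hq : Tendsto q atTop (𝓝 Q))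
    (he : Tendsto e atTop (𝓝 0))
    (hmazur : ∀ n, ∀ K : ℝ, 0 ≤ K → ∀ φ : ℝ → ℝ, (∀ x, |1 - φ x| ≤ K * |x|) →
      r n ≤ Real.sqrt (∑ i, a n i * φ (ω n i) ^ 2) * Real.sqrt (q n) +
        K * (Real.sqrt (∑ i, a n i) * Real.sqrt (e n))) (hR : 0 ≤ R) (hQ : 0 ≤ Q) :
    R ^ 2 ≤ C * (μ : Measure ℝ).real {0} * Q := by
  have hC0 : 0 ≤ C := ge_of_tendsto' hC fun n => Finset.sum_nonneg fun i _ => ha n i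
  have hden : ∀ (K : ℕ) (x : ℝ), 0 < 1 + K * |x| := fun K x => by positivity
  have hle : ∀ (K : ℕ) (x : ℝ), 0 ≤ (1 + K * |x|)⁻¹ ∧ (1 + K * |x|)⁻¹ ≤ 1 := fun K x =>
    ⟨(inv_pos.2 (hden K x)).le, inv_le_one_of_one_le₀ (by
      have : 0 ≤ K * |x| := by positivity
      linarith)⟩
  have hcont : ∀ K : ℕ, Continuous fun x : ℝ => ((1 + K * |x|)⁻¹) ^ 2 := fun K =>
    (Continuous.inv₀ (by fun_prop) fun x => (hden K x).ne').pow 2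
  have hbd : ∀ (K : ℕ) (x : ℝ), ‖((1 + K * |x|)⁻¹) ^ 2‖ ≤ 1 := fun K x => by
    rw [Real.norm_of_nonneg (by positivity)]
    exact pow_le_one₀ (hle K x).1 (hle K x).2
  have h1 : ∀ K : ℕ, R ^ 2 ≤ C * (∫ x, ((1 + K * |x|)⁻¹) ^ 2 ∂(μ : Measure ℝ)) * Q := by
    intro K
    have h2 := hμ (BoundedContinuousFunction.ofNormedAddCommGroup _ (hcont K) 1 (hbd K))
    have h3 := (h2.sqrt.mul hq.sqrt).add ((hC.sqrt.mul he.sqrt).const_mul (K : ℝ))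
    -- The test function `1/(1 + K|x|)` is continuous, bounded by `1`, and deviates from `1` by at
    -- most `K|x|`. At fixed `K` the error disappears with `e` as `n → ∞`; only then does `K → ∞`
    -- select the atom.
    have h4 := le_of_tendsto_of_tendsto' hr h3 fun n => hmazur n K K.cast_nonneg
      (fun x => (1 + K * |x|)⁻¹) fun x => by
        rw [abs_of_nonneg (by linarith [(hle K x).2])]
        have := hden K x
        have h5 : 1 - (1 + K * |x|)⁻¹ = K * |x| * (1 + K * |x|)⁻¹ := by field_simp; ring
        rw [h5]
        exact mul_le_of_le_one_right (by positivity) (hle K x).2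
    rw [Real.sqrt_zero, mul_zero, mul_zero, add_zero] at h4
    have h6 : 0 ≤ C * ∫ x, ((1 + K * |x|)⁻¹) ^ 2 ∂(μ : Measure ℝ) :=
      mul_nonneg hC0 (integral_nonneg fun x => by positivity)
    calc R ^ 2 ≤ (Real.sqrt (C * ∫ x, ((1 + K * |x|)⁻¹) ^ 2 ∂(μ : Measure ℝ)) *
          Real.sqrt Q) ^ 2 := pow_le_pow_left₀ hR h4 2
      _ = _ := by rw [mul_pow, Real.sq_sqrt h6, Real.sq_sqrt hQ]
  have h2 : Tendsto (fun K : ℕ => ∫ x, ((1 + K * |x|)⁻¹) ^ 2 ∂(μ : Measure ℝ)) atTop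
      (𝓝 (∫ x, Set.indicator {0} (fun _ => (1 : ℝ)) x ∂(μ : Measure ℝ))) := by
    refine tendsto_integral_filter_of_dominated_convergence (fun _ => (1 : ℝ))
      (Eventually.of_forall fun K => (hcont K).aestronglyMeasurable)
      (Eventually.of_forall fun K => Eventually.of_forall (hbd K)) (integrable_const _)
      (Eventually.of_forall fun x => ?_)
    by_cases hx : x = 0
    · simp [hx]
    · rw [Set.indicator_of_notMem (by simpa using hx)]
      have h3 : Tendsto (fun K : ℕ => 1 + (K : ℝ) * |x|) atTop atTop :=
        tendsto_atTop_add_const_left _ _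
          (tendsto_natCast_atTop_atTop.atTop_mul_const (abs_pos.2 hx))
      simpa using (tendsto_inv_atTop_zero.comp h3).pow 2
  rw [integral_indicator_const _ (measurableSet_singleton 0), smul_eq_mul, mul_one] at h2
  exact ge_of_tendsto' ((h2.const_mul C).mul_const Q) h1

end SpectralMeasure

/-! ### Finite systems: eigenbasis expansion and finite-size Mazur inequality. -/

section EigenvalueRepresentation

open Matrix

variable {ι : Type*} [Fintype ι] [DecidableEq ι]

theorem trace_diagonal_mul_mul (d e : ι → ℂ) (X Y : Matrix ι ι ℂ) :
    (diagonal d * X * diagonal e * Y).trace = ∑ p : ι × ι, d p.1 * X p.1 p.2 * e p.2 * Y p.2 p.1 := by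
  rw [Fintype.sum_prod_type, Matrix.trace]
  refine Finset.sum_congr rfl fun i _ => ?_
  rw [Matrix.diag_apply, Matrix.mul_apply]
  refine Finset.sum_congr rfl fun j _ => ?_
  rw [Matrix.mul_diagonal, Matrix.diagonal_mul]

/-- In an eigenbasis of `H`, two-point functions are sums of exponentials. -/
theorem exists_eigenvalue_representation {H J Q : Matrix ι ι ℂ} (hH : H.IsHermitian)
    (hJ : J.IsHermitian) (hQ : Q.IsHermitian) (β : ℝ) :
    ∃ (a ω : ι × ι → ℝ), (∀ p, 0 ≤ a p) ∧
      0 ≤ (NormedSpace.exp (-(β : ℂ) • H) * Q * Q).trace.re ∧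
      (∀ z : ℂ, (NormedSpace.exp ((-(β : ℂ) - z) • H) * J * NormedSpace.exp (z • H) * J).trace =
        ∑ p, (a p : ℂ) * Complex.exp (z * ω p)) ∧
      ∀ K : ℝ, 0 ≤ K → ∀ φ : ℝ → ℝ, (∀ x, |1 - φ x| ≤ K * |x|) →
        ‖(NormedSpace.exp (-(β : ℂ) • H) * J * Q).trace‖ ≤
          Real.sqrt (∑ p, a p * φ (ω p) ^ 2) *
            Real.sqrt (NormedSpace.exp (-(β : ℂ) • H) * Q * Q).trace.re +
          K * (Real.sqrt (∑ p, a p) * Real.sqrt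
            (NormedSpace.exp (-(β : ℂ) • H) * (H * Q - Q * H) * (H * Q - Q * H)ᴴ).trace.re) := by
  set U : Matrix ι ι ℂ := (hH.eigenvectorUnitary : Matrix ι ι ℂ) with hU
  set ev := hH.eigenvalues with hev
  have hUU : star U * U = 1 := Unitary.star_mul_self_of_mem hH.eigenvectorUnitary.2
  have hUU' : U * star U = 1 := Unitary.mul_star_self_of_mem hH.eigenvectorUnitary.2
  have hHU : H = U * diagonal (fun i => (ev i : ℂ)) * star U := hH.spectral_theorem
  have hexp : ∀ c : ℂ, NormedSpace.exp (c • H) =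
      U * diagonal (fun i => Complex.exp (c * ev i)) * star U := by
    intro c
    have hunit : IsUnit U := ⟨⟨U, star U, hUU', hUU⟩, rfl⟩
    have hinv : star U = U⁻¹ := (Matrix.inv_eq_right_inv hUU').symm
    have h1 : c • H = U * diagonal (fun i => c * (ev i : ℂ)) * U⁻¹ := by
      rw [hHU, ← hinv, ← smul_mul_assoc, ← mul_smul_comm, ← Matrix.diagonal_smul]
      rfl
    rw [h1, Matrix.exp_conj _ _ hunit, Matrix.exp_diagonal, hinv]
    congr 3
    funext i
    rw [Pi.coe_exp, ← Complex.exp_eq_exp_ℂ]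
  have htr : ∀ (c₁ c₂ : ℂ) (X Y : Matrix ι ι ℂ),
      (NormedSpace.exp (c₁ • H) * X * NormedSpace.exp (c₂ • H) * Y).trace =
        ∑ p : ι × ι, Complex.exp (c₁ * ev p.1) * (star U * X * U) p.1 p.2 *
          Complex.exp (c₂ * ev p.2) * (star U * Y * U) p.2 p.1 := by
    intro c₁ c₂ X Y
    rw [← trace_diagonal_mul_mul (fun i => Complex.exp (c₁ * ev i))
      (fun i => Complex.exp (c₂ * ev i)), hexp, hexp]
    simp only [Matrix.mul_assoc]
    rw [Matrix.trace_mul_comm U]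
    simp only [Matrix.mul_assoc]
  have htr1 : ∀ (c : ℂ) (X Y : Matrix ι ι ℂ), (NormedSpace.exp (c • H) * X * Y).trace =
        ∑ p : ι × ι, Complex.exp (c * ev p.1) * (star U * X * U) p.1 p.2 *
          (star U * Y * U) p.2 p.1 := by
    intro c X Y
    simpa using htr c 0 X Y
  set J' := star U * J * U with hJ'
  set Q' := star U * Q * U with hQ'
  have hherm : ∀ X : Matrix ι ι ℂ, ∀ p : ι × ι, (star U * Xᴴ * U) p.2 p.1 =
      star ((star U * X * U) p.1 p.2) := by
    intro X p
    rw [← Matrix.conjTranspose_apply]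
    simp only [Matrix.star_eq_conjTranspose, Matrix.conjTranspose_mul,
      Matrix.conjTranspose_conjTranspose, Matrix.mul_assoc]
  have hJh : ∀ p : ι × ι, J' p.2 p.1 = star (J' p.1 p.2) := fun p => by
    rw [hJ', ← hherm, hJ.eq]
  have hQh : ∀ p : ι × ι, Q' p.2 p.1 = star (Q' p.1 p.2) := fun p => by
    rw [hQ', ← hherm, hQ.eq]
  -- In the eigenbasis the commutator multiplies a matrix element by its energy difference, so a
  -- small commutator suppresses `Q` away from frequency zero.
  have hcomm : ∀ p : ι × ι, (star U * (H * Q - Q * H) * U) p.1 p.2 =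
      ((ev p.1 - ev p.2 : ℝ) : ℂ) * Q' p.1 p.2 := by
    intro p
    have h1 : star U * (H * Q - Q * H) * U =
        diagonal (fun i => (ev i : ℂ)) * Q' - Q' * diagonal (fun i => (ev i : ℂ)) := by
      have h2 : star U * H = diagonal (fun i => (ev i : ℂ)) * star U := by
        rw [hHU, ← Matrix.mul_assoc, ← Matrix.mul_assoc, hUU, Matrix.one_mul]
      have h3 : H * U = U * diagonal (fun i => (ev i : ℂ)) := by
        rw [hHU, Matrix.mul_assoc, hUU, Matrix.mul_one]
      calc _ = star U * H * Q * U - star U * Q * (H * U) := by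
            rw [Matrix.mul_sub, Matrix.sub_mul]; simp only [Matrix.mul_assoc]
        _ = _ := by rw [h2, h3, hQ']; simp only [Matrix.mul_assoc]
    rw [h1, Matrix.sub_apply, Matrix.diagonal_mul, Matrix.mul_diagonal]
    push_cast
    ring
  set w : ι × ι → ℝ := fun p => Real.exp (-β * ev p.1) with hw
  have hw0 : ∀ p, 0 ≤ w p := fun p => (Real.exp_pos _).le
  have hwc : ∀ p : ι × ι, Complex.exp (-(β : ℂ) * ev p.1) = (w p : ℂ) := fun p => by
    simp [hw]
  have hnorm : ∀ z : ℂ, z * star z = ((‖z‖ ^ 2 : ℝ) : ℂ) := fun z => by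
    rw [Complex.star_def, Complex.mul_conj, Complex.normSq_eq_norm_sq]
  have hCS : ∀ x y : ι × ι → ℝ, (∀ p, 0 ≤ x p) → (∀ p, 0 ≤ y p) → ∑ p, w p * x p * y p ≤
      Real.sqrt (∑ p, w p * x p ^ 2) * Real.sqrt (∑ p, w p * y p ^ 2) := by
    intro x y hx hy
    have h1 := Real.sum_sqrt_mul_sqrt_le Finset.univ (f := fun p => w p * x p ^ 2)
      (g := fun p => w p * y p ^ 2) (fun p => mul_nonneg (hw0 p) (sq_nonneg _))
      (fun p => mul_nonneg (hw0 p) (sq_nonneg _))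
    refine le_trans (le_of_eq (Finset.sum_congr rfl fun p _ => ?_)) h1
    rw [Real.sqrt_mul (hw0 p), Real.sqrt_mul (hw0 p), Real.sqrt_sq (hx p), Real.sqrt_sq (hy p)]
    have := Real.mul_self_sqrt (hw0 p)
    linear_combination (-(x p * y p)) * this
  have hQQ : (NormedSpace.exp (-(β : ℂ) • H) * Q * Q).trace.re = ∑ p, w p * ‖Q' p.1 p.2‖ ^ 2 := by
    rw [htr1, Complex.re_sum]
    refine Finset.sum_congr rfl fun p _ => ?_
    rw [← hQ', hQh, mul_assoc, hnorm, hwc, ← Complex.ofReal_mul, Complex.ofReal_re]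
  have hEE : (NormedSpace.exp (-(β : ℂ) • H) * (H * Q - Q * H) * (H * Q - Q * H)ᴴ).trace.re =
      ∑ p, w p * (|ev p.1 - ev p.2| * ‖Q' p.1 p.2‖) ^ 2 := by
    rw [htr1, Complex.re_sum]
    refine Finset.sum_congr rfl fun p _ => ?_
    rw [hherm, mul_assoc, hnorm, hwc, ← Complex.ofReal_mul, Complex.ofReal_re, hcomm, norm_mul,
      Complex.norm_real, Real.norm_eq_abs]
  refine ⟨fun p => w p * ‖J' p.1 p.2‖ ^ 2, fun p => ev p.2 - ev p.1,
    fun p => mul_nonneg (hw0 p) (sq_nonneg _),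
    hQQ ▸ Finset.sum_nonneg fun p _ => mul_nonneg (hw0 p) (sq_nonneg _), fun z => ?_, fun K hK φ hφ => ?_⟩
  · rw [htr]
    refine Finset.sum_congr rfl fun p _ => ?_
    rw [← hJ', hJh, Complex.ofReal_mul, ← hnorm, ← hwc, sub_mul, Complex.exp_sub]
    have h1 : Complex.exp (z * ((ev p.2 - ev p.1 : ℝ) : ℂ)) =
        Complex.exp (z * ev p.2) / Complex.exp (z * ev p.1) := by
      rw [← Complex.exp_sub]; congr 1; push_cast; ring
    rw [h1]
    ring
  · rw [hQQ, hEE, htr1, ← hJ', ← hQ']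
    -- The inequality `1 ≤ |φ(ω)| + K|ω|` splits the overlap into a low-frequency part and a part
    -- controlled by the commutator; weighted Cauchy-Schwarz handles each.
    have h1 : ∀ p : ι × ι, ‖Complex.exp (-(β : ℂ) * ev p.1) * J' p.1 p.2 * Q' p.2 p.1‖ ≤
        w p * (‖J' p.1 p.2‖ * |φ (ev p.2 - ev p.1)|) * ‖Q' p.1 p.2‖ +
        K * (w p * ‖J' p.1 p.2‖ * (|ev p.1 - ev p.2| * ‖Q' p.1 p.2‖)) := by
      intro p
      rw [hwc, hQh, norm_mul, norm_mul, norm_star, Complex.norm_real,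
        Real.norm_of_nonneg (hw0 p)]
      have h2 : 1 ≤ |φ (ev p.2 - ev p.1)| + K * |ev p.1 - ev p.2| := by
        have h3 := hφ (ev p.2 - ev p.1)
        rw [abs_sub_comm (ev p.2)] at h3
        have h4 := abs_sub_abs_le_abs_sub 1 (φ (ev p.2 - ev p.1))
        rw [abs_one] at h4
        linarith
      have h5 : 0 ≤ w p * ‖J' p.1 p.2‖ * ‖Q' p.1 p.2‖ :=
        mul_nonneg (mul_nonneg (hw0 p) (norm_nonneg _)) (norm_nonneg _)
      nlinarith [mul_le_mul_of_nonneg_left h2 h5]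
    refine (norm_sum_le _ _).trans ((Finset.sum_le_sum fun p _ => h1 p).trans ?_)
    rw [Finset.sum_add_distrib, ← Finset.mul_sum]
    refine add_le_add ((hCS _ _ (fun p => by positivity) fun p => norm_nonneg _).trans
      (le_of_eq ?_)) (mul_le_mul_of_nonneg_left
        (hCS _ _ (fun p => norm_nonneg _) fun p => by positivity) hK)
    congr 2
    refine Finset.sum_congr rfl fun p _ => ?_
    rw [mul_pow, sq_abs, mul_assoc]

end EigenvalueRepresentation


/-! ### Spectral measure of the current at high temperature in the infinite chain. -/

section ThermalCorrelations

open scoped Matrix.Norms.L2Operator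
open MeasureTheory

/-- The correlation density `⟨X(0) Y(z)⟩_β / n` at complex time `z`. -/
noncomputable def gibbsCorrelation (h : Op 2) (X Y : ∀ d, Op d) (β : ℝ) (z : ℂ) (n : ℕ) : ℂ :=
  correlation h X Y (((-β : ℝ) : ℂ) - z) z n (Finset.range (n - 1)) /
    weight h ((-β : ℝ) : ℂ) n (Finset.range (n - 1)) / n

/-- Splitting the Gibbs factor as `G * G` with `G` hermitian gives the bound `hs G ^ 2 * ‖A‖`, and
`hs G ^ 2` is the weight. -/
theorem norm_tracial_exp_mul_le {n : ℕ} {h : Op 2} (hH : h.IsHermitian) (β : ℝ) (B : Finset ℕ)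
    (A : Op n) : ‖tracial (NormedSpace.exp (((-β : ℝ) : ℂ) • bondSum n h B) * A)‖ ≤
      (weight h ((-β : ℝ) : ℂ) n B).re * ‖A‖ := by
  set G := NormedSpace.exp (((-β / 2 : ℝ) : ℂ) • bondSum n h B) with hG
  have h1 : NormedSpace.exp (((-β : ℝ) : ℂ) • bondSum n h B) = G * G := by
    rw [hG, exp_smul_mul_exp_smul, ← Complex.ofReal_add, add_halves]
  have h2 : G.conjTranspose = G := by
    rw [hG, ← Matrix.exp_conjTranspose, Matrix.conjTranspose_smul,
      (bondSum_conjTranspose hH B : _ = _)]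
    simp
  have h3 : hs G * hs G = (weight h ((-β : ℝ) : ℂ) n B).re := by
    rw [← sq, hs_sq, h2, weight, h1]
  rw [h1, mul_assoc, tracial_mul_comm, ← h3]
  have h4 := norm_tracial_mul_mul_mul_le 1 G A.conjTranspose G
  have h5 : tracial (1 * G * A.conjTranspose * G) = star (tracial (G * A * G)) := by
    rw [Complex.star_def, ← tracial_conjTranspose]
    simp only [Matrix.conjTranspose_mul, h2, one_mul, mul_assoc]
  rw [h5, norm_star, ← Matrix.star_eq_conjTranspose A, norm_star] at h4
  refine h4.trans ?_
  have h6 : ‖(1 : Op n)‖ ≤ 1 := by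
    exact norm_one.le
  have h7 : 0 ≤ hs G * hs G := mul_nonneg (hs_nonneg _) (hs_nonneg _)
  refine mul_le_mul_of_nonneg_left ?_ h7
  exact mul_le_of_le_one_left (norm_nonneg _) h6

/-- The cluster expansion on a small disc of complex times supplies convergence and exponential
moments for the finite-size spectral measures. Their weak limit then describes all real times, and
the Mazur inequality passes to it. -/
theorem exists_drude_measure {h : Op 2} (hH : h.IsHermitian) (hT : h.transpose = h) {r : ℝ}
    (hr : 0 < r) (hr1 : r < 1) : ∃ β₀ > 0, ∀ {C : ℝ}, 0 ≤ C → ∀ {j q : ∀ d, Op d},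
      IsOddFamily j C r → IsOddFamily q C r →
      (∀ n, (familySum n j (Finset.range (n - 1))).IsHermitian) →
      (∀ n, (familySum n q (Finset.range (n - 1))).IsHermitian) →
      (∀ n, ‖bondSum n h (Finset.range (n - 1)) * familySum n q (Finset.range (n - 1)) -
        familySum n q (Finset.range (n - 1)) * bondSum n h (Finset.range (n - 1))‖ ≤ 4) →
      ∀ {β : ℝ}, |β| ≤ β₀ → ∀ {Ljj Ljq Lqq : ℂ},
      Tendsto (gibbsCorrelation h j j β 0) atTop (𝓝 Ljj) →
      Tendsto (gibbsCorrelation h j q β 0) atTop (𝓝 Ljq) →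
      Tendsto (gibbsCorrelation h q q β 0) atTop (𝓝 Lqq) → Ljj ≠ 0 →
      ∃ (μ : ProbabilityMeasure ℝ) (M : ℝ),
        (∀ s : ℝ, Tendsto (gibbsCorrelation h j j β (Complex.I * s)) atTop
          (𝓝 (Ljj * charFun (μ : Measure ℝ) s))) ∧
        (∀ n, 0 < n → ∀ s : ℝ, ‖gibbsCorrelation h j j β (Complex.I * s) n‖ ≤ M) ∧
        ‖Ljq‖ ^ 2 ≤ Ljj.re * (μ : Measure ℝ).real {0} * Lqq.re ∧ (Ljj.re : ℂ) = Ljj := by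
  obtain ⟨κ₀, hκ₀, hlim⟩ := exists_thermodynamic_limit hH hT hr hr1
  refine ⟨κ₀ / 4, by positivity, fun {C} hC {j q} hj hq hjh hqh hcomm {β} hβ {Ljj Ljq Lqq} hLjj
    hLjq hLqq hne => ?_⟩
  obtain ⟨M, hM⟩ := hlim C hC
  -- The quarter leaves room for `|β|` and twice `‖z‖`.
  have hc : ∀ z : ℂ, ‖z‖ ≤ κ₀ / 4 → ‖((-β : ℝ) : ℂ) - z‖ + ‖z‖ ≤ κ₀ := by
    intro z hz
    have h1 := norm_sub_le ((-β : ℝ) : ℂ) z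
    rw [Complex.norm_real, Real.norm_eq_abs, abs_neg] at h1
    linarith
  have hM' : ∀ z : ℂ, ‖z‖ ≤ κ₀ / 4 → _ := fun z hz =>
    hM j j hj hj (-β) (((-β : ℝ) : ℂ) - z) z (sub_add_cancel _ _) (hc z hz)
  have hz0 : ‖(0 : ℂ)‖ ≤ κ₀ / 4 := by rw [norm_zero]; positivity
  have hwpos := (hM' 0 hz0).1
  set W : ℕ → ℝ := fun n => 2 ^ n * (weight h ((-β : ℝ) : ℂ) n (Finset.range (n - 1))).re * n with hW
  have hW0 : ∀ n, 0 ≤ W n := fun n => by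
    have := (hwpos n).le
    simp only [hW]
    positivity
  set H : ∀ n, Op n := fun n => bondSum n h (Finset.range (n - 1)) with hHdef
  set J : ∀ n, Op n := fun n => familySum n j (Finset.range (n - 1)) with hJdef
  set Q : ∀ n, Op n := fun n => familySum n q (Finset.range (n - 1)) with hQdef
  have hrep := fun n => exists_eigenvalue_representation (bondSum_conjTranspose hH
    (Finset.range (n - 1)) : (H n).IsHermitian) (hjh n) (hqh n) β
  choose a ω ha hqq hexp hmaz using hrep
  have hgc : ∀ (X Y : ∀ d, Op d) (z : ℂ) (n : ℕ), gibbsCorrelation h X Y β z n =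
      (NormedSpace.exp ((-(β : ℂ) - z) • H n) * familySum n X (Finset.range (n - 1)) *
        NormedSpace.exp (z • H n) * familySum n Y (Finset.range (n - 1))).trace / (W n : ℂ) := by
    intro X Y z n
    rw [gibbsCorrelation, correlation, tracial, ← weight_real hH, Complex.ofReal_neg, div_div,
      div_div]
    simp only [hW]
    push_cast
    simp only [mul_assoc]
    rfl
  have hgc0 : ∀ (X Y : ∀ d, Op d) (n : ℕ), gibbsCorrelation h X Y β 0 n =
      (NormedSpace.exp (-(β : ℂ) • H n) * familySum n X (Finset.range (n - 1)) *
        familySum n Y (Finset.range (n - 1))).trace / (W n : ℂ) := by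
    intro X Y n
    rw [hgc]
    simp
  have hsum : ∀ n z, gibbsCorrelation h j j β z n =
      ∑ p, ((a n p / W n : ℝ) : ℂ) * Complex.exp (z * ω n p) := by
    intro n z
    rw [hgc, hexp, Finset.sum_div]
    refine Finset.sum_congr rfl fun p _ => ?_
    push_cast
    ring
  have ha' : ∀ n p, 0 ≤ a n p / W n := fun n p => div_nonneg (ha n p) (hW0 n)
  have hreal : ∀ n, gibbsCorrelation h j j β 0 n = ((∑ p, a n p / W n : ℝ) : ℂ) := by
    intro n
    rw [hsum]
    simp
  have hre : Tendsto (fun n => ∑ p, a n p / W n) atTop (𝓝 Ljj.re) := by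
    have := (Complex.continuous_re.tendsto _).comp hLjj
    refine this.congr fun n => ?_
    rw [Function.comp_apply, hreal, Complex.ofReal_re]
  have hLre : (Ljj.re : ℂ) = Ljj := by
    refine tendsto_nhds_unique ((Complex.continuous_ofReal.tendsto _).comp hre) (hLjj.congr hreal)
  have hLpos : 0 < Ljj.re := by
    refine lt_of_le_of_ne (ge_of_tendsto' hre fun n => Finset.sum_nonneg fun p _ => ha' n p) ?_
    intro h0
    rw [← h0, Complex.ofReal_zero] at hLre
    exact hne hLre.symm
  obtain ⟨μ, hμ, hφ⟩ := exists_spectral_measure (fun n p => a n p / W n) ω ha'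
    (by positivity : 0 < κ₀ / 4) (M := M)
    (fun n hn z hz => by rw [← hsum]; exact (hM' z hz).2.2 n hn)
    (fun z hz => by
      obtain ⟨L, hL⟩ := (hM' z hz).2.1
      exact ⟨L, hL.congr fun n => hsum n z⟩) hLpos hre
  refine ⟨μ, M, fun s => ?_, fun n hn s => ?_, ?_, hLre⟩
  · rw [← hLre]
    exact (hμ s).congr fun n => (hsum n _).symm
  -- Amplitudes are nonnegative and phases have modulus one, so the bound at time zero holds at
  -- every real time.
  · rw [hsum]
    have h1 := (hM' 0 hz0).2.2 n hn
    refine (norm_sum_le _ _).trans ?_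
    change ‖gibbsCorrelation h j j β 0 n‖ ≤ M at h1
    rw [hreal, Complex.norm_real, Real.norm_of_nonneg
      (Finset.sum_nonneg fun p _ => ha' n p)] at h1
    refine le_trans (le_of_eq (Finset.sum_congr rfl fun p _ => ?_)) h1
    rw [norm_mul, Complex.norm_real, Real.norm_of_nonneg (ha' n p), mul_assoc, mul_comm Complex.I,
      ← Complex.ofReal_mul, Complex.norm_exp_ofReal_mul_I, mul_one]
  · refine mazur_bound (fun n p => a n p / W n) ω ha' hre hφ
      (fun n => ‖gibbsCorrelation h j q β 0 n‖) (fun n => (gibbsCorrelation h q q β 0 n).re)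
      (fun n => (NormedSpace.exp (-(β : ℂ) • H n) * (H n * Q n - Q n * H n) *
        (H n * Q n - Q n * H n).conjTranspose).trace.re / W n) hLjq.norm
      ((Complex.continuous_re.tendsto _).comp hLqq) ?_ (fun n K hK φ hφK => ?_) (norm_nonneg _) ?_
    -- The commutator has norm at most `4`, so its thermal mean square is at most `16` and its
    -- density vanishes.
    · have h1 : Tendsto (fun n : ℕ => 16 / (n : ℝ)) atTop (𝓝 0) :=
        tendsto_const_div_atTop_nhds_zero_nat 16
      refine squeeze_zero_norm (fun n => ?_) h1
      rcases Nat.eq_zero_or_pos n with rfl | hn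
      · simp [hW]
      have h2 := norm_tracial_exp_mul_le hH β (Finset.range (n - 1))
        ((H n * Q n - Q n * H n) * (H n * Q n - Q n * H n).conjTranspose)
      have h3 : ‖(H n * Q n - Q n * H n) * (H n * Q n - Q n * H n).conjTranspose‖ ≤ 16 := by
        refine (norm_mul_le _ _).trans ?_
        rw [← Matrix.star_eq_conjTranspose, norm_star]
        nlinarith [hcomm n, norm_nonneg (H n * Q n - Q n * H n)]
      have h4 := h2.trans (mul_le_mul_of_nonneg_left h3 (hwpos n).le)
      rw [tracial, norm_div, norm_pow, Complex.norm_ofNat, ← mul_assoc, Complex.ofReal_neg,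
        div_le_iff₀ (by positivity)] at h4
      have h5 := (Complex.abs_re_le_norm _).trans h4
      have hn' : (0 : ℝ) < n := by exact_mod_cast hn
      have hWpos : 0 < W n := by
        have := hwpos n
        simp only [hW]
        positivity
      rw [norm_div, Real.norm_of_nonneg hWpos.le, div_le_div_iff₀ hWpos hn']
      refine (mul_le_mul_of_nonneg_right h5 hn'.le).trans (le_of_eq ?_)
      simp only [hW, Complex.ofReal_neg]
      ring
    · have h1 := div_le_div_of_nonneg_right (hmaz n K hK φ hφK) (hW0 n)
      have hsq : ∀ x y : ℝ, Real.sqrt (x / W n) * Real.sqrt (y / W n) =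
          Real.sqrt x * Real.sqrt y / W n := by
        intro x y
        rw [Real.sqrt_div' _ (hW0 n), Real.sqrt_div' _ (hW0 n), div_mul_div_comm,
          Real.mul_self_sqrt (hW0 n)]
      have h2 : ∑ p, a n p / W n * φ (ω n p) ^ 2 = (∑ p, a n p * φ (ω n p) ^ 2) / W n := by
        rw [Finset.sum_div]
        exact Finset.sum_congr rfl fun p _ => by ring
      rw [hgc0, hgc0, norm_div, Complex.norm_real, Real.norm_of_nonneg (hW0 n), h2,
        ← Finset.sum_div, Complex.div_ofReal_re, hsq, hsq]
      refine h1.trans (le_of_eq ?_)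
      ring
    · refine ge_of_tendsto' ((Complex.continuous_re.tendsto _).comp hLqq) fun n => ?_
      rw [Function.comp_apply, hgc0, Complex.div_ofReal_re]
      refine div_nonneg ?_ (hW0 n)
      exact hqq n

end ThermalCorrelations


/-! ### Adjoints and transposes of the Pauli matrices, the interaction and the current. -/

section Interaction

theorem tensor_conjTranspose {n : ℕ} (M : Fin n → Matrix (Fin 2) (Fin 2) ℂ) :
    (tensor M).conjTranspose = tensor fun i => (M i).conjTranspose := by
  ext a b
  simp [tensor, Matrix.conjTranspose_apply]

theorem tensor_transpose {n : ℕ} (M : Fin n → Matrix (Fin 2) (Fin 2) ℂ) :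
    (tensor M).transpose = tensor fun i => (M i).transpose := by
  ext a b
  simp [tensor, Matrix.transpose_apply]

theorem sigmaX_transpose : sigmaX.transpose = sigmaX := by
  ext i j; fin_cases i <;> fin_cases j <;> rfl

theorem sigmaY_transpose : sigmaY.transpose = -sigmaY := by
  ext i j; fin_cases i <;> fin_cases j <;> simp [sigmaY]

theorem sigmaZ_transpose : sigmaZ.transpose = sigmaZ := by
  ext i j; fin_cases i <;> fin_cases j <;> rfl

theorem sigmaPlus_transpose : sigmaPlus.transpose = sigmaMinus := by
  ext i j; fin_cases i <;> fin_cases j <;> rfl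

theorem sigmaMinus_transpose : sigmaMinus.transpose = sigmaPlus := by
  ext i j; fin_cases i <;> fin_cases j <;> rfl

theorem sigmaX_conjTranspose : sigmaX.conjTranspose = sigmaX := by
  ext i j; fin_cases i <;> fin_cases j <;> simp [sigmaX]

theorem sigmaY_conjTranspose : sigmaY.conjTranspose = sigmaY := by
  ext i j; fin_cases i <;> fin_cases j <;> simp [sigmaY]

theorem sigmaZ_conjTranspose : sigmaZ.conjTranspose = sigmaZ := by
  ext i j; fin_cases i <;> fin_cases j <;> simp [sigmaZ]

theorem sigmaPlus_conjTranspose : sigmaPlus.conjTranspose = sigmaMinus := by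
  ext i j; fin_cases i <;> fin_cases j <;> simp [sigmaPlus, sigmaMinus]

theorem sigmaMinus_conjTranspose : sigmaMinus.conjTranspose = sigmaPlus := by
  ext i j; fin_cases i <;> fin_cases j <;> simp [sigmaPlus, sigmaMinus]

theorem tensor_pair_conjTranspose (A B : Matrix (Fin 2) (Fin 2) ℂ) :
    (tensor ![A, B]).conjTranspose = tensor ![A.conjTranspose, B.conjTranspose] := by
  rw [tensor_conjTranspose]
  congr 1
  funext i
  fin_cases i <;> rfl

theorem tensor_pair_transpose (A B : Matrix (Fin 2) (Fin 2) ℂ) :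
    (tensor ![A, B]).transpose = tensor ![A.transpose, B.transpose] := by
  rw [tensor_transpose]
  congr 1
  funext i
  fin_cases i <;> rfl

theorem tensor_pair_neg_right (A B : Matrix (Fin 2) (Fin 2) ℂ) :
    tensor ![A, -B] = -tensor ![A, B] := by
  ext a b
  simp [tensor, Fin.prod_univ_two]

theorem tensor_pair_neg_left (A B : Matrix (Fin 2) (Fin 2) ℂ) :
    tensor ![-A, B] = -tensor ![A, B] := by
  ext a b
  simp [tensor, Fin.prod_univ_two]

theorem interaction_isHermitian (Δ : ℝ) : (interaction Δ).IsHermitian := by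
  unfold interaction Matrix.IsHermitian
  simp only [Matrix.conjTranspose_add, Matrix.conjTranspose_smul, tensor_pair_conjTranspose,
    sigmaPlus_conjTranspose, sigmaMinus_conjTranspose, sigmaZ_conjTranspose]
  rw [add_comm (tensor ![sigmaMinus, sigmaPlus])]
  simp

theorem interaction_transpose (Δ : ℝ) : (interaction Δ).transpose = interaction Δ := by
  unfold interaction
  simp only [Matrix.transpose_add, Matrix.transpose_smul, tensor_pair_transpose,
    sigmaPlus_transpose, sigmaMinus_transpose, sigmaZ_transpose]
  rw [add_comm (tensor ![sigmaMinus, sigmaPlus])]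

theorem currentDensity_isHermitian : currentDensity.IsHermitian := by
  unfold currentDensity Matrix.IsHermitian
  simp [tensor_pair_conjTranspose, sigmaX_conjTranspose, sigmaY_conjTranspose]

theorem currentDensity_transpose : currentDensity.transpose = -currentDensity := by
  unfold currentDensity
  simp only [Matrix.transpose_smul, Matrix.transpose_sub, tensor_pair_transpose, sigmaX_transpose,
    sigmaY_transpose, tensor_pair_neg_right, tensor_pair_neg_left]
  rw [← smul_neg]
  congr 1
  abel

end Interaction

/-! ### From spectral measures to Drude weights. -/

section DrudeWeight

open scoped Matrix.Norms.L2Operator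
open MeasureTheory

/-- Cyclicity moves `exp(-isH)` next to the Gibbs factor: real time `s` is the pair of exponents `-β
- is` and `is`. -/
theorem gibbs_current_evolve {j : ∀ d, Op d}
    (hJ : ∀ n, spinCurrent n = familySum n j (Finset.range (n - 1))) (Δ β : ℝ) (n : ℕ) (s : ℝ) :
    gibbs Δ β n (spinCurrent n * evolve Δ n s (spinCurrent n)) / n =
      gibbsCorrelation (interaction Δ) j j β (Complex.I * s) n := by
  have h1 : NormedSpace.exp ((((-β : ℝ) : ℂ) - Complex.I * s) • hamiltonian Δ n) =
      NormedSpace.exp (-(Complex.I * s) • hamiltonian Δ n) *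
        NormedSpace.exp (-(β : ℂ) • hamiltonian Δ n) := by
    rw [exp_smul_mul_exp_smul]
    congr 2
    push_cast
    ring
  rw [gibbsCorrelation, correlation, weight, ← hJ]
  change _ = tracial (NormedSpace.exp ((((-β : ℝ) : ℂ) - Complex.I * s) • hamiltonian Δ n) *
    spinCurrent n * NormedSpace.exp ((Complex.I * s) • hamiltonian Δ n) * spinCurrent n) /
    tracial (NormedSpace.exp (((-β : ℝ) : ℂ) • hamiltonian Δ n)) / n
  rw [h1, tracial, tracial, div_div_div_cancel_right₀ (pow_ne_zero n two_ne_zero), gibbs, evolve,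
    Complex.ofReal_neg]
  congr 2
  rw [← Matrix.mul_assoc, ← Matrix.mul_assoc, Matrix.trace_mul_comm]
  simp only [Matrix.mul_assoc]

theorem tracial_current_evolve {j : ∀ d, Op d}
    (hJ : ∀ n, spinCurrent n = familySum n j (Finset.range (n - 1))) (Δ : ℝ) (n : ℕ) (s : ℝ) :
    tracial (spinCurrent n * evolve Δ n s (spinCurrent n)) / n =
      gibbsCorrelation (interaction Δ) j j 0 (Complex.I * s) n := by
  rw [← gibbs_current_evolve hJ, gibbs, tracial]
  simp

theorem gibbsCorrelation_zero_zero (h : Op 2) (X Y : ∀ d, Op d) (n : ℕ) :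
    gibbsCorrelation h X Y 0 0 n = tracial (familySum n X (Finset.range (n - 1)) *
      familySum n Y (Finset.range (n - 1))) / n := by
  simp [gibbsCorrelation, correlation, weight, tracial_one]

theorem continuous_gibbsCorrelation_time (h : Op 2) (X Y : ∀ d, Op d) (β : ℝ) (n : ℕ) :
    Continuous fun s : ℝ => gibbsCorrelation h X Y β (Complex.I * s) n := by
  let _ : NormedAlgebra ℚ (Op n) := NormedAlgebra.restrictScalars ℚ ℂ (Op n)
  have hexp : Continuous (NormedSpace.exp : Op n → Op n) := NormedSpace.exp_continuous
  unfold gibbsCorrelation correlation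
  refine ((((continuous_tracial n).comp ?_).div_const _).div_const _)
  fun_prop

/-- The uniform bound permits `n → ∞` under the time integral. The prefactor `β/(4t)` is `β/2` times
that of a time mean, and the mean tends to the atom. -/
theorem isThermalDrudeWeight_of_tendsto {Δ β : ℝ} {j : ∀ d, Op d}
    (hJ : ∀ n, spinCurrent n = familySum n j (Finset.range (n - 1))) {L : ℂ} (hL : (L.re : ℂ) = L)
    {μ : ProbabilityMeasure ℝ} {M : ℝ}
    (hlim : ∀ s : ℝ, Tendsto (gibbsCorrelation (interaction Δ) j j β (Complex.I * s)) atTop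
      (𝓝 (L * charFun (μ : Measure ℝ) s)))
    (hM : ∀ n, 0 < n → ∀ s : ℝ,
      ‖gibbsCorrelation (interaction Δ) j j β (Complex.I * s) n‖ ≤ M) :
    IsThermalDrudeWeight Δ β (β / 2 * (L.re * (μ : Measure ℝ).real {0})) := by
  refine ⟨fun t => β / (4 * t) * ∫ s in (-t)..t, L * charFun (μ : Measure ℝ) s, fun t ht => ?_, ?_⟩
  · have h1 : Tendsto (fun n : ℕ => ∫ s in (-t)..t,
        gibbsCorrelation (interaction Δ) j j β (Complex.I * s) n) atTop
        (𝓝 (∫ s in (-t)..t, L * charFun (μ : Measure ℝ) s)) := by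
      refine intervalIntegral.tendsto_integral_filter_of_dominated_convergence (fun _ => M)
        (Eventually.of_forall fun n =>
          (continuous_gibbsCorrelation_time _ _ _ _ n).aestronglyMeasurable) ?_
        intervalIntegrable_const (Eventually.of_forall fun s _ => hlim s)
      filter_upwards [eventually_gt_atTop 0] with n hn
      exact Eventually.of_forall fun s _ => hM n hn s
    refine (h1.const_mul ((β : ℂ) / (4 * t))).congr fun n => ?_
    simp_rw [← gibbs_current_evolve hJ]
    rw [intervalIntegral.integral_div]
    ring
  · have h1 := (tendsto_mean_charFun μ).const_mul ((β : ℂ) / 2 * L)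
    have h2 : ((β / 2 * (L.re * (μ : Measure ℝ).real {0}) : ℝ) : ℂ) =
        (β : ℂ) / 2 * L * ((μ : Measure ℝ).real {0} : ℝ) := by
      push_cast
      rw [hL]
      ring
    rw [h2]
    refine h1.congr fun t => ?_
    rw [intervalIntegral.integral_const_mul]
    ring

theorem IsThermalDrudeWeight.unique {Δ β D D' : ℝ} (h : IsThermalDrudeWeight Δ β D)
    (h' : IsThermalDrudeWeight Δ β D') : D = D' := by
  obtain ⟨g, hg, hgD⟩ := h
  obtain ⟨g', hg', hgD'⟩ := h'
  have h1 : g =ᶠ[atTop] g' := by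
    filter_upwards [eventually_gt_atTop 0] with t ht
    exact tendsto_nhds_unique (hg t ht) (hg' t ht)
  exact_mod_cast tendsto_nhds_unique hgD (hgD'.congr' h1.symm)

theorem isInfiniteTemperatureDrudeRatio_of_tendsto {Δ : ℝ} {j : ∀ d, Op d}
    (hJ : ∀ n, spinCurrent n = familySum n j (Finset.range (n - 1))) {L : ℂ} (hL : (L.re : ℂ) = L)
    {μ : ProbabilityMeasure ℝ}
    (hlim : ∀ s : ℝ, Tendsto (gibbsCorrelation (interaction Δ) j j 0 (Complex.I * s)) atTop
      (𝓝 (L * charFun (μ : Measure ℝ) s))) :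
    IsInfiniteTemperatureDrudeRatio Δ (1 / 2 * (L.re * (μ : Measure ℝ).real {0})) := by
  refine ⟨fun s => L * charFun (μ : Measure ℝ) s, fun s => ?_, ?_⟩
  · exact (hlim s).congr fun n => (tracial_current_evolve hJ Δ n s).symm
  · have heven : ∀ n (s : ℝ), gibbsCorrelation (interaction Δ) j j 0 (Complex.I * (-s : ℝ)) n =
        gibbsCorrelation (interaction Δ) j j 0 (Complex.I * s) n := by
      intro n s
      have h1 : ((-0 : ℝ) : ℂ) - Complex.I * ((-s : ℝ) : ℂ) = Complex.I * s := by
        push_cast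
        ring
      have h2 : Complex.I * ((-s : ℝ) : ℂ) = ((-0 : ℝ) : ℂ) - Complex.I * s := by
        push_cast
        ring
      unfold gibbsCorrelation correlation
      rw [h1, h2, mul_assoc, tracial_mul_comm, ← mul_assoc]
    have hev : ∀ s : ℝ, L * charFun (μ : Measure ℝ) (-s) = L * charFun (μ : Measure ℝ) s :=
      fun s => tendsto_nhds_unique (hlim (-s)) ((hlim s).congr fun n => (heven n s).symm)
    have hcont : Continuous fun s : ℝ => L * charFun (μ : Measure ℝ) s := by fun_prop
    have hsplit : ∀ t : ℝ, ∫ s in (-t)..t, L * charFun (μ : Measure ℝ) s =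
        2 * ∫ s in (0 : ℝ)..t, L * charFun (μ : Measure ℝ) s := by
      intro t
      rw [← intervalIntegral.integral_add_adjacent_intervals (hcont.intervalIntegrable (-t) 0)
        (hcont.intervalIntegrable 0 t), two_mul]
      congr 1
      have := intervalIntegral.integral_comp_neg (a := (0 : ℝ)) (b := t)
        (fun s => L * charFun (μ : Measure ℝ) s)
      rw [neg_zero] at this
      rw [← this]
      simp_rw [hev]
    have h1 := (tendsto_mean_charFun μ).const_mul (L / 2)
    have h2 : ((1 / 2 * (L.re * (μ : Measure ℝ).real {0}) : ℝ) : ℂ) =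
        L / 2 * ((μ : Measure ℝ).real {0} : ℝ) := by
      push_cast
      rw [hL]
      ring
    rw [h2]
    refine h1.congr fun t => ?_
    have h3 := hsplit t
    rw [intervalIntegral.integral_const_mul] at h3
    rw [show L / 2 * (1 / (2 * (t : ℂ)) * ∫ s in (-t)..t, charFun (μ : Measure ℝ) s) =
      1 / (2 * (t : ℂ)) / 2 * (L * ∫ s in (-t)..t, charFun (μ : Measure ℝ) s) by ring, h3]
    ring

/-- The Mazur bound on the Drude weights from one almost conserved odd pseudo-local charge. -/
theorem drude_weight_bounds (Δ : ℝ) {r C : ℝ} (hr : 0 < r) (hr1 : r < 1) (hC : 0 ≤ C)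
    {j q : ∀ d, Op d} (hj : IsOddFamily j C r) (hq : IsOddFamily q C r)
    (hJ : ∀ n, spinCurrent n = familySum n j (Finset.range (n - 1)))
    (hjh : ∀ n, (spinCurrent n).IsHermitian)
    (hqh : ∀ n, (familySum n q (Finset.range (n - 1))).IsHermitian)
    (hcomm : ∀ n, ‖hamiltonian Δ n * familySum n q (Finset.range (n - 1)) -
        familySum n q (Finset.range (n - 1)) * hamiltonian Δ n‖ ≤ 4)
    {L R Q : ℝ} (hL : 0 < L) (hQ : 0 < Q)
    (hjj : Tendsto (fun n : ℕ => tracial (spinCurrent n * spinCurrent n) / n) atTop (𝓝 (L : ℂ)))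
    (hjq : Tendsto (fun n : ℕ => tracial (spinCurrent n * familySum n q (Finset.range (n - 1))) / n)
      atTop (𝓝 (R : ℂ)))
    (hqq : Tendsto (fun n : ℕ => tracial (familySum n q (Finset.range (n - 1)) *
      familySum n q (Finset.range (n - 1))) / n) atTop (𝓝 (Q : ℂ))) :
    (∀ᶠ β : ℝ in 𝓝[>] 0, ∃ D : ℝ, IsThermalDrudeWeight Δ β D) ∧
    (∀ ε : ℝ, 0 < ε → ∀ᶠ β : ℝ in 𝓝[>] 0, ∀ D : ℝ,
      IsThermalDrudeWeight Δ β D → R ^ 2 / (2 * Q) - ε ≤ D / β) ∧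
    ∃ κ : ℝ, IsInfiniteTemperatureDrudeRatio Δ κ ∧ R ^ 2 / (2 * Q) ≤ κ := by
  have hH := interaction_isHermitian Δ
  have hT := interaction_transpose Δ
  obtain ⟨β₀, hβ₀, hdm⟩ := exists_drude_measure hH hT hr hr1
  have hjj0 : Tendsto (gibbsCorrelation (interaction Δ) j j 0 0) atTop (𝓝 (L : ℂ)) :=
    hjj.congr fun n => by rw [gibbsCorrelation_zero_zero, ← hJ]
  have hjq0 : Tendsto (gibbsCorrelation (interaction Δ) j q 0 0) atTop (𝓝 (R : ℂ)) :=
    hjq.congr fun n => by rw [gibbsCorrelation_zero_zero, ← hJ]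
  have hqq0 : Tendsto (gibbsCorrelation (interaction Δ) q q 0 0) atTop (𝓝 (Q : ℂ)) :=
    hqq.congr fun n => by rw [gibbsCorrelation_zero_zero]
  have hdens : ∀ {X Y : ∀ d, Op d}, IsOddFamily X C r → IsOddFamily Y C r → ∀ {A : ℂ},
      Tendsto (gibbsCorrelation (interaction Δ) X Y 0 0) atTop (𝓝 A) → ∃ A' : ℝ → ℂ,
        (∀ᶠ β : ℝ in 𝓝[>] 0, Tendsto (gibbsCorrelation (interaction Δ) X Y β 0) atTop
          (𝓝 (A' β))) ∧ Tendsto A' (𝓝[>] 0) (𝓝 A) := by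
    intro X Y hX hY A hA
    obtain ⟨A', h1, h2⟩ := tendsto_correlation_density hH hT hC hr hr1 hX hY (L₀ := A)
      (hA.congr fun n => by simp [gibbsCorrelation, weight, tracial_one])
    refine ⟨A', h1.mono fun β hβ => hβ.congr fun n => ?_, h2⟩
    rw [gibbsCorrelation, sub_zero]
  obtain ⟨Ljj, hLjj, hLjj'⟩ := hdens hj hj hjj0
  obtain ⟨Ljq, hLjq, hLjq'⟩ := hdens hj hq hjq0
  obtain ⟨Lqq, hLqq, hLqq'⟩ := hdens hq hq hqq0
  have hjh' : ∀ n, (familySum n j (Finset.range (n - 1))).IsHermitian := fun n => hJ n ▸ hjh n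
  have hLne : (L : ℂ) ≠ 0 := by exact_mod_cast hL.ne'
  have hsmall : ∀ᶠ β : ℝ in 𝓝[>] 0, 0 < β ∧ |β| ≤ β₀ := by
    filter_upwards [Ioo_mem_nhdsGT hβ₀] with β hβ
    exact ⟨hβ.1, (abs_of_pos hβ.1).trans_le hβ.2.le⟩
  have hlow : Tendsto (fun β => ‖Ljq β‖ ^ 2 / (2 * (Lqq β).re)) (𝓝[>] 0)
      (𝓝 (R ^ 2 / (2 * Q))) := by
    have h1 := (hLjq'.norm.pow 2).div ((((Complex.continuous_re.tendsto _).comp hLqq')).const_mul 2)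
      (by simpa using hQ.ne')
    have h2 : ‖(R : ℂ)‖ ^ 2 / (2 * (Q : ℂ).re) = R ^ 2 / (2 * Q) := by simp
    rw [← h2]
    exact h1
  have hQpos : ∀ᶠ β in 𝓝[>] (0 : ℝ), 0 < (Lqq β).re := by
    have h1 : Tendsto (fun β => (Lqq β).re) (𝓝[>] 0) (𝓝 (Q : ℂ).re) :=
      (Complex.continuous_re.tendsto _).comp hLqq'
    exact h1.eventually (lt_mem_nhds hQ)
  -- Here `D / β` is half the mass of the atom, which the Mazur inequality bounds below by `‖Ljq‖² /
  -- Lqq`.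
  have hthermal : ∀ᶠ β : ℝ in 𝓝[>] 0, 0 < β ∧ ∃ D : ℝ, IsThermalDrudeWeight Δ β D ∧
      ‖Ljq β‖ ^ 2 / (2 * (Lqq β).re) ≤ D / β := by
    filter_upwards [hsmall, hLjj, hLjq, hLqq, hQpos, hLjj'.eventually_ne hLne] with
      β hβ h1 h2 h3 h4 h5
    obtain ⟨μ, M, hlim, hM, hmaz, hre⟩ := hdm hC hj hq hjh' hqh hcomm hβ.2 h1 h2 h3 h5
    refine ⟨hβ.1, _, isThermalDrudeWeight_of_tendsto hJ hre hlim hM, ?_⟩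
    rw [div_le_div_iff₀ (by positivity) hβ.1]
    nlinarith [mul_le_mul_of_nonneg_right hmaz hβ.1.le]
  refine ⟨hthermal.mono fun β hβ => ⟨_, hβ.2.choose_spec.1⟩, fun ε hε => ?_, ?_⟩
  · filter_upwards [hthermal, hlow.eventually (lt_mem_nhds (sub_lt_self _ hε))] with β hβ h1 D hD
    obtain ⟨-, D', hD', hle⟩ := hβ
    rw [hD.unique hD']
    exact h1.le.trans hle
  · obtain ⟨μ, M, hlim, -, hmaz, hre⟩ := hdm hC hj hq hjh' hqh hcomm (β := 0)
      (by simpa using hβ₀.le) hjj0 hjq0 hqq0 hLne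
    refine ⟨_, isInfiniteTemperatureDrudeRatio_of_tendsto hJ hre hlim, ?_⟩
    rw [Complex.norm_real, Real.norm_eq_abs, sq_abs, Complex.ofReal_re, Complex.ofReal_re] at hmaz
    rw [Complex.ofReal_re, div_le_iff₀ (by positivity)]
    linarith

end DrudeWeight


/-! ### The first-order term of `S_n(ε)` as a matrix product operator. -/

section MatrixProduct

/-- Amplitude of `|k⟩⟨k + 1|`, where `k = 0` stands for the auxiliary state `|R⟩`. -/
noncomputable def raising (γ : ℝ) (k : ℕ) : ℝ := if k = 0 then 0 else Real.sin ((k + 1 : ℕ) * γ)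

/-- Amplitude of `|k + 1⟩⟨k|`, where `k = 0` stands for the auxiliary state `|R⟩`. -/
noncomputable def lowering (γ : ℝ) (k : ℕ) : ℝ := if k = 0 then 1 else -Real.sin (k * γ)

/-- One step of the matrix product from the auxiliary state `k`. -/
noncomputable def auxStep (γ : ℝ) {n : ℕ} (y : ℕ → Op n) (k : ℕ) : Op (n + 1) :=
  (Real.cos (k * γ) : ℂ) • site 1 (y k) + (raising γ k : ℂ) • site sigmaPlus (y (k + 1)) +
    if k = 0 then 0 else (lowering γ (k - 1) : ℂ) • site sigmaMinus (y (k - 1))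

/-- The matrix product operator from the auxiliary state `k` to `|R⟩` (the state `0`). -/
noncomputable def mpoTail (γ : ℝ) : ∀ n : ℕ, ℕ → Op n
  | 0, k => if k = 0 then 1 else 0
  | n + 1, k => auxStep γ (mpoTail γ n) k

/-- The matrix product operator from the auxiliary state `|L⟩` to `|R⟩`. -/
noncomputable def mpo (γ : ℝ) : ∀ n : ℕ, Op n
  | 0 => 0
  | n + 1 => site 1 (mpo γ n) + site sigmaPlus (mpoTail γ n 1)

/-- The state `|R⟩` is absorbing: its diagonal amplitude is `cos 0 = 1` and nothing leads out of it.
-/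
theorem mpoTail_zero_right (γ : ℝ) (n : ℕ) : mpoTail γ n 0 = 1 := by
  induction n with
  | zero => rfl
  | succ n ih => simp [mpoTail, auxStep, ih, raising, site_one]

theorem mpoTail_succ_succ (γ : ℝ) (n k : ℕ) : mpoTail γ (n + 1) (k + 1) =
    (Real.cos ((k + 1 : ℕ) * γ) : ℂ) • site 1 (mpoTail γ n (k + 1)) +
      (raising γ (k + 1) : ℂ) • site sigmaPlus (mpoTail γ n (k + 2)) +
      (lowering γ k : ℂ) • site sigmaMinus (mpoTail γ n k) := by
  simp [mpoTail, auxStep]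

/-- The operators `⟨k| A_{s_1} ⋯ A_{s_n} |0⟩ σ^{s_1} ⊗ ⋯ ⊗ σ^{s_n}` summed over `s`. -/
noncomputable def sTail (Δ : ℝ) (ε : ℂ) (n k : ℕ) : Op n :=
  ∑ s : Fin n → Fin 3,
    ((List.ofFn fun i => ![auxZero Δ ε, auxPlus, auxMinus Δ ε] (s i)).prod (Pi.single 0 1) k) •
      tensor fun i => ![1, sigmaPlus, sigmaMinus] (s i)

theorem sTail_zero (Δ : ℝ) (ε : ℂ) (k : ℕ) : sTail Δ ε 0 k = if k = 0 then 1 else 0 := by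
  rw [sTail, Fintype.sum_unique]
  by_cases hk : k = 0
  · simp [hk, tensor_fin_zero]
  · simp [hk, tensor_fin_zero]

theorem sTail_succ (Δ : ℝ) (ε : ℂ) (n k : ℕ) : sTail Δ ε (n + 1) k =
    ampZero Δ ε k • site 1 (sTail Δ ε n k) + site sigmaPlus (sTail Δ ε n (k + 1)) +
      if k = 0 then 0 else ampProd Δ ε (k - 1) • site sigmaMinus (sTail Δ ε n (k - 1)) := by
  unfold sTail
  rw [← (Fin.consEquiv fun _ => Fin 3).sum_comp, Fintype.sum_prod_type, Fin.sum_univ_three]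
  simp only [site_sum_right, Finset.smul_sum]
  congr 1
  · congr 1
    · refine Finset.sum_congr rfl fun s _ => ?_
      rw [tensor_succ, site_smul_right, smul_smul, List.ofFn_succ, List.prod_cons,
        Module.End.mul_apply]
      rfl
    · refine Finset.sum_congr rfl fun s _ => ?_
      rw [tensor_succ, site_smul_right, List.ofFn_succ, List.prod_cons, Module.End.mul_apply]
      rfl
  · by_cases hk : k = 0
    · subst hk
      rw [if_pos rfl]
      refine Finset.sum_eq_zero fun s _ => ?_
      rw [List.ofFn_succ, List.prod_cons, Module.End.mul_apply]
      exact zero_smul ℂ _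
    · obtain ⟨k, rfl⟩ := Nat.exists_eq_succ_of_ne_zero hk
      rw [if_neg hk]
      refine Finset.sum_congr rfl fun s _ => ?_
      rw [tensor_succ, site_smul_right, smul_smul, List.ofFn_succ, List.prod_cons,
        Module.End.mul_apply]
      rfl

theorem ampZero_zero_right (Δ : ℝ) (ε : ℂ) : ampZero Δ ε 0 = 1 := by
  simp [ampZero]

theorem ampZero_cos (γ : ℝ) (k : ℕ) : ampZero (Real.cos γ) 0 k = (Real.cos (k * γ) : ℂ) := by
  rw [ampZero, Complex.ofReal_cos, Polynomial.Chebyshev.T_complex_cos]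
  simp

/-- The recursion telescopes to `cos((k+1)γ) cos(kγ) - cos γ`, and the subtraction formula for the
cosine turns this into a product of sines. -/
theorem ampProd_cos (γ : ℝ) (k : ℕ) : ampProd (Real.cos γ) 0 k =
    -((Real.sin (k * γ) : ℝ) : ℂ) * (Real.sin ((k + 1 : ℕ) * γ) : ℝ) := by
  have h : ∀ k : ℕ, -(Real.sin (k * γ)) * Real.sin ((k + 1 : ℕ) * γ) =
      Real.cos ((k + 1 : ℕ) * γ) * Real.cos (k * γ) - Real.cos γ := by
    intro k
    have h1 := Real.cos_sub ((k + 1 : ℕ) * γ) (k * γ)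
    have h2 : ((k + 1 : ℕ) : ℝ) * γ - k * γ = γ := by push_cast; ring
    rw [h2] at h1
    linarith
  induction k with
  | zero => simp [ampProd]
  | succ k ih =>
    rw [ampProd, ih, ampZero_cos, ampZero_cos, ampZero_cos]
    have h1 := congrArg (fun x : ℝ => (x : ℂ)) (h k)
    have h2 := congrArg (fun x : ℝ => (x : ℂ)) (h (k + 1))
    simp only [Complex.ofReal_mul, Complex.ofReal_neg, Complex.ofReal_sub] at h1 h2
    linear_combination h1 - h2

theorem differentiable_ampZero (Δ : ℝ) (k : ℕ) : Differentiable ℂ fun ε => ampZero Δ ε k := by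
  unfold ampZero
  fun_prop

theorem differentiable_ampProd (Δ : ℝ) (k : ℕ) : Differentiable ℂ fun ε => ampProd Δ ε k := by
  induction k with
  | zero => unfold ampProd; fun_prop
  | succ k ih =>
    have := differentiable_ampZero Δ
    unfold ampProd
    exact (ih.add ((this _).mul (this _))).sub ((this _).mul (this _))

/-- With `b_0 = 0` no path from a positive state can return to `|0⟩`. -/
theorem sTail_at_zero (γ : ℝ) (n k : ℕ) :
    sTail (Real.cos γ) 0 n k = if k = 0 then 1 else 0 := by
  induction n generalizing k with
  | zero => exact sTail_zero _ _ _
  | succ n ih =>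
    rw [sTail_succ]
    rcases k with _ | _ | k
    · simp [ih, ampZero_zero_right, site_one, site_zero_right]
    · simp [ih, ampProd, site_zero_right]
    · simp [ih, site_zero_right]

/-- The change of gauge between the matrix product forms of `S_n(ε)` and of `Z_n`. -/
noncomputable def gauge (γ : ℝ) (k : ℕ) : ℝ := ∏ i ∈ Finset.range k, Real.sin ((i + 2 : ℕ) * γ)

/-- Tails from positive states vanish at `ε = 0`, so in the product rule the derivatives of `a_k`
and `b_k` with `k ≥ 1` drop out. Only the derivative `i` of `b_0` survives; it marks the single
return to `|0⟩`, which acts as `|L⟩` before the excursion and as `|R⟩` after it. The gauge enters as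
a factor and is never inverted, so its zeros at resonant angles are harmless. -/
theorem hasDerivAt_sTail (γ : ℝ) (n : ℕ) :
    (∀ a b, HasDerivAt (fun ε => sTail (Real.cos γ) ε n 0 a b) (Complex.I * mpo γ n a b) 0) ∧
    ∀ k a b, HasDerivAt (fun ε => sTail (Real.cos γ) ε n (k + 1) a b)
      (Complex.I * gauge γ k * mpoTail γ n (k + 1) a b) 0 := by
  induction n with
  | zero =>
    constructor
    · intro a b
      simp only [sTail_zero, mpo, Matrix.zero_apply, mul_zero]
      exact hasDerivAt_const _ _
    · intro k a b
      simp only [sTail_zero, mpoTail, if_neg (Nat.succ_ne_zero k), Matrix.zero_apply, mul_zero]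
      exact hasDerivAt_const _ _
  | succ n ih =>
    constructor
    · intro a b
      simp only [sTail_succ, if_pos, ampZero_zero_right, one_smul, Matrix.add_apply, Matrix.zero_apply,
        add_zero, site_apply, mpo]
      have h1 := ((ih.1 (Fin.tail a) (Fin.tail b)).const_mul
        ((1 : Matrix (Fin 2) (Fin 2) ℂ) (a 0) (b 0))).add
        ((ih.2 0 (Fin.tail a) (Fin.tail b)).const_mul (sigmaPlus (a 0) (b 0)))
      refine h1.congr_deriv ?_
      simp only [gauge, Finset.range_zero, Finset.prod_empty, Complex.ofReal_one]
      ring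
    · intro k a b
      have hz : ∀ k, sTail (Real.cos γ) 0 n (k + 1) = 0 := fun k => by
        rw [sTail_at_zero, if_neg (Nat.succ_ne_zero k)]
      simp only [sTail_succ, if_neg (Nat.succ_ne_zero k), Nat.add_sub_cancel, Matrix.add_apply,
        Matrix.smul_apply, site_apply, smul_eq_mul, mpoTail_succ_succ]
      have hA := (differentiable_ampZero (Real.cos γ) (k + 1) 0).hasDerivAt
      have h1 := hA.mul ((ih.2 k (Fin.tail a) (Fin.tail b)).const_mul
        ((1 : Matrix (Fin 2) (Fin 2) ℂ) (a 0) (b 0)))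
      have h2 := (ih.2 (k + 1) (Fin.tail a) (Fin.tail b)).const_mul (sigmaPlus (a 0) (b 0))
      have hg : gauge γ (k + 1) = gauge γ k * Real.sin ((k + 2 : ℕ) * γ) :=
        Finset.prod_range_succ _ _
      rcases k with _ | k
      · have hB : HasDerivAt (fun ε => ampProd (Real.cos γ) ε 0) Complex.I 0 := by
          simpa [ampProd] using (hasDerivAt_id (0 : ℂ)).const_mul Complex.I
        have h3 := hB.mul ((ih.1 (Fin.tail a) (Fin.tail b)).const_mul (sigmaMinus (a 0) (b 0)))
        refine ((h1.add h2).add h3).congr_deriv ?_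
        rw [hz, ampZero_cos, sTail_at_zero, hg, mpoTail_zero_right]
        simp only [gauge, raising, lowering, ampProd]
        simp
        ring
      · have hB := (differentiable_ampProd (Real.cos γ) (k + 1) 0).hasDerivAt
        have h3 := hB.mul ((ih.2 k (Fin.tail a) (Fin.tail b)).const_mul (sigmaMinus (a 0) (b 0)))
        refine ((h1.add h2).add h3).congr_deriv ?_
        have hg' : gauge γ (k + 1) = gauge γ k * Real.sin ((k + 2 : ℕ) * γ) :=
          Finset.prod_range_succ _ _
        rw [hz, hz, ampZero_cos, ampProd_cos, hg, hg']
        simp only [raising, lowering, if_neg (Nat.succ_ne_zero _), Matrix.zero_apply, mul_zero,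
          zero_add, Complex.ofReal_mul, Complex.ofReal_neg]
        ring

theorem zOperator_eq_mpo (γ : ℝ) (n : ℕ) : zOperator (Real.cos γ) n = mpo γ n := by
  ext a b
  have h : (fun ε => sOperator (Real.cos γ) n ε a b) = fun ε => sTail (Real.cos γ) ε n 0 a b := rfl
  rw [zOperator, Matrix.of_apply, h, ((hasDerivAt_sTail γ n).1 a b).deriv, ← mul_assoc]
  simp

end MatrixProduct


/-! ### Almost conservation: the commutator with the Hamiltonian. -/

section Commutator

theorem sigmaPlus_mul_sigmaPlus : sigmaPlus * sigmaPlus = 0 := by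
  ext i j; fin_cases i <;> fin_cases j <;> simp [sigmaPlus]

theorem sigmaMinus_mul_sigmaMinus : sigmaMinus * sigmaMinus = 0 := by
  ext i j; fin_cases i <;> fin_cases j <;> simp [sigmaMinus]

theorem sigmaPlus_mul_sigmaMinus :
    sigmaPlus * sigmaMinus = (1 / 2 : ℂ) • 1 + (1 / 2 : ℂ) • sigmaZ := by
  ext i j; fin_cases i <;> fin_cases j <;> simp [sigmaPlus, sigmaMinus, sigmaZ]; norm_num

theorem sigmaMinus_mul_sigmaPlus :
    sigmaMinus * sigmaPlus = (1 / 2 : ℂ) • 1 - (1 / 2 : ℂ) • sigmaZ := by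
  ext i j; fin_cases i <;> fin_cases j <;> simp [sigmaPlus, sigmaMinus, sigmaZ]; norm_num

theorem sigmaZ_mul_sigmaPlus : sigmaZ * sigmaPlus = sigmaPlus := by
  ext i j; fin_cases i <;> fin_cases j <;> simp [sigmaPlus, sigmaZ]

theorem sigmaPlus_mul_sigmaZ : sigmaPlus * sigmaZ = (-1 : ℂ) • sigmaPlus := by
  ext i j; fin_cases i <;> fin_cases j <;> simp [sigmaPlus, sigmaZ]

theorem sigmaZ_mul_sigmaMinus : sigmaZ * sigmaMinus = (-1 : ℂ) • sigmaMinus := by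
  ext i j; fin_cases i <;> fin_cases j <;> simp [sigmaMinus, sigmaZ]

theorem sigmaMinus_mul_sigmaZ : sigmaMinus * sigmaZ = sigmaMinus := by
  ext i j; fin_cases i <;> fin_cases j <;> simp [sigmaMinus, sigmaZ]

/-- The interaction on the first two sites. -/
noncomputable def headBond (Δ : ℝ) (n : ℕ) : Op (n + 2) :=
  (2 : ℂ) • (site sigmaPlus (site sigmaMinus 1) + site sigmaMinus (site sigmaPlus 1)) +
    (Δ : ℂ) • site sigmaZ (site sigmaZ 1)

theorem shift_zero_tensor_pair (n : ℕ) (A B : Matrix (Fin 2) (Fin 2) ℂ) :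
    shift (n + 2) 0 (tensor ![A, B]) = site A (site B 1) := by
  rw [tensor_two_sites, shift_zero_site, shift_zero_site, shift_one (by omega)]

theorem shift_zero_tensor_single (n : ℕ) (A : Matrix (Fin 2) (Fin 2) ℂ) :
    shift (n + 1) 0 (tensor ![A]) = site A 1 := by
  rw [tensor_one_site, shift_zero_site, shift_one (by omega)]

theorem sum_shift_succ (n : ℕ) (q : Op 2) :
    ∑ x ∈ Finset.range (n + 2 - 1), shift (n + 2) x q =
      site 1 (∑ x ∈ Finset.range (n + 1 - 1), shift (n + 1) x q) + shift (n + 2) 0 q := by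
  rw [show n + 2 - 1 = n + 1 by omega, Finset.sum_range_succ', Nat.add_sub_cancel, site_sum_right]
  simp only [shift_succ]

theorem hamiltonian_succ (Δ : ℝ) (n : ℕ) :
    hamiltonian Δ (n + 2) = site 1 (hamiltonian Δ (n + 1)) + headBond Δ n := by
  rw [hamiltonian, sum_shift_succ, interaction, shift_add, shift_smul, shift_smul, shift_add]
  simp only [shift_zero_tensor_pair]
  rfl

theorem hamiltonian_one (Δ : ℝ) : hamiltonian Δ 1 = 0 := by simp [hamiltonian]

theorem headBond_mul (Δ : ℝ) {n : ℕ} (A B : Matrix (Fin 2) (Fin 2) ℂ) (X : Op n) :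
    headBond Δ n * site A (site B X) =
      (2 : ℂ) • (site (sigmaPlus * A) (site (sigmaMinus * B) X) +
        site (sigmaMinus * A) (site (sigmaPlus * B) X)) +
      (Δ : ℂ) • site (sigmaZ * A) (site (sigmaZ * B) X) := by
  simp only [headBond, add_mul, smul_mul_assoc, site_mul, one_mul]

theorem mul_headBond (Δ : ℝ) {n : ℕ} (A B : Matrix (Fin 2) (Fin 2) ℂ) (X : Op n) :
    site A (site B X) * headBond Δ n =
      (2 : ℂ) • (site (A * sigmaPlus) (site (B * sigmaMinus) X) +
        site (A * sigmaMinus) (site (B * sigmaPlus) X)) +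
      (Δ : ℂ) • site (A * sigmaZ) (site (B * sigmaZ) X) := by
  simp only [headBond, mul_add, mul_smul_comm, site_mul, mul_one]

/-- Commutator with the interaction on the first two sites. -/
noncomputable def headComm (Δ : ℝ) (n : ℕ) : Op (n + 2) →ₗ[ℂ] Op (n + 2) where
  toFun X := headBond Δ n * X - X * headBond Δ n
  map_add' X Y := by rw [mul_add, add_mul]; abel
  map_smul' c X := by rw [mul_smul_comm, smul_mul_assoc, smul_sub]; rfl

theorem headComm_apply (Δ : ℝ) {n : ℕ} (X : Op (n + 2)) :
    headComm Δ n X = headBond Δ n * X - X * headBond Δ n := rfl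

section Table

variable (Δ : ℝ) {n : ℕ} (X : Op n)

theorem headComm_one_one : headComm Δ n (site 1 (site 1 X)) = 0 := by
  rw [headComm_apply, headBond_mul, mul_headBond]
  simp

theorem headComm_plus_one : headComm Δ n (site sigmaPlus (site 1 X)) =
    (-2 : ℂ) • site sigmaZ (site sigmaPlus X) +
      (2 * Δ : ℂ) • site sigmaPlus (site sigmaZ X) := by
  rw [headComm_apply, headBond_mul, mul_headBond]
  simp only [mul_one, one_mul, sigmaPlus_mul_sigmaPlus, sigmaPlus_mul_sigmaMinus,
    sigmaMinus_mul_sigmaPlus, sigmaZ_mul_sigmaPlus, sigmaPlus_mul_sigmaZ, site_zero_left,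
    site_add_left, site_sub_left, site_smul_left]
  module

theorem headComm_one_plus : headComm Δ n (site 1 (site sigmaPlus X)) =
    (-2 : ℂ) • site sigmaPlus (site sigmaZ X) +
      (2 * Δ : ℂ) • site sigmaZ (site sigmaPlus X) := by
  rw [headComm_apply, headBond_mul, mul_headBond]
  simp only [mul_one, one_mul, sigmaPlus_mul_sigmaPlus, sigmaPlus_mul_sigmaMinus,
    sigmaMinus_mul_sigmaPlus, sigmaZ_mul_sigmaPlus, sigmaPlus_mul_sigmaZ, site_zero_left,
    site_zero_right, site_add_left, site_sub_left, site_smul_left, site_add_right,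
    site_sub_right, site_smul_right]
  module

theorem headComm_minus_one : headComm Δ n (site sigmaMinus (site 1 X)) =
    (2 : ℂ) • site sigmaZ (site sigmaMinus X) -
      (2 * Δ : ℂ) • site sigmaMinus (site sigmaZ X) := by
  rw [headComm_apply, headBond_mul, mul_headBond]
  simp only [mul_one, one_mul, sigmaMinus_mul_sigmaMinus, sigmaPlus_mul_sigmaMinus,
    sigmaMinus_mul_sigmaPlus, sigmaZ_mul_sigmaMinus, sigmaMinus_mul_sigmaZ, site_zero_left,
    site_add_left, site_sub_left, site_smul_left]
  module

theorem headComm_one_minus : headComm Δ n (site 1 (site sigmaMinus X)) =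
    (2 : ℂ) • site sigmaMinus (site sigmaZ X) -
      (2 * Δ : ℂ) • site sigmaZ (site sigmaMinus X) := by
  rw [headComm_apply, headBond_mul, mul_headBond]
  simp only [mul_one, one_mul, sigmaMinus_mul_sigmaMinus, sigmaPlus_mul_sigmaMinus,
    sigmaMinus_mul_sigmaPlus, sigmaZ_mul_sigmaMinus, sigmaMinus_mul_sigmaZ, site_zero_left,
    site_zero_right, site_add_left, site_sub_left, site_smul_left, site_add_right,
    site_sub_right, site_smul_right]
  module

theorem headComm_plus_minus : headComm Δ n (site sigmaPlus (site sigmaMinus X)) =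
    site 1 (site sigmaZ X) - site sigmaZ (site 1 X) := by
  rw [headComm_apply, headBond_mul, mul_headBond]
  simp only [sigmaPlus_mul_sigmaPlus, sigmaMinus_mul_sigmaMinus, sigmaPlus_mul_sigmaMinus,
    sigmaMinus_mul_sigmaPlus, sigmaZ_mul_sigmaMinus, sigmaMinus_mul_sigmaZ, sigmaZ_mul_sigmaPlus,
    sigmaPlus_mul_sigmaZ, site_zero_left, site_add_left, site_sub_left, site_smul_left,
    site_add_right, site_sub_right, site_smul_right]
  module

theorem headComm_minus_plus : headComm Δ n (site sigmaMinus (site sigmaPlus X)) =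
    site sigmaZ (site 1 X) - site 1 (site sigmaZ X) := by
  rw [headComm_apply, headBond_mul, mul_headBond]
  simp only [sigmaPlus_mul_sigmaPlus, sigmaMinus_mul_sigmaMinus, sigmaPlus_mul_sigmaMinus,
    sigmaMinus_mul_sigmaPlus, sigmaZ_mul_sigmaMinus, sigmaMinus_mul_sigmaZ, sigmaZ_mul_sigmaPlus,
    sigmaPlus_mul_sigmaZ, site_zero_left, site_add_left, site_sub_left, site_smul_left,
    site_add_right, site_sub_right, site_smul_right]
  module

theorem headComm_plus_plus : headComm Δ n (site sigmaPlus (site sigmaPlus X)) = 0 := by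
  rw [headComm_apply, headBond_mul, mul_headBond]
  simp only [sigmaPlus_mul_sigmaPlus, sigmaZ_mul_sigmaPlus, sigmaPlus_mul_sigmaZ, site_zero_left,
    site_zero_right, site_smul_left, site_smul_right]
  module

theorem headComm_minus_minus : headComm Δ n (site sigmaMinus (site sigmaMinus X)) = 0 := by
  rw [headComm_apply, headBond_mul, mul_headBond]
  simp only [sigmaMinus_mul_sigmaMinus, sigmaZ_mul_sigmaMinus, sigmaMinus_mul_sigmaZ,
    site_zero_left, site_zero_right, site_smul_left, site_smul_right]
  module

end Table

theorem commutator_succ (Δ : ℝ) (n : ℕ) (A : Matrix (Fin 2) (Fin 2) ℂ) (X : Op (n + 1)) :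
    hamiltonian Δ (n + 2) * site A X - site A X * hamiltonian Δ (n + 2) =
      site A (hamiltonian Δ (n + 1) * X - X * hamiltonian Δ (n + 1)) +
        headComm Δ n (site A X) := by
  rw [hamiltonian_succ, headComm_apply, add_mul, mul_add, site_mul, site_mul, one_mul, mul_one,
    site_sub_right]
  abel

/-- Commutator with the Hamiltonian. -/
noncomputable def hamComm (Δ : ℝ) (n : ℕ) : Op n →ₗ[ℂ] Op n where
  toFun X := hamiltonian Δ n * X - X * hamiltonian Δ n
  map_add' X Y := by rw [mul_add, add_mul]; abel
  map_smul' c X := by rw [mul_smul_comm, smul_mul_assoc, smul_sub]; rfl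

theorem hamComm_apply (Δ : ℝ) {n : ℕ} (X : Op n) :
    hamComm Δ n X = hamiltonian Δ n * X - X * hamiltonian Δ n := rfl

theorem hamComm_site (Δ : ℝ) (n : ℕ) (A : Matrix (Fin 2) (Fin 2) ℂ) (X : Op (n + 1)) :
    hamComm Δ (n + 2) (site A X) = site A (hamComm Δ (n + 1) X) + headComm Δ n (site A X) :=
  commutator_succ Δ n A X

theorem hamComm_one (Δ : ℝ) (X : Op 1) : hamComm Δ 1 X = 0 := by
  rw [hamComm_apply, hamiltonian_one, zero_mul, mul_zero, sub_zero]

/-- Contributions of neighbouring bonds cancel and only a defect at the left end remains. Induction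
strips off the first site; the first bond is evaluated on the two exposed sites with the table
above, and each operator string then yields a trigonometric identity. -/
theorem hamComm_mpoTail (γ : ℝ) (n k : ℕ) :
    hamComm (Real.cos γ) (n + 1) (mpoTail γ (n + 1) k) =
      (2 * Real.sin γ * Real.sin (k * γ) : ℂ) • site sigmaZ (mpoTail γ n k) := by
  induction n generalizing k with
  | zero =>
    rw [hamComm_one]
    by_cases hk : k = 0
    · simp [hk]
    · simp [mpoTail, hk, site_zero_right]
  | succ n ih =>
    rcases k with _ | _ | k
    · rw [mpoTail_zero_right, hamComm_apply]
      simp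
    -- The state `1` is special: its amplitude into `|R⟩` is `1` instead of a sine, and `|R⟩`
    -- carries the identity.
    · have h0 : mpoTail γ (n + 1) 0 = site 1 (mpoTail γ n 0) := by
        rw [mpoTail_zero_right, mpoTail_zero_right, site_one]
      rw [mpoTail_succ_succ]
      simp only [map_add, map_smul, hamComm_site, ih]
      simp only [h0, mpoTail_succ_succ, site_add_right, site_smul_right, map_add, map_smul,
        headComm_one_one, headComm_plus_one, headComm_one_plus, headComm_minus_one,
        headComm_one_minus, headComm_plus_minus, headComm_plus_plus, raising,
        lowering, if_neg (Nat.succ_ne_zero _), if_true, zero_add]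
      have e1 : (1 + 1 : ℂ) * γ = γ + γ := by ring
      have e2 : (2 : ℂ) * γ = γ + γ := by ring
      have h1 := Complex.sin_sq_add_cos_sq (γ : ℂ)
      match_scalars <;>
        simp only [one_mul, zero_mul, Complex.sin_zero, e1, e2, Complex.sin_add,
          Complex.cos_add] <;>
        first | ring1 | grind
    · rw [mpoTail_succ_succ]
      simp only [map_add, map_smul, hamComm_site, ih]
      simp only [mpoTail_succ_succ, site_add_right, site_smul_right, map_add, map_smul,
        headComm_one_one, headComm_plus_one, headComm_one_plus, headComm_minus_one,
        headComm_one_minus, headComm_plus_minus, headComm_minus_plus, headComm_plus_plus,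
        headComm_minus_minus, raising, lowering, if_neg (Nat.succ_ne_zero _)]
      -- All angles are reduced to `(k + 2) γ` and `γ`, after which `sin² γ + cos² γ = 1` is the
      -- only relation used.
      have e1 : ((k : ℂ) + 1) * γ = (k + 2) * γ - γ := by ring
      have e2 : ((k : ℂ) + 1 + 1) * γ = (k + 2) * γ := by ring
      have e3 : ((k : ℂ) + 1 + 1 + 1) * γ = (k + 2) * γ + γ := by ring
      have e4 : ((k : ℂ) + 2 + 1) * γ = (k + 2) * γ + γ := by ring
      have e5 : ((k : ℂ) + 1 + 2) * γ = (k + 2) * γ + γ := by ring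
      have h1 := Complex.sin_sq_add_cos_sq (γ : ℂ)
      match_scalars <;>
        simp only [e1, e2, e3, e4, e5, Complex.sin_add, Complex.sin_sub, Complex.cos_add,
          Complex.cos_sub] <;>
        first | ring1 | grind

/-- On the first bond the string `σ⁺ ⊗ σ⁻` leaves a difference of two adjacent `σᶻ`, the other
strings cancel against the defect of the tail, and the differences telescope. -/
theorem hamComm_mpo (γ : ℝ) (n : ℕ) :
    hamComm (Real.cos γ) (n + 1) (mpo γ (n + 1)) =
      shift (n + 1) n (tensor ![sigmaZ]) - shift (n + 1) 0 (tensor ![sigmaZ]) := by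
  induction n with
  | zero => rw [hamComm_one, sub_self]
  | succ n ih =>
    have h0 : mpoTail γ n 0 = 1 := mpoTail_zero_right γ n
    rw [mpo]
    simp only [map_add, hamComm_site, ih, hamComm_mpoTail]
    rw [mpo, mpoTail_succ_succ, zero_add, h0, shift_succ]
    simp only [site_add_right, site_smul_right, site_sub_right, map_add, map_smul,
      headComm_one_one, headComm_one_plus, headComm_plus_one, headComm_plus_minus,
      headComm_plus_plus, raising, lowering, if_neg (Nat.succ_ne_zero _), if_true,
      shift_zero_tensor_single, site_one]
    have h1 := Complex.sin_sq_add_cos_sq (γ : ℂ)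
    match_scalars <;> simp only [one_mul] <;> first | ring1 | grind

theorem sigmaZ_sub_isHermitian (n : ℕ) : (shift (n + 1) n (tensor ![sigmaZ]) -
    shift (n + 1) 0 (tensor ![sigmaZ])).IsHermitian := by
  have h : (tensor ![sigmaZ]).conjTranspose = tensor ![sigmaZ] := by
    rw [tensor_conjTranspose]
    congr 1
    funext i
    fin_cases i
    exact sigmaZ_conjTranspose
  rw [Matrix.IsHermitian, Matrix.conjTranspose_sub, ← shift_conjTranspose, ← shift_conjTranspose, h]

theorem hamiltonian_isHermitian (Δ : ℝ) (n : ℕ) : (hamiltonian Δ n).IsHermitian :=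
  bondSum_conjTranspose (interaction_isHermitian Δ) (Finset.range (n - 1))

theorem chargeZ_eq (γ : ℝ) (n : ℕ) :
    chargeZ (Real.cos γ) n = Complex.I • (mpo γ n - (mpo γ n).conjTranspose) := by
  rw [chargeZ, zOperator_eq_mpo]

/-- The charge is conserved up to boundary terms. -/
theorem hamiltonian_chargeZ_commutator (γ : ℝ) (n : ℕ) :
    hamiltonian (Real.cos γ) n * chargeZ (Real.cos γ) n -
      chargeZ (Real.cos γ) n * hamiltonian (Real.cos γ) n =
      (-2 * Complex.I) • (shift n 0 (tensor ![sigmaZ]) - shift n (n - 1) (tensor ![sigmaZ])) := by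
  rcases n with _ | n
  · simp [hamiltonian]
  · have h1 := hamComm_mpo γ n
    have h2 : hamComm (Real.cos γ) (n + 1) (mpo γ (n + 1)).conjTranspose =
        -(shift (n + 1) n (tensor ![sigmaZ]) - shift (n + 1) 0 (tensor ![sigmaZ])) := by
      rw [← sigmaZ_sub_isHermitian n, ← h1, hamComm_apply, hamComm_apply,
        Matrix.conjTranspose_sub, Matrix.conjTranspose_mul, Matrix.conjTranspose_mul,
        hamiltonian_isHermitian, neg_sub]
    rw [← hamComm_apply, chargeZ_eq, map_smul, map_sub, h1, h2, Nat.add_sub_cancel]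
    module

end Commutator


/-! ### Local densities of the charge and their symmetries. -/

section Densities

theorem auxStep_sum {ι : Type*} (γ : ℝ) {n : ℕ} (s : Finset ι) (f : ι → ℕ → Op n) (k : ℕ) :
    auxStep γ (fun k => ∑ i ∈ s, f i k) k = ∑ i ∈ s, auxStep γ (f i) k := by
  unfold auxStep
  simp only [site_sum_right, Finset.smul_sum, Finset.sum_add_distrib]
  by_cases hk : k = 0 <;> simp [hk]

theorem shift_auxStep (γ : ℝ) {n d : ℕ} (y : ℕ → Op d) (k : ℕ) :
    shift (n + 1) 0 (auxStep γ y k) = auxStep γ (fun k => shift n 0 (y k)) k := by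
  unfold auxStep
  by_cases hk : k = 0
  · simp only [if_pos hk, shift_add, shift_smul, shift_zero_site, shift_zero]
  · simp only [if_neg hk, shift_add, shift_smul, shift_zero_site]

/-- The matrix product operators whose auxiliary path reaches `|R⟩` at the last site only. -/
noncomputable def mpoHit (γ : ℝ) : ∀ n : ℕ, ℕ → Op n
  | 0, k => if k = 0 then 1 else 0
  | n + 1, k => if k = 0 then 0 else auxStep γ (mpoHit γ n) k

/-- After arrival at `|R⟩` only identities follow, so paths are classified by their arrival time. -/
theorem mpoTail_eq_sum_mpoHit (γ : ℝ) (n k : ℕ) :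
    mpoTail γ n k = ∑ d ∈ Finset.range (n + 1), shift n 0 (mpoHit γ d k) := by
  induction n generalizing k with
  | zero => simp [shift_self, mpoTail, mpoHit]
  | succ n ih =>
    rw [Finset.sum_range_succ']
    by_cases hk : k = 0
    · subst hk
      rw [mpoTail_zero_right, Finset.sum_eq_zero fun d _ => ?_, zero_add]
      · exact (shift_one (by omega)).symm
      · simp [mpoHit, shift_zero]
    · have h0 : mpoHit γ 0 k = 0 := if_neg hk
      rw [h0, shift_zero, add_zero]
      simp only [mpoHit, if_neg hk, shift_auxStep]
      rw [← auxStep_sum, mpoTail]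
      congr 1
      funext k
      exact ih k

/-- The densities of `Z`. -/
noncomputable def zDensity (γ : ℝ) : ∀ d : ℕ, Op d
  | 0 => 0
  | d + 1 => site sigmaPlus (mpoHit γ d 1)

theorem mpo_eq_sum_zDensity (γ : ℝ) (n : ℕ) : mpo γ n =
    ∑ x ∈ Finset.range n, ∑ d ∈ Finset.range (n + 1), shift n x (zDensity γ d) := by
  induction n with
  | zero => rfl
  | succ n ih =>
    rw [Finset.sum_range_succ', mpo, ih, mpoTail_eq_sum_mpoHit, site_sum_right, site_sum_right]
    congr 1
    · refine Finset.sum_congr rfl fun x _ => ?_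
      rw [Finset.sum_range_succ (n := n + 1), shift_of_not_le (by omega), add_zero, site_sum_right]
      exact Finset.sum_congr rfl fun d _ => (shift_succ _).symm
    · conv_rhs => rw [Finset.sum_range_succ']
      simp only [zDensity, shift_zero, add_zero, shift_zero_site]

/-- The densities of the charge `Q = i (Z - Z†)`. -/
noncomputable def chargeDensity (γ : ℝ) (d : ℕ) : Op d :=
  Complex.I • (zDensity γ d - (zDensity γ d).conjTranspose)

theorem chargeDensity_zero (γ : ℝ) : chargeDensity γ 0 = 0 := by simp [chargeDensity, zDensity]

theorem chargeDensity_one (γ : ℝ) : chargeDensity γ 1 = 0 := by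
  simp [chargeDensity, zDensity, mpoHit, site_zero_right]

theorem chargeZ_eq_sum (γ : ℝ) (n : ℕ) : chargeZ (Real.cos γ) n =
    ∑ x ∈ Finset.range n, ∑ d ∈ Finset.range (n + 1), shift n x (chargeDensity γ d) := by
  rw [chargeZ_eq, mpo_eq_sum_zDensity]
  simp only [Matrix.conjTranspose_sum, ← Finset.sum_sub_distrib, Finset.smul_sum, chargeDensity,
    shift_smul, shift_sub, shift_conjTranspose]

/-- Densities on zero and one site vanish, so indexing by nonempty intervals of bonds loses nothing.
-/
theorem chargeZ_eq_familySum (γ : ℝ) (n : ℕ) : chargeZ (Real.cos γ) n =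
    familySum n (chargeDensity γ) (Finset.range (n - 1)) := by
  rw [chargeZ_eq_sum, familySum]
  refine Finset.sum_congr rfl fun x hx => ?_
  rw [Finset.mem_range] at hx
  have h1 : ∀ e, (if Finset.Ico x (x + e + 1) ⊆ Finset.range (n - 1) then
      shift n x (chargeDensity γ (e + 2)) else 0) = shift n x (chargeDensity γ (e + 2)) := by
    intro e
    split_ifs with h
    · rfl
    · rw [shift_of_not_le]
      intro h2
      apply h
      intro i hi
      simp only [Finset.mem_Ico, Finset.mem_range] at hi ⊢
      omega
  simp only [h1]
  obtain ⟨k, rfl⟩ : ∃ k, n = k + 1 := ⟨n - 1, by omega⟩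
  rw [Finset.sum_range_succ', Finset.sum_range_succ', chargeDensity_zero, chargeDensity_one,
    shift_zero, shift_zero, add_zero, add_zero, Finset.sum_range_succ, shift_of_not_le (by omega),
    add_zero]

theorem sum_Icc_eq_familySum_order (γ : ℝ) (n : ℕ) : chargeZ (Real.cos γ) n =
    ∑ d ∈ Finset.Icc 1 n, ∑ x ∈ Finset.range (n - d + 1), shift n x (chargeDensity γ d) := by
  rw [chargeZ_eq_sum, Finset.sum_comm, Finset.sum_range_succ', chargeDensity_zero]
  simp only [shift_zero, Finset.sum_const_zero, add_zero]
  rw [Finset.range_eq_Ico, Finset.sum_Ico_add' (fun d => ∑ x ∈ Finset.Ico 0 n,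
    shift n x (chargeDensity γ d)) 0 n 1]
  refine Finset.sum_congr (by ext; simp) fun d hd => ?_
  rw [Finset.mem_Icc] at hd
  symm
  refine Finset.sum_subset (fun x hx => ?_) fun x hx hx' => shift_of_not_le ?_ _
  · simp only [Finset.mem_range, Finset.mem_Ico] at hx ⊢
    omega
  · simp only [Finset.mem_range, Finset.mem_Ico] at hx hx'
    omega

/-- All amplitudes and site matrices are real, so adjoint and transpose agree. This makes the charge
odd under transposition. -/
theorem auxStep_conjTranspose (γ : ℝ) {n : ℕ} {y : ℕ → Op n}
    (hy : ∀ k, (y k).conjTranspose = (y k).transpose) (k : ℕ) :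
    (auxStep γ y k).conjTranspose = (auxStep γ y k).transpose := by
  unfold auxStep
  by_cases hk : k = 0 <;>
    simp only [hk, if_true, if_false, Matrix.conjTranspose_add, Matrix.conjTranspose_smul,
      Matrix.transpose_add, Matrix.transpose_smul, Matrix.conjTranspose_zero,
      Matrix.transpose_zero, Matrix.conjTranspose_one, Matrix.transpose_one, Complex.star_def,
      Complex.conj_ofReal, site_conjTranspose, site_transpose, hy, sigmaPlus_conjTranspose,
      sigmaMinus_conjTranspose, sigmaPlus_transpose, sigmaMinus_transpose]

theorem mpoHit_conjTranspose (γ : ℝ) (d k : ℕ) :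
    (mpoHit γ d k).conjTranspose = (mpoHit γ d k).transpose := by
  induction d generalizing k with
  | zero => by_cases hk : k = 0 <;> simp [mpoHit, hk]
  | succ d ih =>
    by_cases hk : k = 0
    · simp [mpoHit, hk]
    · simp only [mpoHit, if_neg hk]
      exact auxStep_conjTranspose γ ih k

theorem zDensity_conjTranspose (γ : ℝ) (d : ℕ) :
    (zDensity γ d).conjTranspose = (zDensity γ d).transpose := by
  cases d with
  | zero => simp [zDensity]
  | succ d =>
    simp [zDensity, site_conjTranspose, site_transpose, sigmaPlus_conjTranspose,
      sigmaPlus_transpose, mpoHit_conjTranspose]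

theorem chargeDensity_transpose (γ : ℝ) (d : ℕ) :
    (chargeDensity γ d).transpose = -chargeDensity γ d := by
  rw [chargeDensity, zDensity_conjTranspose, Matrix.transpose_smul, Matrix.transpose_sub,
    Matrix.transpose_transpose, ← smul_neg, neg_sub]

theorem isHermitian_I_smul_sub {n : ℕ} (Z : Op n) :
    (Complex.I • (Z - Z.conjTranspose)).IsHermitian := by
  rw [Matrix.IsHermitian, Matrix.conjTranspose_smul, Matrix.conjTranspose_sub,
    Matrix.conjTranspose_conjTranspose, Complex.star_def, Complex.conj_I, neg_smul, ← smul_neg,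
    neg_sub]

theorem chargeDensity_isHermitian (γ : ℝ) (d : ℕ) : (chargeDensity γ d).IsHermitian :=
  isHermitian_I_smul_sub _

theorem chargeZ_isHermitian (γ : ℝ) (n : ℕ) : (chargeZ (Real.cos γ) n).IsHermitian :=
  chargeZ_eq γ n ▸ isHermitian_I_smul_sub _

theorem tracial_chargeDensity (γ : ℝ) (d : ℕ) : tracial (chargeDensity γ d) = 0 := by
  have h : tracial (chargeDensity γ d) = -tracial (chargeDensity γ d) := by
    conv_lhs => rw [← tracial_transpose, chargeDensity_transpose]
    rw [← tracialLinear_apply, map_neg, tracialLinear_apply]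
  exact self_eq_neg.1 h

/-- If `Z²` is traceless then `i (Z - Z†)` has twice the squared norm of `Z`. -/
theorem tracial_I_smul_sub_mul_self {n : ℕ} {Z : Op n} (hZ : tracial (Z * Z) = 0) :
    tracial ((Complex.I • (Z - Z.conjTranspose)) * (Complex.I • (Z - Z.conjTranspose))) =
      2 * (hs Z ^ 2 : ℝ) := by
  have h1 : tracial (Z.conjTranspose * Z.conjTranspose) = 0 := by
    rw [← Matrix.conjTranspose_mul, tracial_conjTranspose, hZ, map_zero]
  have h2 : tracial (Z * Z.conjTranspose) = (hs Z ^ 2 : ℝ) := by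
    rw [tracial_mul_comm, tracial_conjTranspose_mul_self_eq_hs_sq]
  have h3 : tracial (Z.conjTranspose * Z) = (hs Z ^ 2 : ℝ) := by
    rw [tracial_mul_comm, h2]
  simp only [smul_mul_assoc, mul_smul_comm, tracial_smul, sub_mul, mul_sub, tracial_sub, hZ, h1,
    h2, h3]
  linear_combination (-2 * ((hs Z ^ 2 : ℝ) : ℂ)) * Complex.I_mul_I

end Densities


/-! ### The norm recursion: decay of densities and norm density of the charge. -/

section Norms

theorem trace_one_two : (1 : Matrix (Fin 2) (Fin 2) ℂ).trace = 2 := by simp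

theorem trace_sigmaPlus : sigmaPlus.trace = 0 := by simp [sigmaPlus, Matrix.trace_fin_two]

theorem trace_sigmaMinus : sigmaMinus.trace = 0 := by simp [sigmaMinus, Matrix.trace_fin_two]

theorem trace_sigmaPlus_mul_sigmaMinus : (sigmaPlus * sigmaMinus).trace = 1 := by
  simp [sigmaMinus, sigmaPlus, Matrix.trace_fin_two]

theorem trace_sigmaMinus_mul_sigmaPlus : (sigmaMinus * sigmaPlus).trace = 1 := by
  simp [sigmaMinus, sigmaPlus, Matrix.trace_fin_two]

/-- The matrices `1, σ⁺, σ⁻` are orthogonal with normalized squared norms `1, 1/2, 1/2`; hence the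
factor `1/2` in the transfer matrix. -/
theorem hs_sq_pauli_combination {n : ℕ} (a b c : ℝ) (X Y Z : Op n) :
    hs ((a : ℂ) • site 1 X + (b : ℂ) • site sigmaPlus Y + (c : ℂ) • site sigmaMinus Z) ^ 2 =
      a ^ 2 * hs X ^ 2 + 1 / 2 * b ^ 2 * hs Y ^ 2 + 1 / 2 * c ^ 2 * hs Z ^ 2 := by
  have h : ((hs ((a : ℂ) • site 1 X + (b : ℂ) • site sigmaPlus Y +
      (c : ℂ) • site sigmaMinus Z) ^ 2 : ℝ) : ℂ) = ((a ^ 2 * hs X ^ 2 + 1 / 2 * b ^ 2 * hs Y ^ 2 +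
        1 / 2 * c ^ 2 * hs Z ^ 2 : ℝ) : ℂ) := by
    rw [← tracial_conjTranspose_mul_self_eq_hs_sq]
    push_cast
    simp only [← Complex.ofReal_pow, ← tracial_conjTranspose_mul_self_eq_hs_sq]
    simp only [Matrix.conjTranspose_add, Matrix.conjTranspose_smul, site_conjTranspose,
      sigmaPlus_conjTranspose, sigmaMinus_conjTranspose, Matrix.conjTranspose_one, Complex.star_def,
      Complex.conj_ofReal, add_mul, mul_add, smul_mul_assoc, mul_smul_comm, site_mul, tracial_add,
      tracial_smul, tracial_site, one_mul, mul_one, sigmaPlus_mul_sigmaPlus,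
      sigmaMinus_mul_sigmaMinus, trace_one_two, trace_sigmaPlus, trace_sigmaMinus,
      trace_sigmaPlus_mul_sigmaMinus, trace_sigmaMinus_mul_sigmaPlus, Matrix.trace_zero]
    push_cast
    ring
  exact_mod_cast h

/-- One step of the recursion for the squared norms of the matrix product operators. -/
noncomputable def normStep (γ : ℝ) (t : ℕ → ℝ) (k : ℕ) : ℝ :=
  Real.cos (k * γ) ^ 2 * t k + 1 / 2 * raising γ k ^ 2 * t (k + 1) +
    if k = 0 then 0 else 1 / 2 * lowering γ (k - 1) ^ 2 * t (k - 1)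

theorem hs_sq_auxStep (γ : ℝ) {n : ℕ} (y : ℕ → Op n) (k : ℕ) :
    hs (auxStep γ y k) ^ 2 = normStep γ (fun k => hs (y k) ^ 2) k := by
  unfold auxStep normStep
  by_cases hk : k = 0
  · have := hs_sq_pauli_combination (Real.cos (k * γ)) (raising γ k) 0 (y k) (y (k + 1)) 0
    simp only [if_pos hk]
    simpa [site_zero_right] using this
  · simp only [if_neg hk]
    exact hs_sq_pauli_combination _ _ _ _ _ _

theorem hs_site_sigmaPlus_sq {n : ℕ} (Y : Op n) : hs (site sigmaPlus Y) ^ 2 = 1 / 2 * hs Y ^ 2 := by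
  have := hs_sq_pauli_combination 0 1 0 0 Y 0
  simpa using this

theorem hs_mpo_succ (γ : ℝ) (n : ℕ) :
    hs (mpo γ (n + 1)) ^ 2 = hs (mpo γ n) ^ 2 + 1 / 2 * hs (mpoTail γ n 1) ^ 2 := by
  have := hs_sq_pauli_combination 1 1 0 (mpo γ n) (mpoTail γ n 1) 0
  simpa [mpo] using this

/-- The first factor of a string other than the identity is `σ⁺`, which is traceless and squares to
zero. -/
theorem tracial_mpo_mul_self (γ : ℝ) (n : ℕ) : tracial (mpo γ n * mpo γ n) = 0 := by
  induction n with
  | zero => simp [mpo, tracial_zero]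
  | succ n ih =>
    simp only [mpo, add_mul, mul_add, site_mul, tracial_add, tracial_site, one_mul, mul_one,
      sigmaPlus_mul_sigmaPlus, trace_one_two, trace_sigmaPlus, Matrix.trace_zero, ih]
    ring

theorem tracial_chargeZ_mul_self (γ : ℝ) (n : ℕ) :
    tracial (chargeZ (Real.cos γ) n * chargeZ (Real.cos γ) n) = 2 * (hs (mpo γ n) ^ 2 : ℝ) := by
  rw [chargeZ_eq, tracial_I_smul_sub_mul_self (tracial_mpo_mul_self γ n)]

theorem tracial_chargeDensity_mul_self (γ : ℝ) (d : ℕ) :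
    tracial (chargeDensity γ (d + 1) * chargeDensity γ (d + 1)) = (hs (mpoHit γ d 1) ^ 2 : ℝ) := by
  rw [chargeDensity, tracial_I_smul_sub_mul_self, zDensity, hs_site_sigmaPlus_sq]
  · push_cast
    ring
  · rw [zDensity, site_mul, sigmaPlus_mul_sigmaPlus, site_zero_left, tracial_zero]

theorem hs_chargeDensity_sq (γ : ℝ) (d : ℕ) :
    hs (chargeDensity γ (d + 1)) ^ 2 = hs (mpoHit γ d 1) ^ 2 := by
  rw [hs_sq, chargeDensity_isHermitian, tracial_chargeDensity_mul_self, Complex.ofReal_re]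

/-- The angle `γ` is a multiple of `π / m` with exact denominator `m`. -/
structure IsResonantAngle (γ : ℝ) (m : ℕ) : Prop where
  two_le : 2 ≤ m
  sin_mul : Real.sin (m * γ) = 0
  sin_ne : ∀ k, 0 < k → k < m → Real.sin (k * γ) ≠ 0

/-- A strict supersolution of the norm recursion. -/
noncomputable def superSolution (γ : ℝ) (m k : ℕ) : ℝ :=
  k * ((m : ℝ) - k) / Real.sin (k * γ) ^ 2

theorem superSolution_zero (γ : ℝ) (m : ℕ) : superSolution γ m 0 = 0 := by simp [superSolution]

theorem superSolution_self (γ : ℝ) (m : ℕ) : superSolution γ m m = 0 := by simp [superSolution]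

theorem IsResonantAngle.sin_sq_mul_div {γ : ℝ} {m : ℕ} (h : IsResonantAngle γ m) {k : ℕ}
    (hk0 : 0 < k) (hk : k ≤ m) (c : ℝ) :
    Real.sin (k * γ) ^ 2 * (c * ((m : ℝ) - k) / Real.sin (k * γ) ^ 2) = c * ((m : ℝ) - k) := by
  rcases hk.lt_or_eq with hk | rfl
  · exact mul_div_cancel₀ _ (pow_ne_zero 2 (h.sin_ne k hk0 hk))
  · simp

/-- In terms of `sin² w` the norm recursion is a discrete Laplacian. -/
theorem normStep_eq (γ : ℝ) (w : ℕ → ℝ) {k : ℕ} (hk : k ≠ 0) :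
    normStep γ w k = w k + 1 / 2 * (Real.sin ((k + 1 : ℕ) * γ) ^ 2 * w (k + 1) -
      2 * (Real.sin (k * γ) ^ 2 * w k) +
        if k = 1 then w 0 else Real.sin ((k - 1 : ℕ) * γ) ^ 2 * w (k - 1)) := by
  have h1 := Real.cos_sq' (k * γ)
  unfold normStep raising lowering
  rw [h1, if_neg hk, if_neg hk]
  by_cases hk1 : k = 1
  · subst hk1
    simp only [if_pos]
    ring_nf
  · rw [if_neg hk1, if_neg (by omega)]
    ring

/-- Times `sin²` the supersolution is the parabola `k(m - k)`, whose second difference is `-2`. -/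
theorem superSolution_step {γ : ℝ} {m : ℕ} (h : IsResonantAngle γ m) {k : ℕ} (hk0 : 0 < k)
    (hk : k < m) : normStep γ (superSolution γ m) k = superSolution γ m k - 1 := by
  rw [normStep_eq γ _ hk0.ne']
  have h1 := h.sin_sq_mul_div (k := k + 1) (by omega) (by omega) (k + 1 : ℕ)
  have h2 := h.sin_sq_mul_div hk0 hk.le k
  have h3 : (if k = 1 then superSolution γ m 0 else
      Real.sin ((k - 1 : ℕ) * γ) ^ 2 * superSolution γ m (k - 1)) = ((k : ℝ) - 1) * (m - (k - 1)) := by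
    by_cases hk1 : k = 1
    · simp [hk1, superSolution]
    · rw [if_neg hk1, superSolution, h.sin_sq_mul_div (by omega) (by omega), Nat.cast_sub hk0]
      simp
  rw [h3]
  change _ + 1 / 2 * (Real.sin ((k + 1 : ℕ) * γ) ^ 2 * superSolution γ m (k + 1) -
    2 * (Real.sin (k * γ) ^ 2 * superSolution γ m k) + _) = _
  unfold superSolution
  rw [h1, h2]
  push_cast
  ring

theorem one_le_superSolution {γ : ℝ} {m : ℕ} (h : IsResonantAngle γ m) {k : ℕ} (hk0 : 0 < k)
    (hk : k < m) : 1 ≤ superSolution γ m k := by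
  have h1 : 0 < Real.sin (k * γ) ^ 2 := by
    have := h.sin_ne k hk0 hk
    positivity
  rw [superSolution, le_div_iff₀ h1, one_mul]
  have h2 : (1 : ℝ) ≤ k := by exact_mod_cast hk0
  have h3 : (k : ℝ) + 1 ≤ m := by exact_mod_cast hk
  nlinarith [Real.sin_sq_le_one (k * γ)]

theorem superSolution_nonneg {γ : ℝ} {m : ℕ} (h : IsResonantAngle γ m) {k : ℕ} (hk : k < m) :
    0 ≤ superSolution γ m k := by
  rcases Nat.eq_zero_or_pos k with rfl | hk0
  · rw [superSolution_zero]
  · linarith [one_le_superSolution h hk0 hk]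

/-- The step has nonnegative coefficients, and the one leading from `m - 1` to `m` vanishes at
resonance, so nothing need be known of `t` at `m`. -/
theorem abs_normStep_le {γ : ℝ} {m : ℕ} (h : IsResonantAngle γ m) {t v : ℕ → ℝ}
    (htv : ∀ k < m, |t k| ≤ v k) {k : ℕ} (hk0 : 0 < k) (hk : k < m) (hv : v m = 0) :
    |normStep γ t k| ≤ normStep γ v k := by
  unfold normStep
  rw [if_neg hk0.ne', if_neg hk0.ne']
  have h1 : |1 / 2 * raising γ k ^ 2 * t (k + 1)| ≤ 1 / 2 * raising γ k ^ 2 * v (k + 1) := by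
    rcases Nat.lt_or_ge (k + 1) m with hkm | hkm
    · rw [abs_mul, abs_of_nonneg (by positivity)]
      exact mul_le_mul_of_nonneg_left (htv _ hkm) (by positivity)
    · obtain rfl : k + 1 = m := by omega
      rw [raising, if_neg hk0.ne', h.sin_mul]
      simp
  have h2 : ∀ c : ℝ, 0 ≤ c → ∀ i < m, |c * t i| ≤ c * v i := fun c hc i hi => by
    rw [abs_mul, abs_of_nonneg hc]
    exact mul_le_mul_of_nonneg_left (htv _ hi) hc
  exact (abs_add_three _ _ _).trans (add_le_add (add_le_add (h2 _ (sq_nonneg _) k hk) h1)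
    (h2 _ (by positivity) _ (by omega)))

theorem normStep_smul (γ c : ℝ) (t : ℕ → ℝ) (k : ℕ) :
    normStep γ (fun k => c * t k) k = c * normStep γ t k := by
  unfold normStep
  split_ifs <;> ring

theorem normStep_sub (γ : ℝ) (t t' : ℕ → ℝ) (k : ℕ) :
    normStep γ (fun k => t k - t' k) k = normStep γ t k - normStep γ t' k := by
  unfold normStep
  split_ifs <;> ring

/-- Geometric decay of the iterates of the norm recursion without source. -/
theorem exists_normStep_decay {γ : ℝ} {m : ℕ} (h : IsResonantAngle γ m) :
    ∃ ρ, 0 < ρ ∧ ρ < 1 ∧ ∀ f : ℕ → ℕ → ℝ, (∀ n, f n 0 = 0) →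
      (∀ n k, 0 < k → k < m → f (n + 1) k = normStep γ (f n) k) →
      (∀ k, k < m → |f 0 k| ≤ superSolution γ m k) →
      ∀ n k, k < m → |f n k| ≤ ρ ^ n * superSolution γ m k := by
  -- If `V` bounds the supersolution `v` then `v - 1 ≤ (1 - 1/V) v`; `V ≥ 2` keeps this rate
  -- positive.
  obtain ⟨V, hV2, hV⟩ : ∃ V : ℝ, 2 ≤ V ∧ ∀ k, k < m → superSolution γ m k ≤ V := by
    refine ⟨2 + ∑ k ∈ Finset.range m, superSolution γ m k, ?_, fun k hk => ?_⟩
    · linarith [Finset.sum_nonneg fun k hk => superSolution_nonneg h (Finset.mem_range.1 hk)]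
    · have := Finset.single_le_sum (f := superSolution γ m)
        (fun k hk => superSolution_nonneg h (Finset.mem_range.1 hk)) (Finset.mem_range.2 hk)
      linarith
  have hV1 : V⁻¹ ≤ 1 / 2 := by
    rw [one_div]
    exact inv_anti₀ two_pos hV2
  have hV0 : 0 < V⁻¹ := inv_pos.2 (by linarith)
  refine ⟨1 - V⁻¹, by linarith, by linarith, fun f hf0 hf hf1 n => ?_⟩
  induction n with
  | zero => simpa using hf1
  | succ n ih =>
    intro k hk
    rcases Nat.eq_zero_or_pos k with rfl | hk0
    · simp [hf0, superSolution_zero]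
    · rw [hf n k hk0 hk]
      have hρ : 0 < (1 - V⁻¹) ^ n := pow_pos (by linarith) n
      refine (abs_normStep_le h ih hk0 hk (by rw [superSolution_self, mul_zero])).trans ?_
      rw [normStep_smul, superSolution_step h hk0 hk, pow_succ, mul_assoc]
      refine mul_le_mul_of_nonneg_left ?_ hρ.le
      have h1 : V⁻¹ * superSolution γ m k ≤ V⁻¹ * V := mul_le_mul_of_nonneg_left (hV k hk) hV0.le
      rw [inv_mul_cancel₀ (by linarith)] at h1
      linarith

theorem exists_mpoHit_decay {γ : ℝ} {m : ℕ} (h : IsResonantAngle γ m) :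
    ∃ V ρ, 0 < V ∧ 0 < ρ ∧ ρ < 1 ∧ ∀ d, hs (mpoHit γ (d + 1) 1) ^ 2 ≤ V * ρ ^ d := by
  obtain ⟨ρ, hρ0, hρ1, hρ⟩ := exists_normStep_decay h
  have hm := h.two_le
  refine ⟨superSolution γ m 1, ρ, by linarith [one_le_superSolution h one_pos (by omega)], hρ0, hρ1,
    fun d => ?_⟩
  -- The recursion starts at length one, because at length zero the value at `|R⟩` is `1` rather
  -- than `0`.
  have h1 := hρ (fun n k => hs (mpoHit γ (n + 1) k) ^ 2) (fun n => by simp [mpoHit, hs_zero])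
    (fun n k hk0 hk => by
      rw [← hs_sq_auxStep]
      conv_lhs => rw [mpoHit, if_neg hk0.ne'])
    (fun k hk => by
      rcases Nat.eq_zero_or_pos k with rfl | hk0
      · simp [mpoHit, hs_zero, superSolution_zero]
      · rw [abs_of_nonneg (sq_nonneg _), mpoHit, if_neg hk0.ne', hs_sq_auxStep]
        refine le_trans ?_ (one_le_superSolution h hk0 hk)
        rw [normStep, if_neg hk0.ne']
        by_cases hk1 : k = 1
        · simp [hk1, mpoHit, hs_zero, hs_one, lowering]
          norm_num
        · have hk2 : k - 1 ≠ 0 := by omega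
          simp [mpoHit, hk0.ne', hk2, hs_zero]) d 1 (by omega)
  rw [abs_of_nonneg (sq_nonneg _)] at h1
  linarith

/-- The charge is pseudo-local. -/
theorem isPseudoLocal_chargeZ {γ : ℝ} {m : ℕ} (h : IsResonantAngle γ m) :
    IsPseudoLocal (chargeZ (Real.cos γ)) := by
  obtain ⟨V, ρ, hV, hρ0, hρ1, hdec⟩ := exists_mpoHit_decay h
  -- A density on `d + 2` sites is bounded by `V ρ^d`, whence the division by `ρ²`.
  refine ⟨chargeDensity γ, V / ρ ^ 2, -Real.log ρ, by positivity,
    neg_pos.2 (Real.log_neg hρ0 hρ1), fun d hd => ⟨chargeDensity_isHermitian γ d,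
      tracial_chargeDensity γ d, ?_⟩, sum_Icc_eq_familySum_order γ⟩
  have hexp : Real.exp (- -Real.log ρ * d) = ρ ^ d := by
    rw [neg_neg, mul_comm, Real.exp_nat_mul, Real.exp_log hρ0]
  rw [hexp]
  obtain ⟨d, rfl⟩ : ∃ e, d = e + 1 := ⟨d - 1, by omega⟩
  rw [tracial_chargeDensity_mul_self, Complex.ofReal_re]
  rcases d with _ | d
  · rw [show mpoHit γ 0 1 = 0 from rfl, hs_zero, zero_pow two_ne_zero]
    positivity
  · refine (hdec d).trans (le_of_eq ?_)
    field_simp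
    ring

theorem exists_isOddFamily_chargeDensity {γ : ℝ} {m : ℕ} (h : IsResonantAngle γ m) :
    ∃ C r, 0 ≤ C ∧ 0 < r ∧ r < 1 ∧ IsOddFamily (chargeDensity γ) C r := by
  obtain ⟨V, ρ, hV, hρ0, hρ1, hdec⟩ := exists_mpoHit_decay h
  have hr : Real.sqrt ρ ≠ 0 := (Real.sqrt_pos.2 hρ0).ne'
  refine ⟨Real.sqrt V / Real.sqrt ρ, Real.sqrt ρ, by positivity, Real.sqrt_pos.2 hρ0, ?_,
    chargeDensity_transpose γ, fun e => ?_⟩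
  · rw [Real.sqrt_lt' one_pos, one_pow]
    exact hρ1
  · refine abs_le_of_sq_le_sq' ?_ (by positivity) |>.2
    rw [hs_chargeDensity_sq]
    refine (hdec e).trans (le_of_eq ?_)
    rw [pow_succ' (Real.sqrt ρ), ← mul_assoc, div_mul_cancel₀ _ hr, mul_pow, ← pow_mul,
      mul_comm e 2, pow_mul, Real.sq_sqrt hV.le, Real.sq_sqrt hρ0.le]

/-- The stationary solution of the norm recursion. -/
noncomputable def stationary (γ : ℝ) (m k : ℕ) : ℝ :=
  if k = 0 then 1 else (m : ℝ)⁻¹ * ((m : ℝ) - k) / Real.sin (k * γ) ^ 2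

/-- Times `sin²` the profile is linear, from `1` at `|R⟩` to `0` at the wall, so its Laplacian
vanishes. -/
theorem stationary_step {γ : ℝ} {m : ℕ} (h : IsResonantAngle γ m) {k : ℕ} (hk0 : 0 < k)
    (hk : k < m) : normStep γ (stationary γ m) k = stationary γ m k := by
  have hm : (m : ℝ) ≠ 0 := by exact_mod_cast (by omega : m ≠ 0)
  rw [normStep_eq γ _ hk0.ne']
  have h3 : (if k = 1 then stationary γ m 0 else
      Real.sin ((k - 1 : ℕ) * γ) ^ 2 * stationary γ m (k - 1)) = (m : ℝ)⁻¹ * (m - (k - 1)) := by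
    by_cases hk1 : k = 1
    · simp [hk1, stationary, hm]
    · rw [if_neg hk1, stationary, if_neg (by omega), h.sin_sq_mul_div (by omega) (by omega),
        Nat.cast_sub hk0]
      simp
  rw [h3]
  have h1 : Real.sin ((k + 1 : ℕ) * γ) ^ 2 * stationary γ m (k + 1) =
      (m : ℝ)⁻¹ * (m - (k + 1 : ℕ)) := by
    rw [stationary, if_neg (by omega), h.sin_sq_mul_div (by omega) (by omega)]
  have h2 : Real.sin (k * γ) ^ 2 * stationary γ m k = (m : ℝ)⁻¹ * (m - k) := by
    rw [stationary, if_neg hk0.ne', h.sin_sq_mul_div hk0 hk.le]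
  rw [h1, h2]
  push_cast
  ring

/-- The difference from the stationary profile vanishes at `|R⟩`, so it decays geometrically. -/
theorem tendsto_hs_mpoTail_sq {γ : ℝ} {m : ℕ} (h : IsResonantAngle γ m) :
    Tendsto (fun n => hs (mpoTail γ n 1) ^ 2) atTop (𝓝 (stationary γ m 1)) := by
  obtain ⟨ρ, hρ0, hρ1, hρ⟩ := exists_normStep_decay h
  have hm := h.two_le
  have h1 := fun n => hρ (fun n k => hs (mpoTail γ n k) ^ 2 - stationary γ m k)
    (fun n => by simp [mpoTail_zero_right, hs_one, stationary])
    (fun n k hk0 hk => by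
      rw [normStep_sub, ← hs_sq_auxStep, stationary_step h hk0 hk]
      rfl)
    (fun k hk => by
      rcases Nat.eq_zero_or_pos k with rfl | hk0
      · simp [mpoTail, hs_one, stationary, superSolution_zero]
      · have hkm : (0 : ℝ) < (m : ℝ) - k := sub_pos.2 (by exact_mod_cast hk)
        have hm0 : (0 : ℝ) < m := by exact_mod_cast (by omega : 0 < m)
        rw [mpoTail, if_neg hk0.ne', hs_zero, stationary, if_neg hk0.ne', superSolution,
          zero_pow two_ne_zero, zero_sub, abs_neg, abs_of_nonneg (by positivity)]
        have h2 : (m : ℝ)⁻¹ ≤ k := (inv_le_one_of_one_le₀ (by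
          exact_mod_cast (by omega : 1 ≤ m))).trans (by exact_mod_cast hk0)
        gcongr) n 1 (by omega)
  rw [tendsto_iff_norm_sub_tendsto_zero]
  refine squeeze_zero (fun n => norm_nonneg _) h1 ?_
  simpa using (tendsto_pow_atTop_nhds_zero_of_lt_one hρ0.le hρ1).mul_const (superSolution γ m 1)

theorem hs_mpo_sq_eq_sum (γ : ℝ) (n : ℕ) :
    hs (mpo γ n) ^ 2 = 1 / 2 * ∑ i ∈ Finset.range n, hs (mpoTail γ i 1) ^ 2 := by
  induction n with
  | zero => simp [mpo, hs_zero]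
  | succ n ih => rw [hs_mpo_succ, ih, Finset.sum_range_succ, mul_add]

theorem tendsto_hs_mpo_sq_div {γ : ℝ} {m : ℕ} (h : IsResonantAngle γ m) :
    Tendsto (fun n : ℕ => hs (mpo γ n) ^ 2 / n) atTop
      (𝓝 (((m : ℝ) - 1) / (2 * m * Real.sin γ ^ 2))) := by
  have h1 := ((tendsto_hs_mpoTail_sq h).cesaro).const_mul (1 / 2)
  have h2 : ((m : ℝ) - 1) / (2 * m * Real.sin γ ^ 2) = 1 / 2 * stationary γ m 1 := by
    rw [stationary, if_neg one_ne_zero, Nat.cast_one, one_mul, mul_comm (2 : ℝ), mul_assoc,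
      div_mul_eq_div_div, div_mul_eq_div_div]
    ring
  rw [h2]
  refine h1.congr fun n => ?_
  rw [hs_mpo_sq_eq_sum]
  ring

end Norms


/-! ### The transfer matrix as the norm recursion. -/

section Transfer

/-- The norm recursion on complex sequences, away from `k = 0`. -/
noncomputable def complexStep (γ : ℝ) (t : ℕ → ℂ) (k : ℕ) : ℂ :=
  (Real.cos (k * γ) ^ 2 : ℝ) * t k + (1 / 2 * raising γ k ^ 2 : ℝ) * t (k + 1) +
    (1 / 2 * lowering γ (k - 1) ^ 2 : ℝ) * t (k - 1)

theorem complexStep_ofReal (γ : ℝ) (t : ℕ → ℝ) {k : ℕ} (hk : k ≠ 0) :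
    complexStep γ (fun k => (t k : ℂ)) k = (normStep γ t k : ℝ) := by
  rw [complexStep, normStep, if_neg hk]
  push_cast
  ring

theorem norm_complexStep_le (γ : ℝ) (t : ℕ → ℂ) {k : ℕ} (hk : k ≠ 0) :
    ‖complexStep γ t k‖ ≤ normStep γ (fun k => ‖t k‖) k := by
  have h : ∀ (c : ℝ) (z : ℂ), 0 ≤ c → ‖(c : ℂ) * z‖ = c * ‖z‖ := fun c z hc => by
    rw [norm_mul, Complex.norm_real, Real.norm_of_nonneg hc]
  rw [complexStep, normStep, if_neg hk]
  refine norm_add₃_le.trans (le_of_eq ?_)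
  rw [h _ _ (by positivity), h _ _ (by positivity), h _ _ (by positivity)]

/-- The sequence `sin² t`, with the value of `t` kept at `0`. -/
noncomputable def scaled (γ : ℝ) (t : ℕ → ℂ) (k : ℕ) : ℂ :=
  if k = 0 then t 0 else (Real.sin (k * γ) ^ 2 : ℝ) * t k

theorem complexStep_succ (γ : ℝ) (t : ℕ → ℂ) (k : ℕ) :
    complexStep γ t (k + 1) = t (k + 1) + 1 / 2 * (scaled γ t (k + 2) - 2 * scaled γ t (k + 1) +
      scaled γ t k) := by
  have h1 := Real.cos_sq' ((k + 1 : ℕ) * γ)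
  rw [complexStep, h1, raising, if_neg k.succ_ne_zero, lowering, Nat.add_sub_cancel]
  unfold scaled
  rw [if_neg k.succ_ne_zero, if_neg (k + 1).succ_ne_zero]
  by_cases hk : k = 0
  · subst hk
    simp only [if_pos]
    push_cast
    ring
  · rw [if_neg hk, if_neg hk]
    push_cast
    ring_nf

theorem complexStep_congr {γ : ℝ} {m : ℕ} (h : IsResonantAngle γ m) {t t' : ℕ → ℂ}
    (ht : ∀ k < m, t k = t' k) {k : ℕ} (hk0 : k ≠ 0) (hk : k < m) :
    complexStep γ t k = complexStep γ t' k := by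
  unfold complexStep
  rw [ht k hk, ht (k - 1) (by omega)]
  rcases Nat.lt_or_ge (k + 1) m with hkm | hkm
  · rw [ht _ hkm]
  · obtain rfl : k + 1 = m := by omega
    rw [raising, if_neg hk0, h.sin_mul]
    simp

/-- The components of `v` along `|R⟩, |1⟩, …, |m - 1⟩`, as a sequence. -/
noncomputable def tailSeq {m : ℕ} (v : Aux m → ℂ) (k : ℕ) : ℂ :=
  if k = 0 then v (.inl 1) else if h : k - 1 < m - 1 then v (.inr ⟨k - 1, h⟩) else 0

theorem tailSeq_succ {m : ℕ} (v : Aux m → ℂ) (k : Fin (m - 1)) :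
    tailSeq v (k + 1) = v (.inr k) := by
  simp [tailSeq]

theorem sum_fin_ite_eq {N : ℕ} (j : ℕ) (f : Fin N → ℂ) :
    ∑ k, (if k.val = j then f k else 0) = if h : j < N then f ⟨j, h⟩ else 0 := by
  split_ifs with h
  · rw [Finset.sum_eq_single ⟨j, h⟩]
    · simp
    · intro k _ hk
      rw [if_neg fun h' => hk (Fin.ext h')]
    · simp
  · refine Finset.sum_eq_zero fun k _ => if_neg ?_
    have := k.2
    omega

theorem transfer_apply (γ : ℝ) (m : ℕ) (i j : Aux m) : transfer γ m i j =
    auxZ0 γ m i j * star (auxZ0 γ m i j) + 1 / 2 * (auxZPlus γ m i j * star (auxZPlus γ m i j) +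
      auxZMinus γ m i j * star (auxZMinus γ m i j)) := rfl

theorem ite_ofReal_mul_star (p : Prop) [Decidable p] (x : ℝ) :
    (if p then (x : ℂ) else 0) * star (if p then (x : ℂ) else 0) =
      if p then ((x ^ 2 : ℝ) : ℂ) else 0 := by
  split_ifs
  · rw [Complex.star_def, Complex.conj_ofReal, ← Complex.ofReal_mul, sq]
  · simp

theorem transfer_middle_middle (γ : ℝ) {m : ℕ} (k k' : Fin (m - 1)) :
    transfer γ m (.inr k) (.inr k') =
      (if k'.val = k.val then ((Real.cos ((k.val + 1 : ℕ) * γ) ^ 2 : ℝ) : ℂ) else 0) +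
      1 / 2 * ((if k'.val = k.val + 1 then ((Real.sin ((k.val + 2 : ℕ) * γ) ^ 2 : ℝ) : ℂ) else 0) +
        if k.val = k'.val + 1 then ((Real.sin (k * γ) ^ 2 : ℝ) : ℂ) else 0) := by
  have h1 := ite_ofReal_mul_star (k = k') (Real.cos (γ * (k.val + 1)))
  have h2 := ite_ofReal_mul_star (k'.val = k.val + 1) (Real.sin (γ * (k.val + 2)))
  have h3 := ite_ofReal_mul_star (k.val = k'.val + 1) (-Real.sin (γ * (k'.val + 1)))
  rw [transfer_apply]
  simp only [auxZ0, auxZPlus, auxZMinus, Matrix.of_apply, Complex.ofReal_neg] at h1 h2 h3 ⊢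
  rw [h1, h2, h3]
  congr 1
  · simp only [Fin.ext_iff, eq_comm, mul_comm γ, Nat.cast_add, Nat.cast_one]
  · congr 2
    · simp only [mul_comm γ, Nat.cast_add, Nat.cast_ofNat]
    · split_ifs with h
      · rw [h, neg_sq, mul_comm γ, Nat.cast_add, Nat.cast_one]
      · rfl

theorem transfer_mulVec_left (γ : ℝ) {m : ℕ} (hm : 2 ≤ m) (v : Aux m → ℂ) :
    (transfer γ m).mulVec v (.inl 0) = v (.inl 0) + 1 / 2 * tailSeq v 1 := by
  have h1 : ∀ k : Fin (m - 1), transfer γ m (.inl 0) (.inr k) * v (.inr k) =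
      if k.val = 0 then 1 / 2 * v (.inr k) else 0 := fun k => by
    rw [transfer_apply]
    by_cases hk : k.val = 0 <;> simp [auxZ0, auxZPlus, auxZMinus, hk]
  have h2 : tailSeq v 1 = v (.inr ⟨0, by omega⟩) := tailSeq_succ v ⟨0, by omega⟩
  rw [Matrix.mulVec, dotProduct, Fintype.sum_sum_type, Fin.sum_univ_two,
    Finset.sum_congr rfl fun k _ => h1 k, sum_fin_ite_eq, dif_pos (by omega : 0 < m - 1), h2]
  simp [transfer_apply, auxZ0, auxZPlus, auxZMinus]

theorem transfer_mulVec_right (γ : ℝ) {m : ℕ} (v : Aux m → ℂ) :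
    (transfer γ m).mulVec v (.inl 1) = v (.inl 1) := by
  rw [Matrix.mulVec, dotProduct, Fintype.sum_sum_type, Fin.sum_univ_two]
  simp [transfer_apply, auxZ0, auxZPlus, auxZMinus]

theorem transfer_mulVec_middle (γ : ℝ) {m : ℕ} (v : Aux m → ℂ) (k : Fin (m - 1)) :
    (transfer γ m).mulVec v (.inr k) = complexStep γ (tailSeq v) (k + 1) := by
  have h1 : ∀ k' : Fin (m - 1), transfer γ m (.inr k) (.inr k') * v (.inr k') =
      (if k'.val = k.val then (Real.cos ((k.val + 1 : ℕ) * γ) ^ 2 : ℝ) * v (.inr k') else 0) +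
      (if k'.val = k.val + 1 then (1 / 2 * Real.sin ((k.val + 2 : ℕ) * γ) ^ 2 : ℝ) * v (.inr k')
        else 0) + if k'.val = k.val - 1 then
          if k.val = 0 then 0 else (1 / 2 * Real.sin (k * γ) ^ 2 : ℝ) * v (.inr k') else 0 := by
    intro k'
    rw [transfer_middle_middle]
    have h : (if k.val = k'.val + 1 then ((Real.sin (k * γ) ^ 2 : ℝ) : ℂ) else 0) =
        if k'.val = k.val - 1 then if k.val = 0 then 0 else ((Real.sin (k * γ) ^ 2 : ℝ) : ℂ)
          else 0 := by
      split_ifs <;> first | rfl | omega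
    rw [h]
    split_ifs <;> push_cast <;> ring1
  have h2 : transfer γ m (.inr k) (.inl 0) = 0 := by
    simp [transfer_apply, auxZ0, auxZPlus, auxZMinus]
  have h3 : transfer γ m (.inr k) (.inl 1) = if k.val = 0 then 1 / 2 else 0 := by
    by_cases hk : k.val = 0 <;> simp [transfer_apply, auxZ0, auxZPlus, auxZMinus, hk]
  have h4 : tailSeq v (k.val + 1 + 1) =
      if h : k.val + 1 < m - 1 then v (.inr ⟨k.val + 1, h⟩) else 0 := by
    simp [tailSeq]
  have h5 : k.val - 1 < m - 1 := by omega
  rw [Matrix.mulVec, dotProduct, Fintype.sum_sum_type, Fin.sum_univ_two,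
    Finset.sum_congr rfl fun k _ => h1 k, Finset.sum_add_distrib, Finset.sum_add_distrib,
    sum_fin_ite_eq, sum_fin_ite_eq, sum_fin_ite_eq, dif_pos k.2, dif_pos h5, complexStep,
    raising, if_neg k.val.succ_ne_zero, lowering, Nat.add_sub_cancel, tailSeq_succ, h2, h3, h4,
    tailSeq, dif_pos h5, show k.val + 1 + 1 = k.val + 2 from rfl]
  by_cases hN : k.val + 1 < m - 1
  · simp only [dif_pos hN]
    split_ifs <;> push_cast <;> ring1
  · simp only [dif_neg hN]
    split_ifs <;> push_cast <;> ring1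

/-- The image of `|R⟩` under the powers of the transfer matrix. -/
noncomputable def transferOrbit (γ : ℝ) (m n : ℕ) : Aux m → ℂ :=
  Sum.elim (fun i => if i = 0 then ((hs (mpo γ n) ^ 2 : ℝ) : ℂ) else 1)
    fun k => ((hs (mpoTail γ n (k.val + 1)) ^ 2 : ℝ) : ℂ)

/-- Each application of the transfer matrix prepends one site, and the components record the squared
norms of the operators from each auxiliary state to `|R⟩`. -/
theorem transfer_pow_mulVec {γ : ℝ} {m : ℕ} (h : IsResonantAngle γ m) (n : ℕ) :
    (transfer γ m ^ n).mulVec (Pi.single (.inl 1) 1) =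
      transferOrbit γ m n := by
  induction n with
  | zero =>
    rw [pow_zero, Matrix.one_mulVec]
    ext i
    rcases i with i | k
    · fin_cases i <;> simp [transferOrbit, mpo, hs_zero]
    · simp [transferOrbit, mpoTail, hs_zero]
  | succ n ih =>
    rw [pow_succ', ← Matrix.mulVec_mulVec, ih]
    have ht : ∀ k < m, tailSeq (transferOrbit γ m n) k = ((hs (mpoTail γ n k) ^ 2 : ℝ) : ℂ) := by
      intro k hk
      rcases k with _ | k
      · simp [tailSeq, transferOrbit, mpoTail_zero_right, hs_one]
      · exact tailSeq_succ (transferOrbit γ m n) ⟨k, by omega⟩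
    have hm := h.two_le
    ext i
    rcases i with i | k
    · fin_cases i
      · change (transfer γ m).mulVec (transferOrbit γ m n) (.inl 0) = _
        rw [transfer_mulVec_left γ hm, ht 1 (by omega)]
        simp [transferOrbit, hs_mpo_succ]
      · change (transfer γ m).mulVec (transferOrbit γ m n) (.inl 1) = _
        rw [transfer_mulVec_right]
        simp [transferOrbit]
    · have hk := k.2
      rw [transfer_mulVec_middle, complexStep_congr h ht (Nat.succ_ne_zero _) (by omega),
        complexStep_ofReal _ _ (Nat.succ_ne_zero _), ← hs_sq_auxStep]
      rfl

theorem transfer_pow_apply {γ : ℝ} {m : ℕ} (h : IsResonantAngle γ m) (n : ℕ) :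
    (transfer γ m ^ n) (.inl 0) (.inl 1) = ((hs (mpo γ n) ^ 2 : ℝ) : ℂ) := by
  have h1 := congrFun (transfer_pow_mulVec h n) (Sum.inl 0)
  rw [Matrix.mulVec_single_one] at h1
  simpa [transferOrbit] using h1

end Transfer


/-! ### Jordan structure of the transfer matrix. -/

section Jordan

theorem complexStep_conj (γ : ℝ) (t : ℕ → ℂ) (k : ℕ) :
    complexStep γ (fun k => (starRingEnd ℂ) (t k)) k = (starRingEnd ℂ) (complexStep γ t k) := by
  simp only [complexStep, map_add, map_mul, Complex.conj_ofReal]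

theorem IsResonantAngle.sin_sq_pos {γ : ℝ} {m : ℕ} (h : IsResonantAngle γ m) {k : ℕ} (hk0 : 0 < k)
    (hk : k < m) : 0 < Real.sin (k * γ) ^ 2 := by
  have := h.sin_ne k hk0 hk
  positivity

theorem scaled_self {γ : ℝ} {m : ℕ} (h : IsResonantAngle γ m) (t : ℕ → ℂ) : scaled γ t m = 0 := by
  have := h.two_le
  rw [scaled, if_neg (by omega), h.sin_mul]
  simp

theorem eq_zero_of_scaled_eq_zero {γ : ℝ} {m : ℕ} (h : IsResonantAngle γ m) {t : ℕ → ℂ} {k : ℕ}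
    (hk0 : 0 < k) (hk : k < m) (ht : scaled γ t k = 0) : t k = 0 := by
  rw [scaled, if_neg hk0.ne'] at ht
  exact (mul_eq_zero.1 ht).resolve_left (by exact_mod_cast (h.sin_sq_pos hk0 hk).ne')

/-- Fixed points of the norm recursion without source vanish. -/
theorem eq_zero_of_complexStep_eq {γ : ℝ} {m : ℕ} (h : IsResonantAngle γ m) {t : ℕ → ℂ}
    (h0 : t 0 = 0) (ht : ∀ k, k + 1 < m → complexStep γ t (k + 1) = t (k + 1)) {k : ℕ}
    (hk : k < m) : t k = 0 := by
  have hm := h.two_le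
  -- Vanishing second differences and the zero at `0` make the scaled sequence linear; the zero at
  -- `m` then makes it vanish.
  have h1 : ∀ k, k ≤ m → scaled γ t k = k * scaled γ t 1 := by
    intro k
    induction k using Nat.strong_induction_on with
    | _ k ih =>
      intro hk
      rcases k with _ | _ | k
      · simp [scaled, h0]
      · simp
      · have h2 := ht k (by omega)
        rw [complexStep_succ] at h2
        have h3 := ih k (by omega) (by omega)
        have h4 := ih (k + 1) (by omega) (by omega)
        push_cast at h4 ⊢
        linear_combination 2 * h2 - h3 + 2 * h4
  have h2 : scaled γ t 1 = 0 := by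
    have h3 := h1 m le_rfl
    rw [scaled_self h] at h3
    exact (mul_eq_zero.1 h3.symm).resolve_left (by exact_mod_cast (by omega : m ≠ 0))
  rcases Nat.eq_zero_or_pos k with rfl | hk0
  · exact h0
  · exact eq_zero_of_scaled_eq_zero h hk0 hk (by rw [h1 k hk.le, h2, mul_zero])

/-- Discrete Green's identity. -/
theorem sum_mul_laplacian_sub (u w : ℕ → ℂ) (N : ℕ) :
    ∑ k ∈ Finset.range N, (u (k + 1) * (w (k + 2) - 2 * w (k + 1) + w k) -
      w (k + 1) * (u (k + 2) - 2 * u (k + 1) + u k)) =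
      u N * w (N + 1) - w N * u (N + 1) - (u 0 * w 1 - w 0 * u 1) := by
  induction N with
  | zero => simp
  | succ N ih =>
    rw [Finset.sum_range_succ, ih]
    ring

/-- The norm recursion is symmetric with respect to the weights `sin²(k γ)`. -/
theorem sum_complexStep_symm {γ : ℝ} {m : ℕ} (h : IsResonantAngle γ m) {t t' : ℕ → ℂ}
    (h0 : t 0 = 0) (h0' : t' 0 = 0) :
    ∑ k ∈ Finset.range (m - 1), ((Real.sin ((k + 1 : ℕ) * γ) ^ 2 : ℝ) : ℂ) *
      (t (k + 1) * complexStep γ t' (k + 1) - t' (k + 1) * complexStep γ t (k + 1)) = 0 := by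
  have hm := h.two_le
  have h1 := sum_mul_laplacian_sub (scaled γ t) (scaled γ t') (m - 1)
  have hz : ∀ t : ℕ → ℂ, t 0 = 0 → scaled γ t 0 = 0 := fun t ht => ht
  rw [show m - 1 + 1 = m by omega, scaled_self h, scaled_self h, hz t h0, hz t' h0'] at h1
  have h2 : ∀ k, ((Real.sin ((k + 1 : ℕ) * γ) ^ 2 : ℝ) : ℂ) *
      (t (k + 1) * complexStep γ t' (k + 1) - t' (k + 1) * complexStep γ t (k + 1)) =
      1 / 2 * (scaled γ t (k + 1) * (scaled γ t' (k + 2) - 2 * scaled γ t' (k + 1) + scaled γ t' k) -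
      scaled γ t' (k + 1) * (scaled γ t (k + 2) - 2 * scaled γ t (k + 1) + scaled γ t k)) := by
    intro k
    have h3 : ∀ t : ℕ → ℂ, scaled γ t (k + 1) =
        ((Real.sin ((k + 1 : ℕ) * γ) ^ 2 : ℝ) : ℂ) * t (k + 1) := fun t => if_neg k.succ_ne_zero
    rw [complexStep_succ, complexStep_succ, h3, h3]
    ring
  rw [Finset.sum_congr rfl fun k _ => h2 k, ← Finset.mul_sum, h1]
  ring

/-- Generalized eigenvectors of the norm recursion are eigenvectors. -/
theorem eq_zero_of_complexStep_sub {γ : ℝ} {m : ℕ} (h : IsResonantAngle γ m) {t w : ℕ → ℂ} {μ : ℂ}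
    (ht0 : t 0 = 0) (hw0 : w 0 = 0)
    (ht : ∀ k, k + 1 < m → complexStep γ t (k + 1) = μ * t (k + 1) + w (k + 1))
    (hw : ∀ k, k + 1 < m → complexStep γ w (k + 1) = μ * w (k + 1)) {k : ℕ} (hk : k < m) :
    w k = 0 := by
  set s : ℕ → ℝ := fun k => Real.sin ((k + 1 : ℕ) * γ) ^ 2
  set S : ℝ := ∑ k ∈ Finset.range (m - 1), s k * ‖w (k + 1)‖ ^ 2 with hS
  have hc0 : (fun k => (starRingEnd ℂ) (w k)) 0 = 0 := by simp [hw0]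
  have hSc : (S : ℂ) = ∑ k ∈ Finset.range (m - 1),
      (s k : ℂ) * ((starRingEnd ℂ) (w (k + 1)) * w (k + 1)) := by
    rw [hS]
    push_cast
    refine Finset.sum_congr rfl fun k _ => ?_
    rw [← Complex.conj_mul']
  -- Pairing the conjugate of `w` with `w` gives `(μ - μ̄) S = 0`; pairing it with `t` expresses `S`
  -- as a multiple of `μ - μ̄`. Whether `μ` is real or not, `S` vanishes.
  have h1 : (μ - (starRingEnd ℂ) μ) * S = 0 := by
    rw [← sum_complexStep_symm h (t := fun k => (starRingEnd ℂ) (w k)) hc0 hw0, hSc, Finset.mul_sum]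
    refine Finset.sum_congr rfl fun k hk => ?_
    rw [Finset.mem_range] at hk
    rw [complexStep_conj, hw k (by omega), map_mul]
    ring
  have h2 : (S : ℂ) + (μ - (starRingEnd ℂ) μ) * ∑ k ∈ Finset.range (m - 1),
      (s k : ℂ) * ((starRingEnd ℂ) (w (k + 1)) * t (k + 1)) = 0 := by
    rw [← sum_complexStep_symm h (t := fun k => (starRingEnd ℂ) (w k)) hc0 ht0, hSc, Finset.mul_sum, ← Finset.sum_add_distrib]
    refine Finset.sum_congr rfl fun k hk => ?_
    rw [Finset.mem_range] at hk
    rw [complexStep_conj, hw k (by omega), ht k (by omega), map_mul]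
    ring
  have h3 : S = 0 := by
    rcases mul_eq_zero.1 h1 with h3 | h3
    · rw [h3, zero_mul, add_zero] at h2
      exact_mod_cast h2
    · exact_mod_cast h3
  rcases k with _ | k
  · exact hw0
  · have h4 := (Finset.sum_eq_zero_iff_of_nonneg fun k _ => by positivity).1 h3 k
      (Finset.mem_range.2 (by omega))
    have h5 := (mul_eq_zero.1 h4).resolve_left (h.sin_sq_pos k.succ_pos hk).ne'
    simpa using h5

/-- Eigenvalues of the norm recursion have modulus less than one. -/
theorem norm_lt_one_of_complexStep_eq {γ : ℝ} {m : ℕ} (h : IsResonantAngle γ m) {t : ℕ → ℂ} {μ : ℂ}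
    (h0 : t 0 = 0) (ht : ∀ k, k + 1 < m → complexStep γ t (k + 1) = μ * t (k + 1))
    {i : ℕ} (hi : i < m) (hti : t i ≠ 0) : ‖μ‖ < 1 := by
  have hi0 : 0 < i := Nat.pos_of_ne_zero fun hi => hti (hi ▸ h0)
  -- Maximum principle: where `|t|` relative to the supersolution is largest, the strict loss in the
  -- supersolution forces `‖μ‖ < 1`.
  obtain ⟨j, hj, hmax⟩ := (Finset.Ico 1 m).exists_max_image
    (fun k => ‖t k‖ / superSolution γ m k) ⟨i, Finset.mem_Ico.2 ⟨hi0, hi⟩⟩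
  rw [Finset.mem_Ico] at hj
  have hpos : ∀ k, 0 < k → k < m → 0 < superSolution γ m k := fun k hk0 hk =>
    one_pos.trans_le (one_le_superSolution h hk0 hk)
  set M := ‖t j‖ / superSolution γ m j with hM
  have hM0 : 0 < M := lt_of_lt_of_le (div_pos (norm_pos_iff.2 hti) (hpos i hi0 hi))
    (hmax i (Finset.mem_Ico.2 ⟨hi0, hi⟩))
  have hle : ∀ k < m, |‖t k‖| ≤ M * superSolution γ m k := by
    intro k hk
    rw [abs_norm]
    rcases Nat.eq_zero_or_pos k with rfl | hk0
    · simp [h0, superSolution_zero]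
    · exact (div_le_iff₀ (hpos k hk0 hk)).1 (hmax k (Finset.mem_Ico.2 ⟨hk0, hk⟩))
  have h1 := norm_complexStep_le γ t (k := j) (by omega)
  have h2 := abs_normStep_le h hle hj.1 hj.2 (by rw [superSolution_self, mul_zero])
  rw [normStep_smul, superSolution_step h hj.1 hj.2] at h2
  have h3 := ht (j - 1) (by omega)
  rw [Nat.sub_add_cancel hj.1] at h3
  have h4 : ‖t j‖ = M * superSolution γ m j := (div_mul_cancel₀ _ (hpos j hj.1 hj.2).ne').symm
  rw [h3, norm_mul] at h1
  have h5 : ‖μ‖ * ‖t j‖ < 1 * ‖t j‖ := by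
    have := (le_abs_self _).trans h2
    linarith
  exact lt_of_mul_lt_mul_right h5 (norm_nonneg _)

theorem ext_of_tailSeq {m : ℕ} {v w : Aux m → ℂ} (hL : v (.inl 0) = w (.inl 0))
    (ht : ∀ k < m, tailSeq v k = tailSeq w k) (hm : 2 ≤ m) : v = w := by
  ext i
  rcases i with i | k
  · fin_cases i
    · exact hL
    · exact ht 0 (by omega)
  · have hk := k.2
    rw [← tailSeq_succ v, ← tailSeq_succ w]
    exact ht _ (by omega)

theorem tailSeq_smul {m : ℕ} (c : ℂ) (v : Aux m → ℂ) (k : ℕ) :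
    tailSeq (c • v) k = c * tailSeq v k := by
  unfold tailSeq
  split_ifs <;> simp

theorem tailSeq_sub {m : ℕ} (v w : Aux m → ℂ) (k : ℕ) :
    tailSeq (v - w) k = tailSeq v k - tailSeq w k := by
  unfold tailSeq
  split_ifs <;> simp

theorem tailSeq_add {m : ℕ} (v w : Aux m → ℂ) (k : ℕ) :
    tailSeq (v + w) k = tailSeq v k + tailSeq w k := by
  unfold tailSeq
  split_ifs <;> simp

theorem tailSeq_mulVec_succ (γ : ℝ) {m : ℕ} (v : Aux m → ℂ) {k : ℕ} (hk : k + 1 < m) :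
    tailSeq ((transfer γ m).mulVec v) (k + 1) = complexStep γ (tailSeq v) (k + 1) := by
  have := tailSeq_succ ((transfer γ m).mulVec v) ⟨k, by omega⟩
  rw [transfer_mulVec_middle] at this
  exact this

theorem tailSeq_mulVec_zero (γ : ℝ) {m : ℕ} (v : Aux m → ℂ) :
    tailSeq ((transfer γ m).mulVec v) 0 = tailSeq v 0 := transfer_mulVec_right γ v

/-- The auxiliary vector `|L⟩`. -/
noncomputable def leftVec (m : ℕ) : Aux m → ℂ := Pi.single (.inl 0) 1

theorem tailSeq_leftVec (m k : ℕ) : tailSeq (leftVec m) k = 0 := by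
  unfold tailSeq leftVec
  split_ifs <;> simp

/-- The second vector of the Jordan chain of the transfer matrix. -/
noncomputable def jordanVec (γ : ℝ) (m : ℕ) : Aux m → ℂ :=
  Sum.elim (fun i => if i = 0 then 0 else 1) fun k => (stationary γ m (k.val + 1) : ℂ)

theorem tailSeq_jordanVec (γ : ℝ) {m k : ℕ} (hk : k < m) :
    tailSeq (jordanVec γ m) k = stationary γ m k := by
  rcases k with _ | k
  · simp [tailSeq, jordanVec, stationary]
  · exact tailSeq_succ (jordanVec γ m) ⟨k, by omega⟩

theorem transfer_mulVec_leftVec (γ : ℝ) {m : ℕ} (hm : 2 ≤ m) :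
    (transfer γ m).mulVec (leftVec m) = leftVec m := by
  refine ext_of_tailSeq ?_ (fun k hk => ?_) hm
  · rw [transfer_mulVec_left γ hm, tailSeq_leftVec, mul_zero, add_zero]
  · rcases k with _ | k
    · rw [tailSeq_mulVec_zero]
    · rw [tailSeq_mulVec_succ γ _ hk]
      simp [complexStep, tailSeq_leftVec]

theorem transfer_mulVec_jordanVec {γ : ℝ} {m : ℕ} (h : IsResonantAngle γ m) :
    (transfer γ m).mulVec (jordanVec γ m) =
      jordanVec γ m + (1 / 2 * stationary γ m 1 : ℂ) • leftVec m := by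
  have hm := h.two_le
  refine ext_of_tailSeq ?_ (fun k hk => ?_) hm
  · rw [transfer_mulVec_left γ hm, tailSeq_jordanVec γ (by omega)]
    simp [leftVec]
  · rw [tailSeq_add, tailSeq_smul, tailSeq_leftVec, mul_zero, add_zero]
    rcases k with _ | k
    · rw [tailSeq_mulVec_zero]
    · rw [tailSeq_mulVec_succ γ _ hk, complexStep_congr h (fun k hk => tailSeq_jordanVec γ hk)
        k.succ_ne_zero hk, complexStep_ofReal _ _ k.succ_ne_zero, stationary_step h k.succ_pos hk,
        tailSeq_jordanVec γ hk]

theorem stationary_one_ne_zero {γ : ℝ} {m : ℕ} (h : IsResonantAngle γ m) :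
    stationary γ m 1 ≠ 0 := by
  have hm := h.two_le
  have h1 : (0 : ℝ) < m - 1 := by
    rw [sub_pos]
    exact_mod_cast hm
  have h2 := h.sin_sq_pos one_pos (by omega)
  rw [stationary, if_neg one_ne_zero]
  have h3 : (0 : ℝ) < m := by linarith
  push_cast at h2 ⊢
  positivity

/-- A vector whose tail is fixed by the transfer matrix lies in the span of the Jordan chain. -/
theorem eq_add_of_tailSeq_mulVec_eq {γ : ℝ} {m : ℕ} (h : IsResonantAngle γ m) {v : Aux m → ℂ}
    (hv : ∀ k < m, tailSeq ((transfer γ m).mulVec v) k = tailSeq v k) :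
    v = v (.inl 0) • leftVec m + v (.inl 1) • jordanVec γ m := by
  have hm := h.two_le
  have h1 : ∀ k < m, tailSeq (v - v (.inl 1) • jordanVec γ m) k = 0 := fun k hk => by
    refine eq_zero_of_complexStep_eq h (t := tailSeq (v - v (.inl 1) • jordanVec γ m)) ?_
      (fun k hk => ?_) hk
    · simp [tailSeq, jordanVec]
    · rw [← tailSeq_mulVec_succ γ _ hk, Matrix.mulVec_sub, Matrix.mulVec_smul,
        transfer_mulVec_jordanVec h, tailSeq_sub, tailSeq_sub, hv _ hk, smul_add, smul_smul]
      congr 1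
      simp [tailSeq, leftVec]
  refine ext_of_tailSeq ?_ (fun k hk => ?_) hm
  · simp [leftVec, jordanVec]
  · have h2 := h1 k hk
    rw [tailSeq_sub, sub_eq_zero] at h2
    rw [h2, tailSeq_add, tailSeq_smul _ (leftVec m), tailSeq_leftVec, mul_zero, zero_add]

/-- The `|L⟩` row forces the component along `|1⟩` of a fixed vector to vanish. That component is
the `|R⟩` component times a nonzero number, so only `|L⟩` remains. -/
theorem eigenspace_transfer_one {γ : ℝ} {m : ℕ} (h : IsResonantAngle γ m) :
    Module.End.eigenspace (Matrix.toLin' (transfer γ m)) 1 = Submodule.span ℂ {leftVec m} := by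
  have hm := h.two_le
  ext v
  rw [Module.End.mem_eigenspace_iff, Matrix.toLin'_apply, one_smul, Submodule.mem_span_singleton]
  constructor
  · intro hv
    have h1 := eq_add_of_tailSeq_mulVec_eq h (v := v) fun k _ => by rw [hv]
    have h2 := transfer_mulVec_left γ hm v
    rw [hv, left_eq_add, mul_eq_zero] at h2
    have h3 : tailSeq v 1 = v (.inl 1) * stationary γ m 1 := by
      conv_lhs => rw [h1]
      rw [tailSeq_add, tailSeq_smul, tailSeq_smul, tailSeq_leftVec, tailSeq_jordanVec γ (by omega),
        mul_zero, zero_add]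
    have h4 : v (.inl 1) = 0 := by
      rw [h3] at h2
      simpa [stationary_one_ne_zero h] using h2
    exact ⟨v (.inl 0), by conv_rhs => rw [h1, h4, zero_smul, add_zero]⟩
  · rintro ⟨c, rfl⟩
    rw [Matrix.mulVec_smul, transfer_mulVec_leftVec γ hm]

theorem maxGenEigenspace_transfer_one {γ : ℝ} {m : ℕ} (h : IsResonantAngle γ m) :
    Module.End.maxGenEigenspace (Matrix.toLin' (transfer γ m)) 1 =
      Submodule.span ℂ (Set.range ![leftVec m, jordanVec γ m]) := by
  have hm := h.two_le
  have hspan : ∀ v, v ∈ Submodule.span ℂ (Set.range ![leftVec m, jordanVec γ m]) ↔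
      ∃ a b : ℂ, a • leftVec m + b • jordanVec γ m = v := fun v => by
    rw [Matrix.range_cons, Matrix.range_cons, Matrix.range_empty, Set.union_empty,
      Set.singleton_union, Submodule.mem_span_pair]
  have hT : ∀ v, (Matrix.toLin' (transfer γ m) - (1 : ℂ) • 1) v = (transfer γ m).mulVec v - v :=
    fun v => by simp
  apply le_antisymm
  · intro v hv
    rw [Module.End.mem_maxGenEigenspace] at hv
    obtain ⟨n, hn⟩ := hv
    induction n generalizing v with
    | zero =>
      rw [pow_zero, Module.End.one_apply] at hn
      rw [hn]
      exact Submodule.zero_mem _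
    | succ n ih =>
      rw [pow_succ, Module.End.mul_apply] at hn
      obtain ⟨a, b, hab⟩ := (hspan _).1 (ih hn)
      rw [hT] at hab
      -- The transfer matrix preserves the `|R⟩` component, so `T - 1` never produces one and the
      -- chain stops at length two.
      have hb : b = 0 := by
        have := congrArg (fun w => tailSeq w 0) hab
        simp only [tailSeq_sub, tailSeq_mulVec_zero, sub_self] at this
        simpa [tailSeq, leftVec, jordanVec] using this
      rw [hb, zero_smul, add_zero] at hab
      refine (hspan _).2 ⟨_, _, (eq_add_of_tailSeq_mulVec_eq h fun k _ => ?_).symm⟩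
      have := congrArg (fun w => tailSeq w k) hab
      simp only [tailSeq_sub, tailSeq_smul, tailSeq_leftVec, mul_zero] at this
      exact (sub_eq_zero.1 this.symm)
  · intro v hv
    obtain ⟨a, b, rfl⟩ := (hspan _).1 hv
    rw [Module.End.mem_maxGenEigenspace]
    refine ⟨2, ?_⟩
    have hl : (transfer γ m).mulVec (leftVec m) - leftVec m = 0 := by
      rw [transfer_mulVec_leftVec γ hm, sub_self]
    have hj : (transfer γ m).mulVec (jordanVec γ m) - jordanVec γ m =
        (1 / 2 * stationary γ m 1 : ℂ) • leftVec m := by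
      rw [transfer_mulVec_jordanVec h, add_sub_cancel_left]
    rw [pow_two, Module.End.mul_apply, map_add, map_add, map_smul, map_smul, map_smul, map_smul,
      hT (leftVec m), hT (jordanVec γ m), hl, hj, map_zero, map_smul, hT, hl]
    simp

theorem linearIndependent_jordan_chain (γ : ℝ) (m : ℕ) :
    LinearIndependent ℂ ![leftVec m, jordanVec γ m] := by
  rw [LinearIndependent.pair_iff]
  intro a b hab
  have h0 := congrFun hab (.inl 0)
  have h1 := congrFun hab (.inl 1)
  simp [leftVec, jordanVec] at h0 h1
  exact ⟨h0, h1⟩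

theorem apply_eq_zero_of_pow_apply_eq_zero {V : Type*} [AddCommGroup V] [Module ℂ V]
    {g : Module.End ℂ V} (hg : ∀ v, g (g v) = 0 → g v = 0) {n : ℕ} {v : V} (hv : (g ^ n) v = 0) :
    g v = 0 := by
  induction n with
  | zero =>
    rw [pow_zero, Module.End.one_apply] at hv
    rw [hv, map_zero]
  | succ n ih =>
    rcases n with _ | n
    · simpa using hv
    · apply ih
      rw [pow_succ', pow_succ', Module.End.mul_apply, Module.End.mul_apply] at hv
      rw [pow_succ', Module.End.mul_apply]
      exact hg _ hv

theorem hasSingleJordanBlock_transfer {γ : ℝ} {m : ℕ} (h : IsResonantAngle γ m) :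
    HasSingleJordanBlock (transfer γ m) := by
  have hm := h.two_le
  refine ⟨?_, ?_, fun μ hμ hev => ⟨?_, ?_⟩⟩
  · rw [eigenspace_transfer_one h]
    refine finrank_span_singleton fun h0 => ?_
    have := congrFun h0 (.inl 0)
    simp [leftVec] at this
  · rw [maxGenEigenspace_transfer_one h,
      finrank_span_eq_card (linearIndependent_jordan_chain γ m), Fintype.card_fin]
  · obtain ⟨v, hv, hv0⟩ := hev.exists_hasEigenvector
    rw [Module.End.mem_eigenspace_iff, Matrix.toLin'_apply] at hv
    have hR : tailSeq v 0 = 0 := by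
      have h1 := tailSeq_mulVec_zero γ v
      rw [hv, tailSeq_smul] at h1
      have h2 : (μ - 1) * tailSeq v 0 = 0 := by linear_combination h1
      exact (mul_eq_zero.1 h2).resolve_left (sub_ne_zero.2 hμ)
    have hstep : ∀ k, k + 1 < m → complexStep γ (tailSeq v) (k + 1) = μ * tailSeq v (k + 1) :=
      fun k hk => by rw [← tailSeq_mulVec_succ γ _ hk, hv, tailSeq_smul]
    by_contra hlt
    have hzero : ∀ k < m, tailSeq v k = 0 := fun k hk => by
      by_contra hne
      exact hlt (norm_lt_one_of_complexStep_eq h hR hstep hk hne)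
    apply hv0
    have h1 := transfer_mulVec_left γ hm v
    rw [hv, hzero 1 (by omega), Pi.smul_apply, smul_eq_mul] at h1
    have h2 : (μ - 1) * v (.inl 0) = 0 := by linear_combination h1
    refine ext_of_tailSeq ((mul_eq_zero.1 h2).resolve_left (sub_ne_zero.2 hμ)) (fun k hk => ?_) hm
    rw [hzero k hk]
    simp [tailSeq]
  · apply le_antisymm _ Module.End.eigenspace_le_maxGenEigenspace
    intro v hv
    rw [Module.End.mem_maxGenEigenspace] at hv
    obtain ⟨n, hn⟩ := hv
    have hT : ∀ v, (Matrix.toLin' (transfer γ m) - μ • 1) v = (transfer γ m).mulVec v - μ • v :=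
      fun v => by simp
    have := apply_eq_zero_of_pow_apply_eq_zero (fun v hv => ?_) hn
    · rw [hT, sub_eq_zero] at this
      rwa [Module.End.mem_eigenspace_iff, Matrix.toLin'_apply]
    · rw [hT v] at hv ⊢
      rw [hT] at hv
      set w := (transfer γ m).mulVec v - μ • v with hw
      have htw : ∀ k, tailSeq ((transfer γ m).mulVec w) k = μ * tailSeq w k := fun k => by
        rw [sub_eq_zero.1 hv, tailSeq_smul]
      have htv : ∀ k, tailSeq ((transfer γ m).mulVec v) k = μ * tailSeq v k + tailSeq w k :=
        fun k => by
          rw [hw, tailSeq_sub, tailSeq_smul]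
          ring
      have hw0 : tailSeq w 0 = 0 := by
        have h1 := htw 0
        rw [tailSeq_mulVec_zero] at h1
        have h2 : (μ - 1) * tailSeq w 0 = 0 := by linear_combination -h1
        exact (mul_eq_zero.1 h2).resolve_left (sub_ne_zero.2 hμ)
      have hv0 : tailSeq v 0 = 0 := by
        have h1 := htv 0
        rw [tailSeq_mulVec_zero, hw0] at h1
        have h2 : (μ - 1) * tailSeq v 0 = 0 := by linear_combination -h1
        exact (mul_eq_zero.1 h2).resolve_left (sub_ne_zero.2 hμ)
      have hzero : ∀ k < m, tailSeq w k = 0 := fun k hk =>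
        eq_zero_of_complexStep_sub h hv0 hw0
          (fun k hk => by rw [← tailSeq_mulVec_succ γ _ hk, htv])
          (fun k hk => by rw [← tailSeq_mulVec_succ γ _ hk, htw]) hk
      have h1 := transfer_mulVec_left γ hm w
      rw [sub_eq_zero.1 hv, hzero 1 (by omega), Pi.smul_apply, smul_eq_mul] at h1
      have h2 : (μ - 1) * w (.inl 0) = 0 := by linear_combination h1
      refine ext_of_tailSeq ((mul_eq_zero.1 h2).resolve_left (sub_ne_zero.2 hμ)) (fun k hk => ?_) hm
      rw [hzero k hk]
      simp [tailSeq]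

end Jordan


/-! ### Overlaps of current and charge, and the value of the Mazur bound. -/

section Overlaps

theorem sigmaX_eq : sigmaX = sigmaPlus + sigmaMinus := by
  ext i j; fin_cases i <;> fin_cases j <;> simp [sigmaX, sigmaPlus, sigmaMinus]

theorem sigmaY_eq : sigmaY = (-Complex.I) • (sigmaPlus - sigmaMinus) := by
  ext i j; fin_cases i <;> fin_cases j <;> simp [sigmaY, sigmaPlus, sigmaMinus]

/-- The spin current on the first bond. -/
noncomputable def headCurrent (n : ℕ) : Op (n + 2) :=
  (4 * Complex.I) • (site sigmaPlus (site sigmaMinus 1) - site sigmaMinus (site sigmaPlus 1))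

theorem shift_zero_currentDensity (n : ℕ) : shift (n + 2) 0 currentDensity = headCurrent n := by
  rw [currentDensity, shift_smul, shift_sub, shift_zero_tensor_pair, shift_zero_tensor_pair,
    sigmaX_eq, sigmaY_eq, headCurrent]
  simp only [site_add_left, site_smul_left, site_sub_left, site_add_right, site_smul_right,
    site_sub_right]
  module

theorem spinCurrent_succ (n : ℕ) :
    spinCurrent (n + 2) = site 1 (spinCurrent (n + 1)) + headCurrent n := by
  rw [spinCurrent, sum_shift_succ, shift_zero_currentDensity]
  rfl

theorem spinCurrent_one : spinCurrent 1 = 0 := by simp [spinCurrent]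

/-- Distinct bonds are orthogonal, and each contributes `16 (1/4 + 1/4) = 8`. -/
theorem tracial_spinCurrent_mul_self (n : ℕ) :
    tracial (spinCurrent (n + 1) * spinCurrent (n + 1)) = 8 * n := by
  induction n with
  | zero => simp [spinCurrent_one, tracial_zero]
  | succ n ih =>
    rw [spinCurrent_succ]
    simp only [headCurrent, add_mul, mul_add, site_mul, one_mul, mul_one, smul_mul_assoc,
      mul_smul_comm, sub_mul, mul_sub, tracial_add, tracial_smul, tracial_sub, tracial_site, ih,
      sigmaPlus_mul_sigmaPlus, sigmaMinus_mul_sigmaMinus, trace_one_two, trace_sigmaPlus,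
      trace_sigmaMinus, trace_sigmaPlus_mul_sigmaMinus, trace_sigmaMinus_mul_sigmaPlus,
      Matrix.trace_zero, tracial_one]
    push_cast
    linear_combination (-8 : ℂ) * Complex.I_mul_I

theorem tracial_sigmaPlus_mul_mpoTail_one (γ : ℝ) (n : ℕ) :
    tracial (site sigmaPlus 1 * mpoTail γ (n + 1) 1) = 1 / 2 := by
  rw [mpoTail_succ_succ, mpoTail_zero_right]
  simp only [mul_add, mul_smul_comm, site_mul, tracial_add, tracial_smul, tracial_site, mul_one,
    sigmaPlus_mul_sigmaPlus, trace_sigmaPlus, trace_sigmaPlus_mul_sigmaMinus, Matrix.trace_zero,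
    one_mul, tracial_one, lowering]
  simp

/-- Only the strings `σ⁺ ⊗ σ⁻` on a single bond overlap with the current, each giving `-4i · 1/4`.
-/
theorem tracial_spinCurrent_mul_mpo (γ : ℝ) (n : ℕ) :
    tracial (spinCurrent (n + 1) * mpo γ (n + 1)) = -Complex.I * n := by
  induction n with
  | zero => simp [spinCurrent_one, tracial_zero]
  | succ n ih =>
    have h : mpo γ (n + 1 + 1) = site 1 (mpo γ (n + 1)) + site sigmaPlus (mpoTail γ (n + 1) 1) := rfl
    rw [spinCurrent_succ, h]
    simp only [headCurrent, add_mul, mul_add, site_mul, one_mul, mul_one, smul_mul_assoc, sub_mul,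
      tracial_add, tracial_smul, tracial_sub, tracial_site, ih, sigmaPlus_mul_sigmaPlus,
      trace_one_two, trace_sigmaPlus, trace_sigmaMinus, trace_sigmaMinus_mul_sigmaPlus,
      Matrix.trace_zero, tracial_sigmaPlus_mul_mpoTail_one]
    push_cast
    ring

theorem spinCurrent_isHermitian (n : ℕ) : (spinCurrent n).IsHermitian :=
  bondSum_conjTranspose currentDensity_isHermitian (Finset.range (n - 1))

theorem tracial_spinCurrent_mul_chargeZ (γ : ℝ) (n : ℕ) :
    tracial (spinCurrent (n + 1) * chargeZ (Real.cos γ) (n + 1)) = 2 * n := by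
  have h : tracial (spinCurrent (n + 1) * (mpo γ (n + 1)).conjTranspose) = Complex.I * n := by
    have h1 : spinCurrent (n + 1) * (mpo γ (n + 1)).conjTranspose =
        (mpo γ (n + 1) * spinCurrent (n + 1)).conjTranspose := by
      rw [Matrix.conjTranspose_mul, spinCurrent_isHermitian]
    rw [h1, tracial_conjTranspose, tracial_mul_comm, tracial_spinCurrent_mul_mpo]
    simp
  rw [chargeZ_eq, mul_smul_comm, tracial_smul, mul_sub, tracial_sub, tracial_spinCurrent_mul_mpo, h]
  linear_combination (-2 * n : ℂ) * Complex.I_mul_I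

/-- The family of densities of the spin current. -/
noncomputable def currentFamily : ∀ d : ℕ, Op d
  | 2 => currentDensity
  | _ => 0

theorem spinCurrent_eq_familySum (n : ℕ) :
    spinCurrent n = familySum n currentFamily (Finset.range (n - 1)) := by
  have h : ∀ x ∈ Finset.range n, (∑ e ∈ Finset.range n,
      if Finset.Ico x (x + e + 1) ⊆ Finset.range (n - 1) then shift n x (currentFamily (e + 2))
        else 0) = shift n x currentDensity := by
    intro x hx
    rw [Finset.mem_range] at hx
    rw [Finset.sum_eq_single_of_mem 0 (Finset.mem_range.2 (by omega))]
    · split_ifs with hs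
      · rfl
      · rw [shift_of_not_le]
        intro hx2
        apply hs
        intro i hi
        simp only [Finset.mem_Ico, Finset.mem_range] at hi ⊢
        omega
    · intro e _ he
      have h0 : currentFamily (e + 2) = 0 := by
        obtain ⟨e, rfl⟩ := Nat.exists_eq_succ_of_ne_zero he
        rfl
      rw [h0, shift_zero, ite_self]
  rw [familySum, Finset.sum_congr rfl h, spinCurrent]
  refine Finset.sum_subset (Finset.range_subset_range.2 (by omega)) fun x hx hx' => ?_
  rw [Finset.mem_range] at hx hx'
  exact shift_of_not_le (by omega) _

theorem IsOddFamily.mono {q : ∀ d, Op d} {C C' r : ℝ} (hq : IsOddFamily q C r) (hr : 0 ≤ r)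
    (hC : C ≤ C') : IsOddFamily q C' r :=
  ⟨hq.transpose, fun e => (hq.bound e).trans (mul_le_mul_of_nonneg_right hC (pow_nonneg hr _))⟩

theorem isOddFamily_currentFamily {r : ℝ} (hr : 0 < r) :
    IsOddFamily currentFamily (hs currentDensity / r) r := by
  refine ⟨fun d => ?_, fun e => ?_⟩
  · rcases d with _ | _ | _ | d
    · simp [currentFamily]
    · simp [currentFamily]
    · exact currentDensity_transpose
    · simp [currentFamily]
  · rcases e with _ | e
    · rw [zero_add, zero_add, pow_one, div_mul_cancel₀ _ hr.ne']
      rfl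
    · have h : currentFamily (e + 1 + 2) = 0 := rfl
      rw [h, hs_zero]
      exact mul_nonneg (div_nonneg (hs_nonneg _) hr.le) (pow_nonneg hr.le _)

section Commutator

open scoped Matrix.Norms.L2Operator

theorem norm_tensor_sigmaZ : ‖tensor ![sigmaZ]‖ = 1 := by
  have h1 : sigmaZ.conjTranspose * sigmaZ = 1 := by
    ext i j; fin_cases i <;> fin_cases j <;> simp [sigmaZ, Matrix.mul_apply]
  have h2 : star (tensor ![sigmaZ]) * tensor ![sigmaZ] = 1 := by
    rw [tensor_one_site, Matrix.star_eq_conjTranspose, site_conjTranspose, site_mul, h1,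
      Matrix.conjTranspose_one, one_mul, site_one]
  have h3 := CStarRing.norm_star_mul_self (x := tensor ![sigmaZ])
  rw [h2, CStarRing.norm_one] at h3
  nlinarith [norm_nonneg (tensor ![sigmaZ])]

theorem norm_hamiltonian_chargeZ_commutator_le (γ : ℝ) (n : ℕ) :
    ‖hamiltonian (Real.cos γ) n * chargeZ (Real.cos γ) n -
      chargeZ (Real.cos γ) n * hamiltonian (Real.cos γ) n‖ ≤ 4 := by
  rw [hamiltonian_chargeZ_commutator, norm_smul]
  have h1 := norm_sub_le (shift n 0 (tensor ![sigmaZ])) (shift n (n - 1) (tensor ![sigmaZ]))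
  have h2 := norm_shift_le (n := n) (x := 0) (tensor ![sigmaZ])
  have h3 := norm_shift_le (n := n) (x := n - 1) (tensor ![sigmaZ])
  rw [norm_tensor_sigmaZ] at h2 h3
  have h4 : ‖(-2 * Complex.I : ℂ)‖ = 2 := by simp
  rw [h4]
  linarith

end Commutator

/-- Normalized squared norm of the charge in the thermodynamic limit. -/
noncomputable def chargeNorm (γ : ℝ) (m : ℕ) : ℝ := ((m : ℝ) - 1) / (m * Real.sin γ ^ 2)

theorem IsResonantAngle.sin_pos {γ : ℝ} {m : ℕ} (h : IsResonantAngle γ m) :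
    0 < Real.sin γ ^ 2 := by
  have := h.sin_sq_pos one_pos h.two_le
  rwa [Nat.cast_one, one_mul] at this

theorem IsResonantAngle.one_lt_cast {γ : ℝ} {m : ℕ} (h : IsResonantAngle γ m) : (1 : ℝ) < m := by
  exact_mod_cast h.two_le

theorem chargeNorm_pos {γ : ℝ} {m : ℕ} (h : IsResonantAngle γ m) : 0 < chargeNorm γ m := by
  have h1 := h.sin_pos
  have h2 := h.one_lt_cast
  exact div_pos (by linarith) (mul_pos (by linarith) h1)

theorem tendsto_tracial_chargeZ_mul_self_div {γ : ℝ} {m : ℕ} (h : IsResonantAngle γ m) :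
    Tendsto (fun n : ℕ => tracial (chargeZ (Real.cos γ) n * chargeZ (Real.cos γ) n) / n) atTop
      (𝓝 (chargeNorm γ m : ℂ)) := by
  have h1 := (Complex.continuous_ofReal.tendsto _).comp ((tendsto_hs_mpo_sq_div h).const_mul 2)
  have h2 : 2 * (((m : ℝ) - 1) / (2 * m * Real.sin γ ^ 2)) = chargeNorm γ m := by
    rw [chargeNorm]
    have := h.sin_pos
    have := h.one_lt_cast
    field_simp
  rw [h2] at h1
  refine h1.congr fun n => ?_
  rw [tracial_chargeZ_mul_self]
  simp only [Function.comp_apply]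
  push_cast
  ring

theorem tendsto_affine_div (c : ℂ) {f : ℕ → ℂ} (hf : ∀ n : ℕ, f (n + 1) = c * n) :
    Tendsto (fun n : ℕ => f n / n) atTop (𝓝 c) := by
  rw [← tendsto_add_atTop_iff_nat 1]
  have h1 := (tendsto_natCast_div_add_atTop (1 : ℂ)).const_mul c
  rw [mul_one] at h1
  refine h1.congr fun n => ?_
  rw [hf]
  push_cast
  ring

theorem tendsto_tracial_spinCurrent_mul_chargeZ_div (γ : ℝ) :
    Tendsto (fun n : ℕ => tracial (spinCurrent n * chargeZ (Real.cos γ) n) / n) atTop (𝓝 2) :=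
  tendsto_affine_div 2 (tracial_spinCurrent_mul_chargeZ γ)

/-- The right-hand side of the Mazur inequality for the charge. -/
theorem tendsto_mazur_ratio {γ : ℝ} {m : ℕ} (h : IsResonantAngle γ m) :
    Tendsto (fun n : ℕ => (1 / 2 : ℂ) * (1 / n) *
      (tracial (spinCurrent n * chargeZ (Real.cos γ) n) ^ 2 /
        tracial (chargeZ (Real.cos γ) n * chargeZ (Real.cos γ) n))) atTop
      (𝓝 ((2 ^ 2 / (2 * chargeNorm γ m) : ℝ) : ℂ)) := by
  have h1 := (((tendsto_tracial_spinCurrent_mul_chargeZ_div γ).pow 2).div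
    (tendsto_tracial_chargeZ_mul_self_div h)
    (by exact_mod_cast (chargeNorm_pos h).ne')).const_mul (1 / 2)
  have h2 : ((2 ^ 2 / (2 * chargeNorm γ m) : ℝ) : ℂ) = 1 / 2 * (2 ^ 2 / (chargeNorm γ m : ℂ)) := by
    push_cast
    ring
  rw [h2]
  refine h1.congr' ?_
  filter_upwards [eventually_ne_atTop 0] with n hn
  have hn' : (n : ℂ) ≠ 0 := by exact_mod_cast hn
  simp only [Pi.div_apply]
  field_simp

theorem tendsto_div_transfer_pow {γ : ℝ} {m : ℕ} (h : IsResonantAngle γ m) :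
    Tendsto (fun n : ℕ => (1 / 4 : ℂ) * (n / (transfer γ m ^ n) (.inl 0) (.inl 1))) atTop
      (𝓝 ((1 / (2 * chargeNorm γ m) : ℝ) : ℂ)) := by
  have h1 := ((tendsto_tracial_chargeZ_mul_self_div h).inv₀
    (by exact_mod_cast (chargeNorm_pos h).ne')).const_mul (1 / 2)
  have h2 : ((1 / (2 * chargeNorm γ m) : ℝ) : ℂ) = 1 / 2 * (chargeNorm γ m : ℂ)⁻¹ := by
    push_cast
    ring
  rw [h2]
  refine h1.congr fun n => ?_
  rw [transfer_pow_apply h, tracial_chargeZ_mul_self, inv_div, ← div_div]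
  ring

/-- The bounds on the Drude weights at a resonant anisotropy. -/
theorem drude_weight_bounds_of_isResonantAngle {γ : ℝ} {m : ℕ} (h : IsResonantAngle γ m) :
    (∀ᶠ β : ℝ in 𝓝[>] 0, ∃ D : ℝ, IsThermalDrudeWeight (Real.cos γ) β D) ∧
    (∀ ε : ℝ, 0 < ε → ∀ᶠ β : ℝ in 𝓝[>] 0, ∀ D : ℝ,
      IsThermalDrudeWeight (Real.cos γ) β D → 2 ^ 2 / (2 * chargeNorm γ m) - ε ≤ D / β) ∧
    ∃ κ : ℝ, IsInfiniteTemperatureDrudeRatio (Real.cos γ) κ ∧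
      2 ^ 2 / (2 * chargeNorm γ m) ≤ κ := by
  obtain ⟨C, r, hC, hr, hr1, hq⟩ := exists_isOddFamily_chargeDensity h
  refine drude_weight_bounds (Real.cos γ) hr hr1 (hC.trans (le_max_left C (hs currentDensity / r)))
    ((isOddFamily_currentFamily hr).mono hr.le (le_max_right _ _)) (hq.mono hr.le (le_max_left _ _))
    spinCurrent_eq_familySum spinCurrent_isHermitian (fun n => ?_) (fun n => ?_)
    (L := 8) (by norm_num) (chargeNorm_pos h) ?_ ?_ ?_
  · rw [← chargeZ_eq_familySum]
    exact chargeZ_isHermitian γ n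
  · rw [← chargeZ_eq_familySum]
    exact norm_hamiltonian_chargeZ_commutator_le γ n
  · exact_mod_cast tendsto_affine_div 8 tracial_spinCurrent_mul_self
  · simp only [← chargeZ_eq_familySum]
    exact_mod_cast tendsto_tracial_spinCurrent_mul_chargeZ_div γ
  · simp only [← chargeZ_eq_familySum]
    exact tendsto_tracial_chargeZ_mul_self_div h

end Overlaps


/-! ### Resonant angles: dependence on the denominator, density, discontinuity. -/

section Resonances

theorem isResonantAngle_of_isCoprime {l : ℤ} {m : ℕ} (hm : 2 ≤ m) (hlm : IsCoprime l (m : ℤ)) :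
    IsResonantAngle (Real.pi * l / m) m := by
  have hm0 : (m : ℝ) ≠ 0 := by exact_mod_cast (by omega : m ≠ 0)
  refine ⟨hm, ?_, fun k hk0 hk h => ?_⟩
  · rw [mul_div_cancel₀ _ hm0, mul_comm]
    exact Real.sin_int_mul_pi l
  · obtain ⟨n, hn⟩ := Real.sin_eq_zero_iff.1 h
    have h1 : (n * m : ℝ) = l * k := by
      have h2 : (n * m - l * k : ℝ) * Real.pi = 0 := by
        rw [sub_mul, mul_right_comm, hn]
        field_simp
        ring
      exact sub_eq_zero.1 ((mul_eq_zero.1 h2).resolve_right Real.pi_ne_zero)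
    have h3 : n * (m : ℤ) = l * (k : ℤ) := by exact_mod_cast h1
    have h4 : (m : ℤ) ∣ k := hlm.symm.dvd_of_dvd_mul_left ⟨n, by rw [← h3, mul_comm]⟩
    exact absurd (Nat.le_of_dvd hk0 (Int.natCast_dvd_natCast.1 h4)) (by omega)

/-- The Chebyshev polynomial `T_k` shows that `cos(kγ)`, and with it `sin²(kγ)`, depends on `cos γ`
only. The denominator is therefore a function of the anisotropy. -/
theorem sin_natCast_mul_eq_zero_of_cos_eq {γ γ' : ℝ} (h : Real.cos γ = Real.cos γ') {k : ℕ}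
    (hk : Real.sin (k * γ) = 0) : Real.sin (k * γ') = 0 := by
  have h1 : Real.cos (k * γ) = Real.cos (k * γ') := by
    have h2 := Polynomial.Chebyshev.T_real_cos γ k
    have h3 := Polynomial.Chebyshev.T_real_cos γ' k
    rw [h, h3] at h2
    exact_mod_cast h2.symm
  have h2 := Real.sin_sq_add_cos_sq (k * γ)
  have h3 := Real.sin_sq_add_cos_sq (k * γ')
  rw [hk, h1] at h2
  exact pow_eq_zero_iff two_ne_zero |>.1 (by linarith)

/-- The denominator of a resonant angle is determined by its cosine. -/
theorem IsResonantAngle.eq_of_cos_eq {γ γ' : ℝ} {m m' : ℕ} (h : IsResonantAngle γ m)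
    (h' : IsResonantAngle γ' m') (hcos : Real.cos γ = Real.cos γ') : m = m' := by
  have hm := h.two_le
  have hm' := h'.two_le
  rcases lt_trichotomy m m' with hlt | heq | hlt
  · exact absurd (sin_natCast_mul_eq_zero_of_cos_eq hcos h.sin_mul) (h'.sin_ne m (by omega) hlt)
  · exact heq
  · exact absurd (sin_natCast_mul_eq_zero_of_cos_eq hcos.symm h'.sin_mul)
      (h.sin_ne m' (by omega) hlt)

open scoped Classical in
/-- The lower bound `(1 - Δ²) m / (2 (m - 1))` at `Δ = cos(π l / m)`. -/
noncomputable def drudeBound (Δ : ℝ) : ℝ :=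
  if h : ∃ γ m, IsResonantAngle γ m ∧ Δ = Real.cos γ then
    1 / 2 * (1 - Δ ^ 2) * ((h.choose_spec.choose : ℝ) / ((h.choose_spec.choose : ℝ) - 1))
  else 0

theorem drudeBound_cos {γ : ℝ} {m : ℕ} (h : IsResonantAngle γ m) :
    drudeBound (Real.cos γ) = 1 / 2 * (1 - Real.cos γ ^ 2) * ((m : ℝ) / ((m : ℝ) - 1)) := by
  have hex : ∃ γ' m, IsResonantAngle γ' m ∧ Real.cos γ = Real.cos γ' := ⟨γ, m, h, rfl⟩
  have hspec := hex.choose_spec.choose_spec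
  rw [drudeBound, dif_pos hex, ← h.eq_of_cos_eq hspec.1 hspec.2]

theorem drudeBound_eq_chargeNorm {γ : ℝ} {m : ℕ} (h : IsResonantAngle γ m) :
    drudeBound (Real.cos γ) = 1 / (2 * chargeNorm γ m) := by
  have h1 := h.sin_pos
  have h2 := h.one_lt_cast
  have h3 : (m : ℝ) - 1 ≠ 0 := by linarith
  rw [drudeBound_cos h, chargeNorm, ← Real.sin_sq]
  field_simp

theorem cos_mem_resonant {l : ℤ} {m : ℕ} (hm : 2 ≤ m) (hlm : IsCoprime l (m : ℤ)) :
    Real.cos (Real.pi * l / m) ∈ resonant := ⟨l, m, hm, hlm, rfl⟩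

/-- The fractions `(⌊a n⌋ n + 1) / n²` approximate `a`, and their numerators are `1` modulo `n`,
hence coprime to the denominators. -/
theorem Icc_subset_closure_resonant : Set.Icc (-1) 1 ⊆ closure resonant := by
  intro x hx
  obtain ⟨a, ha⟩ : ∃ a, a = Real.arccos x / Real.pi := ⟨_, rfl⟩
  have hlim : Tendsto (fun n : ℕ => (⌊a * n⌋₊ : ℝ) / n + 1 / (n : ℝ) ^ 2) atTop (𝓝 (a + 0)) := by
    refine Tendsto.add ?_ ?_
    · exact (tendsto_nat_floor_mul_div_atTop
        (ha ▸ div_nonneg (Real.arccos_nonneg x) Real.pi_pos.le)).comp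
        tendsto_natCast_atTop_atTop
    · exact tendsto_const_div_pow 1 2 two_ne_zero |>.comp tendsto_natCast_atTop_atTop
  have hcos : Tendsto (fun n : ℕ => Real.cos (Real.pi * ((⌊a * n⌋₊ * n + 1 : ℤ) : ℝ) /
      ((n ^ 2 : ℕ) : ℝ))) atTop (𝓝 x) := by
    have h1 := (Real.continuous_cos.tendsto _).comp (hlim.const_mul Real.pi)
    have h2 : Real.pi * (a + 0) = Real.arccos x := by
      rw [add_zero, ha, mul_div_cancel₀ _ Real.pi_ne_zero]
    rw [h2, Real.cos_arccos hx.1 hx.2] at h1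
    refine h1.congr' ?_
    filter_upwards [eventually_ne_atTop 0] with n hn
    have hn' : (n : ℝ) ≠ 0 := by exact_mod_cast hn
    simp only [Function.comp_apply]
    congr 1
    push_cast
    field_simp
  refine mem_closure_of_tendsto hcos ?_
  filter_upwards [eventually_ge_atTop 2] with n hn
  refine cos_mem_resonant (by nlinarith) ?_
  push_cast
  exact IsCoprime.pow_right ⟨1, -⌊a * n⌋₊, by ring⟩

/-- Near each resonant anisotropy there are resonant anisotropies of large denominator. -/
theorem not_continuousWithinAt_drudeBound {Δ : ℝ} (hΔ : Δ ∈ resonant) :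
    ¬ ContinuousWithinAt drudeBound resonant Δ := by
  obtain ⟨l, m, hm, hlm, rfl⟩ := hΔ
  intro hcont
  have h := isResonantAngle_of_isCoprime hm hlm
  have hm0 : (m : ℝ) ≠ 0 := by exact_mod_cast (by omega : m ≠ 0)
  -- The numerator is `1` modulo `n m`, so the fraction has exact denominator `n m²`, while it
  -- differs from `l / m` only by `1 / (n m²)`.
  set γ : ℕ → ℝ := fun n => Real.pi * ((l * n * m + 1 : ℤ) : ℝ) / ((n * m ^ 2 : ℕ) : ℝ)
  have hco : ∀ n : ℕ, IsCoprime (l * n * m + 1) ((n * m ^ 2 : ℕ) : ℤ) := fun n => by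
    have h1 : IsCoprime (l * n * m + 1) (n * m : ℤ) := ⟨1, -l, by ring⟩
    push_cast
    rw [sq, ← mul_assoc]
    exact h1.mul_right (IsCoprime.of_mul_right_right h1)
  have hinv : Tendsto (fun n : ℕ => 1 / ((n : ℝ) * m ^ 2)) atTop (𝓝 0) := by
    have h1 := (tendsto_const_div_atTop_nhds_zero_nat (1 : ℝ)).mul_const (1 / (m : ℝ) ^ 2)
    rw [zero_mul] at h1
    exact h1.congr fun n => by rw [div_mul_div_comm, one_mul]
  have hγ : Tendsto γ atTop (𝓝 (Real.pi * l / m)) := by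
    have h1 := (hinv.const_mul Real.pi).const_add (Real.pi * l / m)
    rw [mul_zero, add_zero] at h1
    refine h1.congr' ?_
    filter_upwards [eventually_ne_atTop 0] with n hn
    have hn' : (n : ℝ) ≠ 0 := by exact_mod_cast hn
    simp only [γ]
    push_cast
    field_simp
  have hcosγ : Tendsto (fun n => Real.cos (γ n)) atTop (𝓝 (Real.cos (Real.pi * l / m))) :=
    (Real.continuous_cos.tendsto _).comp hγ
  have hlarge : ∀ᶠ n : ℕ in atTop, 2 ≤ n * m ^ 2 := by
    filter_upwards [eventually_ge_atTop 1] with n hn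
    nlinarith
  have hdrude := hcont.tendsto.comp (tendsto_nhdsWithin_iff.2 ⟨hcosγ, by
    filter_upwards [hlarge] with n hn
    exact cos_mem_resonant hn (hco n)⟩)
  have hratio : Tendsto (fun n : ℕ => (1 - 1 / ((n : ℝ) * m ^ 2))⁻¹) atTop (𝓝 1) := by
    have h1 := (hinv.const_sub 1).inv₀ (by norm_num)
    rwa [sub_zero, inv_one] at h1
  have hlim : Tendsto (drudeBound ∘ fun n => Real.cos (γ n)) atTop
      (𝓝 (1 / 2 * (1 - Real.cos (Real.pi * l / m) ^ 2) * 1)) := by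
    refine ((((hcosγ.pow 2).const_sub 1).const_mul (1 / 2)).mul hratio).congr' ?_
    filter_upwards [hlarge] with n hn
    have h1 := isResonantAngle_of_isCoprime hn (hco n)
    have h2 := h1.one_lt_cast
    have h3 : (n : ℝ) * m ^ 2 - 1 ≠ 0 := by
      push_cast at h2
      linarith
    have h4 : (n : ℝ) * m ^ 2 ≠ 0 := by
      push_cast at h2
      linarith
    simp only [Function.comp_apply]
    rw [drudeBound_cos h1]
    congr 1
    push_cast
    rw [one_sub_div h4, inv_div]
  have heq := tendsto_nhds_unique hdrude hlim
  rw [drudeBound_cos h, ← Real.sin_sq] at heq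
  have h1 := h.sin_pos
  have h2 := h.one_lt_cast
  -- Since `sin² γ ≠ 0`, continuity would force `m / (m - 1) = 1`.
  have h3 := mul_left_cancel₀ (by positivity) heq
  rw [div_eq_one_iff_eq (by linarith)] at h3
  linarith

end Resonances

end XXZ

/-! ### Assembly of the theorem. -/

theorem mainTheorem8 :
    ∃ DZ : ℝ → ℝ,
      (∀ (l : ℤ) (m : ℕ) (γ Δ : ℝ), 2 ≤ m → IsCoprime l (m : ℤ) →
        γ = Real.pi * l / m → Δ = Real.cos γ →
        -- the charge is almost conserved and pseudo-local
        (∀ n : ℕ, XXZ.hamiltonian Δ n * XXZ.chargeZ Δ n - XXZ.chargeZ Δ n * XXZ.hamiltonian Δ n =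
          (-2 * Complex.I) • (XXZ.shift n 0 (XXZ.tensor ![XXZ.sigmaZ]) -
            XXZ.shift n (n - 1) (XXZ.tensor ![XXZ.sigmaZ]))) ∧
        XXZ.IsPseudoLocal (XXZ.chargeZ Δ) ∧
        -- its norm is given by the transfer matrix, whose Jordan structure yields the constant
        (∀ n : ℕ, XXZ.tracial (XXZ.chargeZ Δ n * XXZ.chargeZ Δ n) =
          2 * (XXZ.transfer γ m ^ n) (Sum.inl 0) (Sum.inl 1)) ∧
        XXZ.HasSingleJordanBlock (XXZ.transfer γ m) ∧
        Tendsto (fun n : ℕ =>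
          (1 / 4 : ℂ) * (n / (XXZ.transfer γ m ^ n) (Sum.inl 0) (Sum.inl 1)))
          atTop (𝓝 (DZ Δ : ℂ)) ∧
        DZ Δ = 1 / 2 * (1 - Δ ^ 2) * ((m : ℝ) / ((m : ℝ) - 1)) ∧
        -- the right-hand side of the Mazur inequality for this single charge is `4 DZ`
        Tendsto (fun n : ℕ => (1 / 2 : ℂ) * (1 / n) *
          (XXZ.tracial (XXZ.spinCurrent n * XXZ.chargeZ Δ n) ^ 2 /
            XXZ.tracial (XXZ.chargeZ Δ n * XXZ.chargeZ Δ n)))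
          atTop (𝓝 (4 * DZ Δ : ℂ)) ∧
        -- the bound on the thermal Drude weight at high temperature
        (∀ᶠ β : ℝ in 𝓝[>] 0, ∃ D : ℝ, XXZ.IsThermalDrudeWeight Δ β D) ∧
        (∀ ε : ℝ, 0 < ε → ∀ᶠ β : ℝ in 𝓝[>] 0, ∀ D : ℝ,
          XXZ.IsThermalDrudeWeight Δ β D → 4 * DZ Δ - ε ≤ D / β) ∧
        -- the same bound at infinite temperature
        (∃ κ : ℝ, XXZ.IsInfiniteTemperatureDrudeRatio Δ κ ∧ 4 * DZ Δ ≤ κ)) ∧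
      -- the bound, defined on a dense set of anisotropies, is nowhere continuous
      Set.Icc (-1) 1 ⊆ closure XXZ.resonant ∧
      ∀ Δ ∈ XXZ.resonant, ¬ ContinuousWithinAt DZ XXZ.resonant Δ := by

  refine ⟨XXZ.drudeBound, ?_, XXZ.Icc_subset_closure_resonant,
    fun Δ hΔ => XXZ.not_continuousWithinAt_drudeBound hΔ⟩
  rintro l m γ Δ hm hlm rfl rfl
  have h := XXZ.isResonantAngle_of_isCoprime hm hlm
  have hD := XXZ.drudeBound_eq_chargeNorm h
  have hD4 : 4 * XXZ.drudeBound (Real.cos (Real.pi * l / m)) =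
      2 ^ 2 / (2 * XXZ.chargeNorm (Real.pi * l / m) m) := by
    rw [hD]
    ring
  obtain ⟨h1, h2, h3⟩ := XXZ.drude_weight_bounds_of_isResonantAngle h
  refine ⟨XXZ.hamiltonian_chargeZ_commutator _, XXZ.isPseudoLocal_chargeZ h, fun n => ?_,
    XXZ.hasSingleJordanBlock_transfer h, ?_, XXZ.drudeBound_cos h, ?_, h1, ?_, ?_⟩
  · rw [XXZ.transfer_pow_apply h, XXZ.tracial_chargeZ_mul_self]
  · rw [hD]
    exact XXZ.tendsto_div_transfer_pow h
  · have h4 := XXZ.tendsto_mazur_ratio h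
    rw [← hD4] at h4
    exact_mod_cast h4
  · rw [hD4]
    exact h2
  · rw [hD4]
    exact h3
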